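/- **Theorem (cohomology of the nilpotent supersymmetries on the lattice).** Consider bosonic variables $\phi_{\pm n},F_{\pm n}$ and fermionic (mutually anticommuting) variables $\chi_{\pm n},\bar\chi_{\pm n}$, $n\in\mathbb Z$. They have fermion number $N_F=0$ for $\phi_\pm,F_\pm$, $N_F=1$ for $\chi_\pm$ and $N_F=-1$ for $\bar\chi_\pm$. A functional is a formal, possibly infinite, complex linear combination of monomials in these variables. A coefficient $C:\mathbb Z^{I+1}\to\mathbb C$ is a *translationally invariant local coefficient* (TILC) if $C_{m_0+1,\dots,m_I+1}=C_{m_0,\dots,m_I}$ and for each $\ell\in\{1,\dots,I\}$ there are $M,L>0$ and $r$ such that $|C_{m_0,\dots,m_I}|<L\,e^{-M|m_0-m_\ell|}$ for all $(m_0,\dots,m_I)$ with $|m_0-m_\ell|\ge r$. A functional is *local* if it is a finite sum of functionals $\sum_{m_0,\dots,m_I}C_{m_0\dots m_I}X^0_{m_0}\cdots X^I_{m_I}$, each $X^i$ one of the eight fields and $C$ a TILC. Write $\mathcal O(n_+,n_-)$ for the functionals all of whose monomials contain exactly $n_+$ fields with label $+$ and $n_-$ fields with label $-$. Let $\nabla=(\nabla_{mn})_{m,n\in\mathbb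 Z}$ be a local difference operator, that is, a nonzero TILC with $\sum_m\nabla_{mn}=0$; put $(\nabla\phi)_m=\sum_n\nabla_{mn}\phi_n$ and $A\cdot B=\sum_nA_nB_n$. With left derivatives for the fermionic variables, set $$Q_+=\bar\chi_+\cdot\tfrac{\partial}{\partial\phi_+}+F_+\cdot\tfrac{\partial}{\partial\chi_+}-i\nabla\phi_-\cdot\tfrac{\partial}{\partial\chi_-}-i\nabla\bar\chi_-\cdot\tfrac{\partial}{\partial F_-},$$ $$Q_-=i\nabla\phi_+\cdot\tfrac{\partial}{\partial\chi_+}-i\nabla\bar\chi_+\cdot\tfrac{\partial}{\partial F_+}-\bar\chi_-\cdot\tfrac{\partial}{\partial\phi_-}+F_-\cdot\tfrac{\partial}{\partial\chi_-}.$$ For $k\ge 0$, a *CLR term* of order $k+1$ with label $\pm$ is a functional $\sum_{m,n_1,\dots,n_k}C_{mn_1\cdots n_k}\,\chi_{\pm m}\phi_{\pm n_1}\cdots\phi_{\pm n_k}$ where $C$ is a TILC that is totally symmetric in its last $k$ indices and obeys the cyclic Leibniz rule: for all $n_0,\dots,n_k\in\mathbb Z$, $$\sum_{p}\sum_m\nabla_{m\,n_{p(0)}}C_{m\,n_{p(1)}\cdots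 n_{p(k)}}=0,$$ the outer sum being over the $k+1$ cyclic permutations $p$ of $\{0,1,\dots,k\}$. Let $S$ be any finite set of non-negative integers. (i) If $\mathcal P_+$ is a local functional with $N_F=1$ in $\bigoplus_{k\in S}\mathcal O(k+1,0)$ and $Q_-\mathcal P_+=0$, then $$\mathcal P_+=\sum_{k\in S}\mathcal C_k+Q_-\mathcal Q_+,$$ where $\mathcal C_k$ is a CLR term of order $k+1$ with label $+$ for each $k\in S$, and $\mathcal Q_+$ is a local functional with $N_F=2$ in $\bigoplus_{k\in S}\mathcal O(k+1,0)$. (ii) If $\mathcal P_-$ is a local functional with $N_F=1$ in $\bigoplus_{k\in S}\mathcal O(0,k+1)$ and $Q_+\mathcal P_-=0$, then $$\mathcal P_-=\sum_{k\in S}\mathcal C_k+Q_+\mathcal Q_-,$$ where $\mathcal C_k$ is a CLR term of order $k+1$ with label $-$ for each $k\in S$, and $\mathcal Q_-$ is a local functional with $N_F=2$ in $\bigoplus_{k\in S}\mathcal O(0,k+1)$. -/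

import Mathlib

/- Formal functionals of the eight lattice fields `φ±, F±` (bosonic) and `χ±, χ̄±` (fermionic) on the
infinite one-dimensional lattice `ℤ`, and the two nilpotent supersymmetries acting on them. -/

namespace LatticeSUSY

noncomputable section

/-- The label `±` carried by every field. -/
inductive Charge
  | plus
  | minus
  deriving DecidableEq

/-- The bosonic kinds: `φ` and the auxiliary field `F`. -/
inductive BosonKind
  | phi
  | aux
  deriving DecidableEq

/-- The fermionic kinds: `χ` and `χ̄`. -/
inductive FermionKind
  | chi
  | chiBar
  deriving DecidableEq

/-- A bosonic variable `φ_{±n}` or `F_{±n}`. -/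
abbrev Boson := BosonKind × Charge × ℤ

/-- A fermionic variable `χ_{±n}` or `χ̄_{±n}`. -/
abbrev Fermion := FermionKind × Charge × ℤ

/-- A fixed enumeration of the fermionic variables. It is injective and only serves to choose the
order in which the anticommuting variables of a basis monomial are written. -/
def rank : Fermion → ℤ
  | (.chi, .plus, n) => 4 * n
  | (.chiBar, .plus, n) => 4 * n + 1
  | (.chi, .minus, n) => 4 * n + 2
  | (.chiBar, .minus, n) => 4 * n + 3

theorem rank_injective : Function.Injective rank := by
  rintro ⟨k, c, n⟩ ⟨k', c', n'⟩ h
  cases k <;> cases c <;> cases k' <;> cases c' <;> simp [rank] at h ⊢ <;> omega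

/-- Formal (possibly infinite) complex linear combinations of the basis monomials
`(∏ b, b ^ a b) * ψ₁ ⋯ ψᵣ`, where `a` gives the exponents of the bosonic variables and
`A = {ψ₁, …, ψᵣ}` with `rank ψ₁ < ⋯ < rank ψᵣ`; `f a A` is the coefficient of that monomial. -/
abbrev Functional := (Boson →₀ ℕ) → Finset Fermion → ℂ

/-- The functional `1`. -/
def one : Functional := fun a A => if a = 0 ∧ A = ∅ then 1 else 0

/-- The sign from moving `ψ` past the members of `A` that precede it. -/
def moveSign (ψ : Fermion) (A : Finset Fermion) : ℂ :=
  (-1) ^ (A.filter (fun ξ => rank ξ < rank ψ)).card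

/-- Multiplication by a bosonic variable. -/
def mulBoson (b : Boson) (f : Functional) : Functional :=
  fun a A => if a b = 0 then 0 else f (a - Finsupp.single b 1) A

/-- The partial derivative with respect to a bosonic variable. -/
def derivBoson (b : Boson) (f : Functional) : Functional :=
  fun a A => ((a b : ℂ) + 1) * f (a + Finsupp.single b 1) A

/-- Multiplication from the left by a fermionic variable. -/
def mulFermion (ψ : Fermion) (f : Functional) : Functional :=
  fun a A => if ψ ∈ A then moveSign ψ (A.erase ψ) * f a (A.erase ψ) else 0

/-- The left derivative with respect to a fermionic variable. -/
def derivFermion (ψ : Fermion) (f : Functional) : Functional :=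
  fun a A => if ψ ∈ A then 0 else moveSign ψ A * f a (insert ψ A)

/-- The eight species of fields. -/
abbrev Species := (BosonKind ⊕ FermionKind) × Charge

/-- Multiplication from the left by the field of the given species at the given site. -/
def mulField : Species × ℤ → Functional → Functional
  | ((.inl b, σ), n) => mulBoson (b, σ, n)
  | ((.inr ψ, σ), n) => mulFermion (ψ, σ, n)

/-- The product, in the given order, of a list of field variables. -/
def fieldProduct : List (Species × ℤ) → Functional
  | [] => one
  | x :: l => mulField x (fieldProduct l)

/-- The functional `∑_m C_m X⁰_{m₀} X¹_{m₁} ⋯`, where `Xⁱ` is the field of species `s i`. A basis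
monomial receives contributions from finitely many `m` only, so the sum is purely formal. -/
def siteSum {n : ℕ} (s : Fin n → Species) (C : (Fin n → ℤ) → ℂ) : Functional :=
  fun a A => ∑ᶠ m : Fin n → ℤ, C m * fieldProduct (List.ofFn fun i => (s i, m i)) a A

/-- Translationally invariant local coefficients `C_{m₀ m₁ … m_I}`: invariant under a simultaneous
shift of all sites, and exponentially damped in each of the site differences `m₀ - m_ℓ`. -/
structure IsTILC {I : ℕ} (C : (Fin (I + 1) → ℤ) → ℂ) : Prop where
  translation : ∀ m : Fin (I + 1) → ℤ, C (fun i => m i + 1) = C m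
  locality : ∀ l : Fin I, ∃ M > (0 : ℝ), ∃ L > (0 : ℝ), ∃ r : ℤ, ∀ m : Fin (I + 1) → ℤ,
    r ≤ |m 0 - m l.succ| → ‖C m‖ < L * Real.exp (-M * |((m 0 - m l.succ : ℤ) : ℝ)|)

/-- Local difference operators `∇_{mn}`: a nonzero TILC with two indices that annihilates
constants. -/
structure IsDifferenceOperator (D : ℤ → ℤ → ℂ) : Prop where
  tilc : IsTILC (fun m : Fin 2 → ℤ => D (m 0) (m 1))
  sum_eq_zero : ∑' m : ℤ, D m 0 = 0
  ne_zero : D ≠ 0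

/-- Local functionals: finite sums of functionals `∑_m C_m X⁰_{m₀} ⋯ X^I_{m_I}` with `C` a TILC. -/
def IsLocal (f : Functional) : Prop :=
  f ∈ Submodule.span ℂ {g : Functional | ∃ (I : ℕ) (s : Fin (I + 1) → Species)
    (C : (Fin (I + 1) → ℤ) → ℂ), IsTILC C ∧ g = siteSum s C}

/-- The number of fields with label `σ` in a basis monomial. -/
def fieldCount (σ : Charge) (a : Boson →₀ ℕ) (A : Finset Fermion) : ℕ :=
  (a.sum fun b e => if b.2.1 = σ then e else 0) + (A.filter fun ψ => ψ.2.1 = σ).card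

/-- The fermion number of a basis monomial: `1` for each `χ±` and `-1` for each `χ̄±`. -/
def fermionNumber (A : Finset Fermion) : ℤ :=
  ((A.filter fun ψ => ψ.1 = .chi).card : ℤ) - (A.filter fun ψ => ψ.1 = .chiBar).card

/-- All monomials of `f` have fermion number `N`. -/
def HasFermionNumber (N : ℤ) (f : Functional) : Prop :=
  ∀ a A, f a A ≠ 0 → fermionNumber A = N

/-- Every monomial of `f` consists of `p` fields with label `+` and `q` fields with label `-` for
some `(p, q)` in the given set; for a singleton `{(n₊, n₋)}` this says that `f` is of the type
`𝒪(n₊, n₋)`. -/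
def InSector (T : Set (ℕ × ℕ)) (f : Functional) : Prop :=
  ∀ a A, f a A ≠ 0 → (fieldCount .plus a A, fieldCount .minus a A) ∈ T

/-- `Q₊ = χ̄₊·∂/∂φ₊ + F₊·∂/∂χ₊ - i∇φ₋·∂/∂χ₋ - i∇χ̄₋·∂/∂F₋`. -/
def Qplus (D : ℤ → ℤ → ℂ) (f : Functional) : Functional := fun a A =>
  (∑' n : ℤ, mulFermion (.chiBar, .plus, n) (derivBoson (.phi, .plus, n) f) a A)
  + (∑' n : ℤ, mulBoson (.aux, .plus, n) (derivFermion (.chi, .plus, n) f) a A)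
  - Complex.I * (∑' p : ℤ × ℤ, D p.1 p.2 *
      mulBoson (.phi, .minus, p.2) (derivFermion (.chi, .minus, p.1) f) a A)
  - Complex.I * (∑' p : ℤ × ℤ, D p.1 p.2 *
      mulFermion (.chiBar, .minus, p.2) (derivBoson (.aux, .minus, p.1) f) a A)

/-- `Q₋ = i∇φ₊·∂/∂χ₊ - i∇χ̄₊·∂/∂F₊ - χ̄₋·∂/∂φ₋ + F₋·∂/∂χ₋`. -/
def Qminus (D : ℤ → ℤ → ℂ) (f : Functional) : Functional := fun a A =>
  Complex.I * (∑' p : ℤ × ℤ, D p.1 p.2 *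
      mulBoson (.phi, .plus, p.2) (derivFermion (.chi, .plus, p.1) f) a A)
  - Complex.I * (∑' p : ℤ × ℤ, D p.1 p.2 *
      mulFermion (.chiBar, .plus, p.2) (derivBoson (.aux, .plus, p.1) f) a A)
  - (∑' n : ℤ, mulFermion (.chiBar, .minus, n) (derivBoson (.phi, .minus, n) f) a A)
  + (∑' n : ℤ, mulBoson (.aux, .minus, n) (derivFermion (.chi, .minus, n) f) a A)

/-- The cyclic Leibniz rule for a coefficient `C_{m n₁ … n_k}` that is totally symmetric in its last
`k` indices: the sum over the cyclic permutations `p` of `{0, …, k}` of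
`∑_m ∇_{m n_{p(0)}} C_{m n_{p(1)} … n_{p(k)}}` vanishes. (Addition in `Fin (k + 1)` is modulo
`k + 1`.) -/
structure IsCLR (D : ℤ → ℤ → ℂ) {k : ℕ} (C : (Fin (k + 1) → ℤ) → ℂ) : Prop where
  symmetric : ∀ (m : ℤ) (n : Fin k → ℤ) (π : Equiv.Perm (Fin k)),
    C (Fin.cons m (n ∘ π)) = C (Fin.cons m n)
  cyclic : ∀ n : Fin (k + 1) → ℤ,
    ∑ p : Fin (k + 1), ∑' m : ℤ,
      D m (n p) * C (Fin.cons m fun j : Fin k => n (p + j.succ)) = 0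

/-- CLR terms `∑ C_{m n₁ … n_k} χ_{σ m} φ_{σ n₁} ⋯ φ_{σ n_k}` with `C` a TILC obeying the cyclic
Leibniz rule. -/
def IsCLRTerm (D : ℤ → ℤ → ℂ) (σ : Charge) (k : ℕ) (f : Functional) : Prop :=
  ∃ C : (Fin (k + 1) → ℤ) → ℂ, IsTILC C ∧ IsCLR D C ∧
    f = siteSum (Fin.cons (.inr .chi, σ) fun _ : Fin k => (.inl .phi, σ)) C

end

end LatticeSUSY

open LatticeSUSY

/-! On functionals of the fields with one label, the part of the supersymmetry acting on the other
label drops out. What remains is a Koszul-type differential: up to nonzero constants it replaces `χ`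
by `∇φ` and `F` by `∇χ̄`. Call `χ`, `F` upper letters and `φ`, `χ̄` lower ones. The differential
lowers the number of upper letters by one and conserves the number of letters `F`, `χ̄`; the fermion
number is the difference of these two counts (`wordFermion_eq`). At fermion number one there are two
cases. Without `F`, `χ̄` a monomial is one `χ` times `φ`s, and closedness is precisely the cyclic
Leibniz rule for its coefficient (`isCLR_clrCoef`). Otherwise there are at least two upper letters,
and such a cycle is exact; its primitive has one more upper letter and so fermion number two.

Exactness is proved for coefficient functions of words. On exponentially damped sequences the
operator sending `b` to `∑ m, D m n * b m` is injective but not surjective: its values sum to zero.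
Locality of the primitive requires a left inverse that preserves damping. The symbol of `∇` vanishes
at `z = 1` but is analytic near the unit circle and not identically zero, so some circles `|z| =
e^{±ε}` carry no zero (`exists_small_radius`). Inverting the symbol on the inner circle gives decay
towards `+∞`, on the outer one towards `-∞`; since both give left inverses, their rows can be
spliced into a kernel damped in both directions (`exists_left_inverse_kernel`). The tensor-product
homotopy built from it contracts the damped words in positive degree (`wordDiff_wordHomotopy`).

A translation invariant coefficient is damped only relative to one of its letters. Pinning the first
letter at the origin leaves damped words in the others, while the first letter contributes one
further two-term direction. Homology may then also survive in degree one, where the terms obeying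
the cyclic Leibniz rule live, but not in degree two or more (`exists_word_primitive`).

Words and functionals are linked by `polar` (iterated derivatives at the origin) and `wordSum`. Both
intertwine the differentials (`polar_susyOp`, `susyOp_wordSum`), and their composite is `n!` on the
part of order `n` (`wordSum_polar`). The homotopy prefers the first slot and destroys graded
symmetry, but multiplying out in `wordSum` restores it. -/

namespace LatticeSUSY
-- Commutation relations of multiplications and derivatives.
noncomputable section

theorem rank_lt_iff_not {ψ ξ : Fermion} (h : ψ ≠ ξ) : rank ψ < rank ξ ↔ ¬ rank ξ < rank ψ := by
  have := rank_injective.ne h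
  omega

theorem moveSign_sq (ψ : Fermion) (A : Finset Fermion) : moveSign ψ A * moveSign ψ A = 1 := by
  unfold moveSign
  rw [← pow_add, ← two_mul, pow_mul]
  simp

theorem norm_moveSign (ψ : Fermion) (A : Finset Fermion) : ‖moveSign ψ A‖ = 1 := by
  simp [moveSign]

/-- The sign contributed by `ξ` to the reordering sign of `ψ`. -/
def pairSign (ψ ξ : Fermion) : ℂ := if rank ξ < rank ψ then -1 else 1

theorem pairSign_sq (ψ ξ : Fermion) : pairSign ψ ξ * pairSign ψ ξ = 1 := by
  unfold pairSign; split <;> simp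

theorem pairSign_swap {ψ ξ : Fermion} (h : ψ ≠ ξ) : pairSign ψ ξ = - pairSign ξ ψ := by
  unfold pairSign
  have := rank_lt_iff_not h
  by_cases h1 : rank ψ < rank ξ <;> simp_all

theorem moveSign_insert (ψ : Fermion) {ξ : Fermion} {A : Finset Fermion} (h : ξ ∉ A) :
    moveSign ψ (insert ξ A) = pairSign ψ ξ * moveSign ψ A := by
  unfold moveSign pairSign
  rw [Finset.filter_insert]
  split
  · rw [Finset.card_insert_of_notMem (by simp [h]), pow_succ]; ring
  · simp

theorem moveSign_erase (ψ : Fermion) {ξ : Fermion} {A : Finset Fermion} (h : ξ ∈ A) :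
    moveSign ψ (A.erase ξ) = pairSign ψ ξ * moveSign ψ A := by
  have h1 := moveSign_insert ψ (Finset.notMem_erase ξ A)
  rw [Finset.insert_erase h] at h1
  rw [h1, ← mul_assoc, pairSign_sq, one_mul]

/-- The left derivative with respect to a field variable. -/
def derivField : Species × ℤ → Functional → Functional
  | ((.inl b, σ), n) => derivBoson (b, σ, n)
  | ((.inr ψ, σ), n) => derivFermion (ψ, σ, n)

/-- Removing one factor of a field variable from the bosonic exponents. -/
def remB : Species × ℤ → (Boson →₀ ℕ) → (Boson →₀ ℕ)
  | ((.inl b, σ), n), a => a - Finsupp.single (b, σ, n) 1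
  | ((.inr _, _), _), a => a

/-- Removing one factor of a field variable from the fermionic factors. -/
def remF : Species × ℤ → Finset Fermion → Finset Fermion
  | ((.inl _, _), _), A => A
  | ((.inr ψ, σ), n), A => A.erase (ψ, σ, n)

/-- Adding one factor of a field variable to the bosonic exponents. -/
def addB : Species × ℤ → (Boson →₀ ℕ) → (Boson →₀ ℕ)
  | ((.inl b, σ), n), a => a + Finsupp.single (b, σ, n) 1
  | ((.inr _, _), _), a => a

/-- Adding one factor of a field variable to the fermionic factors. -/
def addF : Species × ℤ → Finset Fermion → Finset Fermion
  | ((.inl _, _), _), A => A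
  | ((.inr ψ, σ), n), A => insert (ψ, σ, n) A

/-- The multiplicity of a field variable in a basis monomial. -/
def mult : Species × ℤ → (Boson →₀ ℕ) → Finset Fermion → ℕ
  | ((.inl b, σ), n), a, _ => a (b, σ, n)
  | ((.inr ψ, σ), n), _, A => if (ψ, σ, n) ∈ A then 1 else 0

/-- The numerical factor in the action of a multiplication operator. -/
def mulCoef : Species × ℤ → (Boson →₀ ℕ) → Finset Fermion → ℂ
  | ((.inl b, σ), n), a, _ => if a (b, σ, n) = 0 then 0 else 1
  | ((.inr ψ, σ), n), _, A =>
      if (ψ, σ, n) ∈ A then moveSign (ψ, σ, n) (A.erase (ψ, σ, n)) else 0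

/-- The numerical factor in the action of a derivative. -/
def derivCoef : Species × ℤ → (Boson →₀ ℕ) → Finset Fermion → ℂ
  | ((.inl b, σ), n), a, _ => (a (b, σ, n) : ℂ) + 1
  | ((.inr ψ, σ), n), _, A => if (ψ, σ, n) ∈ A then 0 else moveSign (ψ, σ, n) A

theorem mulField_apply (v : Species × ℤ) (f : Functional) (a : Boson →₀ ℕ) (A : Finset Fermion) :
    mulField v f a A = mulCoef v a A * f (remB v a) (remF v A) := by
  obtain ⟨⟨_ | _, σ⟩, n⟩ := v <;> simp [mulField, mulBoson, mulFermion, mulCoef, remB, remF]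

theorem derivField_apply (v : Species × ℤ) (f : Functional) (a : Boson →₀ ℕ)
    (A : Finset Fermion) :
    derivField v f a A = derivCoef v a A * f (addB v a) (addF v A) := by
  obtain ⟨⟨_ | _, σ⟩, n⟩ := v <;>
    simp [derivField, derivBoson, derivFermion, derivCoef, addB, addF]

theorem mulCoef_eq_zero_iff (v : Species × ℤ) (a : Boson →₀ ℕ) (A : Finset Fermion) :
    mulCoef v a A = 0 ↔ mult v a A = 0 := by
  obtain ⟨⟨_ | _, σ⟩, n⟩ := v <;> simp [mulCoef, mult, moveSign]

theorem norm_mulCoef_le (v : Species × ℤ) (a : Boson →₀ ℕ) (A : Finset Fermion) :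
    ‖mulCoef v a A‖ ≤ 1 := by
  obtain ⟨⟨_ | _, σ⟩, n⟩ := v <;> simp only [mulCoef] <;> split <;> simp [norm_moveSign]

theorem norm_derivCoef_le (v : Species × ℤ) (a : Boson →₀ ℕ) (A : Finset Fermion) :
    ‖derivCoef v a A‖ ≤ mult v a A + 1 := by
  obtain ⟨⟨b | _, σ⟩, n⟩ := v <;> simp only [derivCoef, mult]
  · have : ((a (b, σ, n) : ℂ) + 1) = ((a (b, σ, n) + 1 : ℕ) : ℂ) := by push_cast; ring
    rw [this, Complex.norm_natCast]; push_cast; rfl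
  · split <;> simp [norm_moveSign]

/-- The sign produced by exchanging two field variables. -/
def fsign (v w : Species × ℤ) : ℂ := if v.1.1.isRight ∧ w.1.1.isRight then -1 else 1

/-- For two fermions, each order of differentiation passes one variable over the other exactly once,
and the two resulting pair signs are opposite by `pairSign_swap`. -/
theorem derivField_comm (v w : Species × ℤ) (f : Functional) (a : Boson →₀ ℕ)
    (A : Finset Fermion) :
    derivField v (derivField w f) a A = fsign v w * derivField w (derivField v f) a A := by
  obtain ⟨⟨b | ψ, σ⟩, n⟩ := v <;> obtain ⟨⟨b' | ψ', σ'⟩, n'⟩ := w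
  · simp only [derivField, derivBoson, fsign]
    by_cases h : (b, σ, n) = (b', σ', n')
    · rw [h]; simp
    · have h1 : (Finsupp.single (b, σ, n) 1 : Boson →₀ ℕ) (b', σ', n') = 0 := by
        rw [Finsupp.single_apply, if_neg h]
      have h2 : (Finsupp.single (b', σ', n') 1 : Boson →₀ ℕ) (b, σ, n) = 0 := by
        rw [Finsupp.single_apply, if_neg (Ne.symm h)]
      simp only [Finsupp.add_apply, h1, h2]
      rw [add_right_comm a]; simp; ring
  · simp only [derivField, derivBoson, derivFermion, fsign]
    split <;> simp; ring
  · simp only [derivField, derivBoson, derivFermion, fsign]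
    split <;> simp; ring
  · simp only [derivField, derivFermion, fsign]
    generalize (ψ, σ, n) = x
    generalize (ψ', σ', n') = y
    by_cases hx : x ∈ A <;> by_cases hy : y ∈ A <;> simp [hx, hy]
    by_cases h : x = y
    · subst h; simp
    · simp only [h, Ne.symm h, if_false]
      rw [moveSign_insert _ hx, moveSign_insert _ hy, pairSign_swap h, Finset.insert_comm]; ring

theorem mulField_comm (v w : Species × ℤ) (f : Functional) (a : Boson →₀ ℕ)
    (A : Finset Fermion) :
    mulField v (mulField w f) a A = fsign v w * mulField w (mulField v f) a A := by
  obtain ⟨⟨b | ψ, σ⟩, n⟩ := v <;> obtain ⟨⟨b' | ψ', σ'⟩, n'⟩ := w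
  · simp only [mulField, mulBoson, fsign]
    by_cases h : (b, σ, n) = (b', σ', n')
    · rw [h]; simp
    · have h1 : (Finsupp.single (b, σ, n) 1 : Boson →₀ ℕ) (b', σ', n') = 0 := by
        rw [Finsupp.single_apply, if_neg h]
      have h2 : (Finsupp.single (b', σ', n') 1 : Boson →₀ ℕ) (b, σ, n) = 0 := by
        rw [Finsupp.single_apply, if_neg (Ne.symm h)]
      simp only [Finsupp.tsub_apply, h1, h2, tsub_zero]
      rw [tsub_right_comm]
      by_cases h3 : a (b, σ, n) = 0 <;> by_cases h4 : a (b', σ', n') = 0 <;> simp [h3, h4]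
  · simp only [mulField, mulBoson, mulFermion, fsign]
    split <;> simp
  · simp only [mulField, mulBoson, mulFermion, fsign]
    split <;> simp
  · simp only [mulField, mulFermion, fsign]
    generalize (ψ, σ, n) = x
    generalize (ψ', σ', n') = y
    by_cases h : x = y
    · subst h; simp
    by_cases hx : x ∈ A <;> by_cases hy : y ∈ A <;>
      simp [hx, hy, Finset.mem_erase, h, Ne.symm h]
    have hx' : x ∈ A.erase y := Finset.mem_erase.2 ⟨h, hx⟩
    have hy' : y ∈ A.erase x := Finset.mem_erase.2 ⟨Ne.symm h, hy⟩
    rw [moveSign_erase x hx', moveSign_erase x hx, moveSign_erase y hy', moveSign_erase y hy,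
      moveSign_erase x hy, moveSign_erase y hx, Finset.erase_right_comm, pairSign_swap h]
    ring

/-- These canonical relations are the source of every graded Leibniz rule used later. -/
theorem derivField_mulField (v w : Species × ℤ) (f : Functional) (a : Boson →₀ ℕ)
    (A : Finset Fermion) :
    derivField v (mulField w f) a A =
      (if v = w then f a A else 0) + fsign v w * mulField w (derivField v f) a A := by
  obtain ⟨⟨b | ψ, σ⟩, n⟩ := v <;> obtain ⟨⟨b' | ψ', σ'⟩, n'⟩ := w
  · simp only [derivField, mulField, mulBoson, derivBoson, fsign]
    by_cases h : (b, σ, n) = (b', σ', n')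
    · have h' : b = b' ∧ σ = σ' ∧ n = n' := by simpa using h
      obtain ⟨rfl, rfl, rfl⟩ := h'
      simp only [Finsupp.add_apply, Finsupp.single_eq_same]
      by_cases h3 : a (b, σ, n) = 0
      · simp [h3]
      · have : a - Finsupp.single (b, σ, n) 1 + Finsupp.single (b, σ, n) 1 = a := by
          apply tsub_add_cancel_of_le
          rw [Finsupp.single_le_iff]; omega
        simp [h3, this]
        rw [Nat.cast_sub (by omega)]
        simp; ring
    · have h1 : (Finsupp.single (b, σ, n) 1 : Boson →₀ ℕ) (b', σ', n') = 0 := by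
        rw [Finsupp.single_apply, if_neg h]
      have h2 : (Finsupp.single (b', σ', n') 1 : Boson →₀ ℕ) (b, σ, n) = 0 := by
        rw [Finsupp.single_apply, if_neg (Ne.symm h)]
      have h5 : ¬ ((((Sum.inl b : BosonKind ⊕ FermionKind), σ), n) = ((Sum.inl b', σ'), n')) := by
        intro hh; apply h; simpa [and_assoc] using hh
      rw [if_neg h5]
      simp only [Finsupp.tsub_apply, Finsupp.add_apply, h1, h2, tsub_zero, add_zero]
      by_cases h4 : a (b', σ', n') = 0
      · simp [h4]
      · have : a + Finsupp.single (b, σ, n) 1 - Finsupp.single (b', σ', n') 1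
            = a - Finsupp.single (b', σ', n') 1 + Finsupp.single (b, σ, n) 1 := by
          rw [tsub_add_eq_add_tsub]
          rw [Finsupp.single_le_iff]; omega
        simp [h4, this]
  · simp only [derivField, mulField, mulFermion, derivBoson, fsign]
    by_cases h : (ψ', σ', n') ∈ A <;> simp [h]
    ring
  · simp only [derivField, mulField, mulBoson, derivFermion, fsign]
    by_cases h : (ψ, σ, n) ∈ A <;> simp [h]
  · have h5 : ((((Sum.inr ψ : BosonKind ⊕ FermionKind), σ), n) = ((Sum.inr ψ', σ'), n')) ↔
        (ψ, σ, n) = (ψ', σ', n') := by simp [and_assoc]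
    simp only [derivField, mulField, mulFermion, derivFermion, fsign, h5]
    generalize (ψ, σ, n) = x
    generalize (ψ', σ', n') = y
    by_cases h : x = y
    · subst h
      by_cases hx : x ∈ A
      · simp [hx, ← mul_assoc, moveSign_sq]
      · simp [hx, ← mul_assoc, moveSign_sq]
    · by_cases hx : x ∈ A <;> by_cases hy : y ∈ A <;> simp [hx, hy, h, Ne.symm h]
      have e1 : (insert x A).erase y = insert x (A.erase y) := by
        rw [Finset.erase_insert_of_ne h]
      have hx' : x ∉ A.erase y := fun hh => hx (Finset.mem_of_mem_erase hh)
      rw [e1, moveSign_insert _ hx', moveSign_erase x hy, pairSign_swap h]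
      ring

/-- This is the number operator of one variable; summed over variables it becomes the Euler operator
behind `wordSum_polar`. -/
theorem mulField_derivField (v : Species × ℤ) (f : Functional) (a : Boson →₀ ℕ)
    (A : Finset Fermion) : mulField v (derivField v f) a A = mult v a A * f a A := by
  obtain ⟨⟨b | ψ, σ⟩, n⟩ := v
  · simp only [derivField, mulField, mulBoson, derivBoson, mult]
    by_cases h3 : a (b, σ, n) = 0
    · simp [h3]
    · have : a - Finsupp.single (b, σ, n) 1 + Finsupp.single (b, σ, n) 1 = a := by
        apply tsub_add_cancel_of_le
        rw [Finsupp.single_le_iff]; omega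
      simp [h3, this]
      rw [Nat.cast_sub (by omega)]
      simp
  · simp only [derivField, mulField, mulFermion, derivFermion, mult]
    generalize (ψ, σ, n) = x
    by_cases hx : x ∈ A
    · simp [hx, ← mul_assoc, moveSign_sq]
    · simp [hx]

end

/-! ### Inverting a convolution operator on zero-free circles. -/

noncomputable section

/-- The convolution theorem: absolute summability of `c` permits integrating the Fourier series term
by term against the bounded function `F`. -/
theorem hasSum_mul_fourierCoeff {c : ℤ → ℂ} (hc : Summable fun n => ‖c n‖)
    (F : C(UnitAddCircle, ℂ)) (k : ℤ) :
    HasSum (fun n => c n * fourierCoeff F (k - n))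
      (fourierCoeff (fun x : UnitAddCircle => (∑' n, c n * fourier n x) * F x) k) := by
  have hint : ∀ g : C(UnitAddCircle, ℂ), MeasureTheory.Integrable (fun x => g x)
      AddCircle.haarAddCircle := fun g =>
    g.continuous.integrable_of_hasCompactSupport (HasCompactSupport.of_compactSpace _)
  have hF : ∀ n, (fun x : UnitAddCircle => c n * (fourier (-(k - n)) x * F x)) =
      fun x => (c n • (fourier (-(k - n)) * F) : C(UnitAddCircle, ℂ)) x := by
    intro n; ext x; simp
  have key := MeasureTheory.hasSum_integral_of_summable_integral_norm
    (μ := (AddCircle.haarAddCircle : MeasureTheory.Measure UnitAddCircle))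
    (F := fun n x => c n * (fourier (-(k - n)) x * F x))
    (fun n => by rw [hF n]; exact hint _) ?_
  · have e1 : (fun n => c n * fourierCoeff F (k - n)) = fun n =>
        ∫ x : UnitAddCircle, c n * (fourier (-(k - n)) x * F x) ∂AddCircle.haarAddCircle := by
      funext n
      unfold fourierCoeff
      rw [← MeasureTheory.integral_const_mul]
      simp only [smul_eq_mul]
    have e2 : fourierCoeff (fun x : UnitAddCircle => (∑' n, c n * fourier n x) * F x) k =
        ∫ x : UnitAddCircle, ∑' n, c n * (fourier (-(k - n)) x * F x)
          ∂AddCircle.haarAddCircle := by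
      unfold fourierCoeff
      congr 1
      funext x
      beta_reduce
      rw [smul_eq_mul, ← tsum_mul_right, ← tsum_mul_left]
      congr 1
      funext n
      have : -(k - n) = -k + n := by ring
      rw [this, fourier_add]
      ring
    rw [e1, e2]
    exact key
  · refine Summable.of_nonneg_of_le (fun n => MeasureTheory.integral_nonneg fun x => norm_nonneg _)
      (fun n => ?_) (hc.mul_right ‖F‖)
    have : ∀ x : UnitAddCircle, ‖c n * (fourier (-(k - n)) x * F x)‖ ≤ ‖c n‖ * ‖F‖ := by
      intro x
      rw [norm_mul, norm_mul]
      have h1 : ‖fourier (-(k - n)) x‖ = 1 := Circle.norm_coe _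
      rw [h1, one_mul]
      exact mul_le_mul_of_nonneg_left (F.norm_coe_le_norm x) (norm_nonneg _)
    calc _ ≤ ∫ x : UnitAddCircle, ‖c n‖ * ‖F‖ ∂AddCircle.haarAddCircle := by
          apply MeasureTheory.integral_mono_of_nonneg
          · exact Filter.Eventually.of_forall fun x => norm_nonneg _
          · exact MeasureTheory.integrable_const _
          · exact Filter.Eventually.of_forall this
      _ = ‖c n‖ * ‖F‖ := by simp

theorem norm_fourierCoeff_le (F : C(UnitAddCircle, ℂ)) (k : ℤ) : ‖fourierCoeff F k‖ ≤ ‖F‖ := by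
  rw [fourierCoeff]
  refine (MeasureTheory.norm_integral_le_of_norm_le_const (C := ‖F‖) ?_).trans ?_
  · refine Filter.Eventually.of_forall fun x => ?_
    rw [norm_smul]
    have h1 : ‖fourier (-k) x‖ = 1 := Circle.norm_coe _
    rw [h1, one_mul]
    exact F.norm_coe_le_norm x
  · simp

theorem summable_exp_neg_abs {M : ℝ} (hM : 0 < M) :
    Summable fun n : ℤ => Real.exp (-M * |(n : ℝ)|) := by
  have h : Summable fun n : ℕ => Real.exp (-M * n) := by
    have := Real.summable_exp_nat_mul_iff.2 (neg_lt_zero.2 hM)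
    simpa [mul_comm] using this
  apply Summable.of_nat_of_neg <;> simpa using h

theorem fourierCoeff_one_eq (k : ℤ) :
    fourierCoeff (fun _ : UnitAddCircle => (1 : ℂ)) k = if k = 0 then 1 else 0 := by
  have : (fun _ : UnitAddCircle => (1 : ℂ)) = fourier 0 := by
    ext x; simp
  rw [this, fourierCoeff_fourier, Pi.single_apply]

/-- Convolution inverses of an absolutely summable sequence without zeros on the unit circle. -/
theorem exists_convolution_inverse {c : ℤ → ℂ} (hc : Summable fun n => ‖c n‖)
    (h0 : ∀ x : UnitAddCircle, ∑' n, c n * fourier n x ≠ 0) :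
    ∃ (g : ℤ → ℂ) (B : ℝ), (∀ k, ‖g k‖ ≤ B) ∧
      ∀ k, HasSum (fun n => c n * g (k - n)) (if k = 0 then 1 else 0) := by
  have hcont : Continuous fun x : UnitAddCircle => ∑' n, c n * fourier n x := by
    refine continuous_tsum (fun n => by fun_prop) hc fun n x => ?_
    rw [norm_mul]
    have h1 : ‖fourier n x‖ = 1 := Circle.norm_coe _
    rw [h1, mul_one]
  -- Continuity of the reciprocal suffices: its Fourier coefficients only have to be bounded,
  -- because decay will come from exponential weights.
  let F : C(UnitAddCircle, ℂ) := ⟨fun x => (∑' n, c n * fourier n x)⁻¹, hcont.inv₀ h0⟩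
  refine ⟨fourierCoeff F, ‖F‖, norm_fourierCoeff_le F, fun k => ?_⟩
  convert hasSum_mul_fourierCoeff hc F k
  rw [← fourierCoeff_one_eq]
  congr 1
  ext x
  exact (mul_inv_cancel₀ (h0 x)).symm

/-- The coefficients are recovered from the sum by the convolution theorem with `F = 1`. -/
theorem exists_tsum_mul_fourier_ne_zero {c : ℤ → ℂ} (hc : Summable fun n => ‖c n‖) (h0 : c ≠ 0) :
    ∃ x : UnitAddCircle, ∑' n, c n * fourier n x ≠ 0 := by
  by_contra! hcon
  apply h0
  ext k
  have h1 := hasSum_mul_fourierCoeff hc 1 k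
  have h2 : HasSum (fun n => c n * fourierCoeff (1 : C(UnitAddCircle, ℂ)) (k - n)) (c k) := by
    have h3 : (fun n => c n * fourierCoeff (1 : C(UnitAddCircle, ℂ)) (k - n)) =
        fun n => if n = k then c k else 0 := by
      ext n
      have := fourierCoeff_one_eq (k - n)
      have e : (fun _ : UnitAddCircle => (1 : ℂ)) = (1 : C(UnitAddCircle, ℂ)) := rfl
      rw [← e, this]
      by_cases h : n = k
      · subst h; simp
      · have : k - n ≠ 0 := by omega
        simp [h, this]
    rw [h3]
    exact hasSum_ite_eq k (c k)
  rw [h2.unique h1]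
  simp_rw [hcon]
  simp [fourierCoeff]

/-- If every small `ε` failed, the symbol would have infinitely many zeros in a compact set inside
its domain of analyticity, and the identity theorem would make it vanish. -/
theorem exists_small_radius {d : ℤ → ℂ} (hd : d ≠ 0) {M L : ℝ} (hM : 0 < M)
    (hL : ∀ k, ‖d k‖ ≤ L * Real.exp (-M * |(k : ℝ)|)) {r : ℝ} (hr : 0 < r) (hrM : r < M) :
    ∃ ε, 0 < ε ∧ ε < r ∧ ∀ t : ℝ, |t| = ε → ∀ x : UnitAddCircle,
      ∑' n : ℤ, (d n * Real.exp (n * t)) * fourier n x ≠ 0 := by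
  have hL0 : 0 ≤ L := by
    have := (norm_nonneg _).trans (hL 0)
    simpa using this
  -- In the coordinate `w` with `z = e^w`, circles become vertical lines and the annulus of
  -- convergence becomes a convex strip.
  let U : Set ℂ := Complex.re ⁻¹' Set.Ioo (-r) r
  have hUo : IsOpen U := isOpen_Ioo.preimage Complex.continuous_re
  have hUc : Convex ℝ U := (convex_Ioo (-r) r).linear_preimage Complex.reLm
  have hbound : ∀ (n : ℤ) (w : ℂ), w ∈ U →
      ‖d n * Complex.exp (n * w)‖ ≤ L * Real.exp (-(M - r) * |(n : ℝ)|) := by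
    intro n w hw
    rw [norm_mul, Complex.norm_exp]
    have h1 : ((n : ℂ) * w).re ≤ r * |(n : ℝ)| := by
      have : ((n : ℂ) * w).re = n * w.re := by simp
      rw [this]
      calc (n : ℝ) * w.re ≤ |(n : ℝ) * w.re| := le_abs_self _
        _ = |(n : ℝ)| * |w.re| := abs_mul _ _
        _ ≤ |(n : ℝ)| * r := by
          apply mul_le_mul_of_nonneg_left _ (abs_nonneg _)
          exact (abs_lt.2 hw).le
        _ = _ := mul_comm _ _
    calc ‖d n‖ * Real.exp ((n : ℂ) * w).re
        ≤ (L * Real.exp (-M * |(n : ℝ)|)) * Real.exp (r * |(n : ℝ)|) := by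
          gcongr
          exact hL n
      _ = _ := by
          rw [mul_assoc, ← Real.exp_add]; ring_nf
  let H : ℂ → ℂ := fun w => ∑' n : ℤ, d n * Complex.exp (n * w)
  have hdiff : DifferentiableOn ℂ H U := by
    refine Complex.differentiableOn_tsum_of_summable_norm
      ((summable_exp_neg_abs (sub_pos.2 hrM)).mul_left L) (fun n => ?_) hUo hbound
    fun_prop
  have han := hdiff.analyticOnNhd hUo
  have hHf : ∀ t y : ℝ, H (t + 2 * Real.pi * Complex.I * y) =
      ∑' n : ℤ, (d n * Real.exp (n * t)) * fourier n (y : UnitAddCircle) := by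
    intro t y
    refine tsum_congr fun n => ?_
    rw [fourier_coe_apply, mul_assoc (d n), Complex.ofReal_exp, ← Complex.exp_add]
    congr 2
    push_cast
    ring
  have hsum : Summable fun n => ‖d n‖ :=
    Summable.of_nonneg_of_le (fun _ => norm_nonneg _) hL ((summable_exp_neg_abs hM).mul_left L)
  have hne : ∃ w ∈ U, H w ≠ 0 := by
    obtain ⟨x, hx⟩ := exists_tsum_mul_fourier_ne_zero hsum hd
    obtain ⟨y, rfl⟩ := QuotientAddGroup.mk_surjective x
    refine ⟨(0 : ℝ) + 2 * Real.pi * Complex.I * y, ?_, ?_⟩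
    · simp [U, hr]
    · rw [hHf]
      simpa using hx
  by_contra! hcon
  -- every radius below `r` carries a zero, so zeros accumulate in a compact rectangle
  have hcon' : ∀ ε ∈ Set.Ioo 0 r, ∃ t y : ℝ, |t| = ε ∧ y ∈ Set.Icc (0 : ℝ) 1 ∧
      H (t + 2 * Real.pi * Complex.I * y) = 0 := by
    intro ε hε
    obtain ⟨t, ht, x, hx⟩ := hcon ε hε.1 hε.2
    obtain ⟨y, hy, hyx⟩ : x ∈ (QuotientAddGroup.mk '' Set.Icc (0 : ℝ) (0 + 1) :
        Set UnitAddCircle) := by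
      rw [AddCircle.coe_image_Icc_eq]; trivial
    rw [← hyx] at hx
    exact ⟨t, y, ht, by simpa using hy, by rw [hHf]; exact hx⟩
  choose! τ y hτ hy hz using hcon'
  let p : ℝ → ℂ := fun ε => τ ε + 2 * Real.pi * Complex.I * y ε
  have hpre : ∀ ε, (p ε).re = τ ε := by intro ε; simp [p]
  -- Stopping at `r / 2` keeps the accumulation point strictly inside the open strip. Zeros at
  -- different radii are distinct because their real parts differ in absolute value.
  let K : Set ℂ := Set.Icc (-(r / 2)) (r / 2) ×ℂ Set.Icc 0 (2 * Real.pi)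
  have hK : IsCompact K := isCompact_Icc.reProdIm isCompact_Icc
  have hinf : (p '' Set.Ioo 0 (r / 2)).Infinite := by
    apply (Set.Ioo_infinite (by linarith : (0 : ℝ) < r / 2)).image
    intro a ha b hb hab
    have h1 := hτ a ⟨ha.1, by linarith [ha.2]⟩
    have h2 := hτ b ⟨hb.1, by linarith [hb.2]⟩
    rw [← hpre, hab, hpre] at h1
    exact h1.symm.trans h2
  have hsub : p '' Set.Ioo 0 (r / 2) ⊆ K := by
    rintro _ ⟨ε, hε, rfl⟩
    have h1 := hτ ε ⟨hε.1, by linarith [hε.2]⟩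
    have h2 := hy ε ⟨hε.1, by linarith [hε.2]⟩
    rw [Complex.mem_reProdIm, hpre]
    refine ⟨abs_le.1 (by rw [h1]; exact hε.2.le), ?_⟩
    have : (p ε).im = 2 * Real.pi * y ε := by simp [p]
    rw [this]
    exact ⟨mul_nonneg (by positivity) h2.1, by nlinarith [h2.2, Real.pi_pos]⟩
  obtain ⟨z, hzK, hacc⟩ := hinf.exists_accPt_of_subset_isCompact hK hsub
  have hzU : z ∈ U := by
    rw [Complex.mem_reProdIm] at hzK
    exact ⟨by linarith [hzK.1.1], by linarith [hzK.1.2]⟩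
  have hfreq : ∃ᶠ w in nhdsWithin z {z}ᶜ, H w = 0 := by
    rw [accPt_iff_frequently_nhdsNE] at hacc
    refine hacc.mono ?_
    rintro _ ⟨ε, hε, rfl⟩
    exact hz ε ⟨hε.1, by linarith [hε.2]⟩
  obtain ⟨w, hw, hw0⟩ := hne
  exact hw0 (han.eqOn_zero_of_preconnected_of_frequently_eq_zero hUc.isPreconnected hzU hfreq hw)

/-- A left inverse of the convolution operator with exponentially damped coefficients `d`,
whose kernel is damped in its output index and grows slowly in its input index. -/
theorem exists_left_inverse_kernel {d : ℤ → ℂ} (hd : d ≠ 0) {M L : ℝ} (hM : 0 < M)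
    (hL : ∀ k, ‖d k‖ ≤ L * Real.exp (-M * |(k : ℝ)|)) {r : ℝ} (hr : 0 < r) :
    ∃ ε, 0 < ε ∧ ε < r ∧ ε < M ∧ ∃ (S : ℤ → ℤ → ℂ) (C : ℝ),
      (∀ n m : ℤ, ‖S n m‖ ≤ C * Real.exp (-ε * |(n : ℝ)|) * Real.exp (ε * |(m : ℝ)|)) ∧
      ∀ n k, HasSum (fun m => S n m * d (k - m)) (if k = n then 1 else 0) := by
  -- The bound `M / 2` keeps `ε` below `M`, so the tilted series still converge absolutely.
  have hr' : 0 < min r (M / 2) := by positivity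
  obtain ⟨ε, hε, hεr, hnz⟩ := exists_small_radius hd hM hL hr'
    (lt_of_le_of_lt (min_le_right _ _) (by linarith))
  have hεM : ε < M := lt_of_lt_of_le hεr ((min_le_right _ _).trans (by linarith))
  have hinv : ∀ t : ℝ, |t| = ε → ∃ (g : ℤ → ℂ) (B : ℝ), 0 ≤ B ∧
      (∀ k : ℤ, ‖g k‖ ≤ B * Real.exp (-(k * t))) ∧
      ∀ k, HasSum (fun n => d n * g (k - n)) (if k = 0 then 1 else 0) := by
    intro t ht
    have hs : Summable fun n : ℤ => ‖d n * (Real.exp (n * t) : ℂ)‖ := by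
      refine Summable.of_nonneg_of_le (fun _ => norm_nonneg _) (fun n => ?_)
        ((summable_exp_neg_abs (sub_pos.2 hεM)).mul_left L)
      rw [norm_mul, Complex.norm_real, Real.norm_eq_abs, Real.abs_exp]
      have h1 : (n : ℝ) * t ≤ ε * |(n : ℝ)| := by
        rw [← ht, mul_comm |t|, ← abs_mul]; exact le_abs_self _
      calc _ ≤ (L * Real.exp (-M * |(n : ℝ)|)) * Real.exp (ε * |(n : ℝ)|) := by
            have := hL n
            have h2 := Real.exp_le_exp.2 h1
            exact mul_le_mul this h2 (Real.exp_pos _).le ((norm_nonneg _).trans this)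
        _ = _ := by rw [mul_assoc, ← Real.exp_add]; ring_nf
    obtain ⟨g, B, hB, hg⟩ := exists_convolution_inverse hs (hnz t ht)
    -- Undoing the tilt turns an inverse on the circle `|z| = e^t` into one for `d` itself, with
    -- bounded coefficients replaced by the growth `e^{-kt}`.
    refine ⟨fun k => g k * Real.exp (-(k * t)), B, (norm_nonneg _).trans (hB 0), fun k => ?_,
      fun k => ?_⟩
    · rw [norm_mul, Complex.norm_real, Real.norm_eq_abs, Real.abs_exp]
      exact mul_le_mul_of_nonneg_right (hB k) (Real.exp_pos _).le
    · have h1 := (hg k).mul_right ((Real.exp (-(k * t)) : ℝ) : ℂ)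
      have e1 : (fun n : ℤ => d n * (g (k - n) * (Real.exp (-((k - n : ℤ) * t)) : ℂ))) =
          fun n => d n * (Real.exp (n * t) : ℂ) * g (k - n) * (Real.exp (-(k * t)) : ℂ) := by
        funext n
        have : Real.exp (-((k - n : ℤ) * t)) = Real.exp (n * t) * Real.exp (-(k * t)) := by
          rw [← Real.exp_add]; push_cast; ring_nf
        rw [this, Complex.ofReal_mul]; ring
      have e2 : (if k = 0 then (1 : ℂ) else 0) =
          (if k = 0 then 1 else 0) * (Real.exp (-(k * t)) : ℂ) := by
        by_cases hk : k = 0 <;> simp [hk]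
      rw [e1, e2]
      exact h1
  obtain ⟨g₁, B₁, hB₁, hb₁, hg₁⟩ := hinv (-ε) (by rw [abs_neg, abs_of_pos hε])
  obtain ⟨g₂, B₂, hB₂, hb₂, hg₂⟩ := hinv ε (abs_of_pos hε)
  -- The left-inverse identity involves a single row `n`, so each row may use its own inverse: the
  -- inner circle for `n ≥ 0` and the outer one for `n < 0`. This yields the factor `e^{-ε|n|}` on
  -- both sides.
  refine ⟨ε, hε, hεr.trans_le (min_le_left _ _), hεM,
    fun n m => if 0 ≤ n then g₁ (m - n) else g₂ (m - n), max B₁ B₂, fun n m => ?_, fun n k => ?_⟩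
  · have hm1 : (m : ℝ) ≤ |(m : ℝ)| := le_abs_self _
    have hm2 : -(m : ℝ) ≤ |(m : ℝ)| := neg_le_abs _
    dsimp only
    rw [mul_assoc, ← Real.exp_add]
    split_ifs with hn
    · have hn' : |(n : ℝ)| = n := abs_of_nonneg (by exact_mod_cast hn)
      refine (hb₁ _).trans (mul_le_mul (le_max_left _ _) ?_ (Real.exp_pos _).le
        (hB₁.trans (le_max_left _ _)))
      rw [Real.exp_le_exp, hn']
      push_cast
      nlinarith
    · have hn' : |(n : ℝ)| = -n := abs_of_neg (by exact_mod_cast (not_le.1 hn))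
      refine (hb₂ _).trans (mul_le_mul (le_max_right _ _) ?_ (Real.exp_pos _).le
        (hB₂.trans (le_max_right _ _)))
      rw [Real.exp_le_exp, hn']
      push_cast
      nlinarith
  · have aux : ∀ g : ℤ → ℂ, (∀ k, HasSum (fun n => d n * g (k - n)) (if k = 0 then 1 else 0)) →
        HasSum (fun m => g (m - n) * d (k - m)) (if k = n then 1 else 0) := by
      intro g hg
      have h1 := hg (k - n)
      rw [← (Equiv.subLeft k).hasSum_iff] at h1
      simp only [sub_eq_zero] at h1
      refine h1.congr_fun fun m => ?_
      simp only [Function.comp_apply, Equiv.subLeft_apply]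
      rw [mul_comm]
      congr 2
      ring
    by_cases hn : 0 ≤ n
    · simpa only [hn, if_true] using aux g₁ hg₁
    · simpa only [hn, if_false] using aux g₂ hg₂

end

/-! ### Words, damping and the unsymmetrised differential. -/

noncomputable section

/-- A letter `(κ, t, n)` encodes a field of fixed label: `κ` tells whether it is `χ` or `F` (as
opposed to `φ` or `χ̄`), `t` whether it is `F` or `χ̄` (as opposed to `φ` or `χ`), and `n` is the
site. -/
abbrev Letter := Bool × Bool × ℤ

/-- The parity sign of a letter. -/
def letterSign (κ t : Bool) : ℂ := if κ = t then 1 else -1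

theorem letterSign_sq (κ t : Bool) : letterSign κ t * letterSign κ t = 1 := by
  unfold letterSign; split <;> simp

theorem letterSign_mul (t : Bool) : letterSign true t * letterSign false t = -1 := by
  cases t <;> simp [letterSign]

theorem norm_letterSign (κ t : Bool) : ‖letterSign κ t‖ = 1 := by
  unfold letterSign; split <;> simp

/-- Translation invariant, exponentially damped kernels on the lattice. -/
structure IsDampedKernel (D : ℤ → ℤ → ℂ) (M L : ℝ) : Prop where
  pos : 0 < M
  shift : ∀ m n k, D (m + k) (n + k) = D m n
  bound : ∀ m n : ℤ, ‖D m n‖ ≤ L * Real.exp (-M * |((m - n : ℤ) : ℝ)|)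

/-- The sum `∑ exp (-s |m|)` over the lattice. -/
def expSum (s : ℝ) : ℝ := ∑' m : ℤ, Real.exp (-s * |(m : ℝ)|)

theorem expSum_nonneg (s : ℝ) : 0 ≤ expSum s := tsum_nonneg fun _ => (Real.exp_pos _).le

variable {D : ℤ → ℤ → ℂ} {M L : ℝ}

theorem IsDampedKernel.nonneg (hD : IsDampedKernel D M L) : 0 ≤ L := by
  have := (norm_nonneg _).trans (hD.bound 0 0)
  simpa using this

theorem summable_exp_shift {s : ℝ} (hs : 0 < s) (n : ℤ) :
    Summable fun m : ℤ => Real.exp (-s * |((m - n : ℤ) : ℝ)|) :=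
  (Equiv.subRight n).summable_iff.2 (summable_exp_neg_abs hs)

theorem tsum_exp_shift (s : ℝ) (n : ℤ) :
    ∑' m : ℤ, Real.exp (-s * |((m - n : ℤ) : ℝ)|) = expSum s :=
  (Equiv.subRight n).tsum_eq fun m : ℤ => Real.exp (-s * |(m : ℝ)|)

theorem IsDampedKernel.summable_norm (hD : IsDampedKernel D M L) (n : ℤ) :
    Summable fun m => ‖D m n‖ :=
  Summable.of_nonneg_of_le (fun _ => norm_nonneg _) (fun m => hD.bound m n)
    ((summable_exp_shift hD.pos n).mul_left L)

theorem IsDampedKernel.tsum_norm_le (hD : IsDampedKernel D M L) (n : ℤ) :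
    ∑' m, ‖D m n‖ ≤ L * expSum M := by
  rw [← tsum_exp_shift M n, ← tsum_mul_left]
  exact (hD.summable_norm n).tsum_le_tsum (fun m => hD.bound m n)
    ((summable_exp_shift hD.pos n).mul_left L)

theorem IsDampedKernel.summable_mul (hD : IsDampedKernel D M L) (n : ℤ) {b : ℤ → ℂ} {B : ℝ}
    (hb : ∀ m, ‖b m‖ ≤ B) : Summable fun m => D m n * b m := by
  refine Summable.of_norm_bounded ((hD.summable_norm n).mul_right B) fun m => ?_
  rw [norm_mul]
  exact mul_le_mul_of_nonneg_left (hb m) (norm_nonneg _)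

theorem IsDampedKernel.norm_tsum_le (hD : IsDampedKernel D M L) (n : ℤ) {b : ℤ → ℂ} {B : ℝ}
    (hb : ∀ m, ‖b m‖ ≤ B) : ‖∑' m, D m n * b m‖ ≤ L * expSum M * B := by
  have hB : 0 ≤ B := (norm_nonneg _).trans (hb 0)
  refine (tsum_of_norm_bounded ((hD.summable_norm n).mul_right B).hasSum fun m => ?_).trans ?_
  · rw [norm_mul]
    exact mul_le_mul_of_nonneg_left (hb m) (norm_nonneg _)
  · rw [tsum_mul_right]
    exact mul_le_mul_of_nonneg_right (hD.tsum_norm_le n) hB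

/-- By `|n| ≤ |m - n| + |m|`, a part `ε` of the rate of the kernel is spent on carrying the decay
from `m` to `n`; the remaining rate `M - ε` makes the sum converge. -/
theorem IsDampedKernel.norm_tsum_le_exp (hD : IsDampedKernel D M L) {ε : ℝ} (hε : 0 ≤ ε)
    (hεM : ε < M) (n : ℤ) {b : ℤ → ℂ} {B : ℝ}
    (hb : ∀ m : ℤ, ‖b m‖ ≤ B * Real.exp (-ε * |(m : ℝ)|)) :
    ‖∑' m, D m n * b m‖ ≤ L * expSum (M - ε) * B * Real.exp (-ε * |(n : ℝ)|) := by
  have hB : 0 ≤ B := by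
    have := (norm_nonneg _).trans (hb 0)
    simpa using this
  have hs := (summable_exp_shift (sub_pos.2 hεM) n).mul_left (L * B * Real.exp (-ε * |(n : ℝ)|))
  refine (tsum_of_norm_bounded hs.hasSum fun m => ?_).trans ?_
  · rw [norm_mul]
    refine (mul_le_mul (hD.bound m n) (hb m) (norm_nonneg _)
      (mul_nonneg hD.nonneg (Real.exp_pos _).le)).trans ?_
    have e1 : L * Real.exp (-M * |((m - n : ℤ) : ℝ)|) * (B * Real.exp (-ε * |(m : ℝ)|)) =
        L * B * Real.exp (-M * |((m - n : ℤ) : ℝ)| + -ε * |(m : ℝ)|) := by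
      rw [Real.exp_add]; ring
    have e2 : L * B * Real.exp (-ε * |(n : ℝ)|) * Real.exp (-(M - ε) * |((m - n : ℤ) : ℝ)|) =
        L * B * Real.exp (-ε * |(n : ℝ)| + -(M - ε) * |((m - n : ℤ) : ℝ)|) := by
      rw [Real.exp_add]; ring
    rw [e1, e2]
    refine mul_le_mul_of_nonneg_left (Real.exp_le_exp.2 ?_) (mul_nonneg hD.nonneg hB)
    have h3 : |(n : ℝ)| ≤ |((m - n : ℤ) : ℝ)| + |(m : ℝ)| := by
      have := abs_sub_abs_le_abs_sub (n : ℝ) (m : ℝ)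
      rw [abs_sub_comm] at this
      push_cast
      linarith
    nlinarith
  · rw [tsum_mul_left, tsum_exp_shift]
    apply le_of_eq; ring

/-- The unsymmetrised differential on coefficient functions of words: it lowers each letter `χ` to
`φ` and each letter `F` to `χ̄` with the kernel `D`. -/
def wordDiff (D : ℤ → ℤ → ℂ) (γ : Bool → ℂ) : List Letter → (List Letter → ℂ) → ℂ
  | [], _ => 0
  | x :: l, c => (if x.1 then 0 else γ x.2.1 * ∑' m, D m x.2.2 * c ((true, x.2.1, m) :: l)) +
      letterSign x.1 x.2.1 * wordDiff D γ l (fun l' => c (x :: l'))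

variable {γ : Bool → ℂ}

theorem wordDiff_smul (w : ℂ) (l : List Letter) (c : List Letter → ℂ) :
    wordDiff D γ l (fun l' => w * c l') = w * wordDiff D γ l c := by
  induction l generalizing c with
  | nil => simp [wordDiff]
  | cons x l ih =>
    simp only [wordDiff]
    rw [ih (fun l' => c (x :: l'))]
    split
    · ring
    · have : (fun m => D m x.2.2 * (w * c ((true, x.2.1, m) :: l))) =
          fun m => w * (D m x.2.2 * c ((true, x.2.1, m) :: l)) := by funext m; ring
      rw [this, tsum_mul_left]; ring

theorem norm_wordDiff_le (hD : IsDampedKernel D M L) {c : List Letter → ℂ} {B : ℝ}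
    (hc : ∀ l, ‖c l‖ ≤ B) (l : List Letter) :
    ‖wordDiff D γ l c‖ ≤ l.length * ((‖γ true‖ + ‖γ false‖) * (L * expSum M)) * B := by
  have hB : 0 ≤ B := (norm_nonneg _).trans (hc [])
  have hL := hD.nonneg
  have hE := expSum_nonneg M
  induction l generalizing c with
  | nil => simp [wordDiff]
  | cons x l ih =>
    simp only [wordDiff]
    refine (norm_add_le _ _).trans ?_
    rw [norm_mul, norm_letterSign, one_mul]
    have h1 := ih (c := fun l' => c (x :: l')) (fun l' => hc _)
    have h2 : ‖if x.1 then 0 else γ x.2.1 * ∑' m, D m x.2.2 * c ((true, x.2.1, m) :: l)‖ ≤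
        ((‖γ true‖ + ‖γ false‖) * (L * expSum M)) * B := by
      split
      · rw [norm_zero]; positivity
      · rw [norm_mul, mul_assoc]
        refine mul_le_mul ?_ (hD.norm_tsum_le _ fun m => hc _) (norm_nonneg _) (by positivity)
        cases x.2.1 <;> simp
    rw [List.length_cons]
    push_cast
    linarith

theorem wordDiff_add (hD : IsDampedKernel D M L) {c c' : List Letter → ℂ} {B B' : ℝ}
    (hc : ∀ l, ‖c l‖ ≤ B) (hc' : ∀ l, ‖c' l‖ ≤ B') (l : List Letter) :
    wordDiff D γ l (fun l' => c l' + c' l') = wordDiff D γ l c + wordDiff D γ l c' := by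
  induction l generalizing c c' with
  | nil => simp [wordDiff]
  | cons x l ih =>
    simp only [wordDiff]
    rw [ih (fun l' => hc (x :: l')) (fun l' => hc' (x :: l'))]
    split
    · ring
    · simp only [mul_add]
      rw [(hD.summable_mul _ fun m => hc _).tsum_add (hD.summable_mul _ fun m => hc' _)]
      ring

theorem wordDiff_sub (hD : IsDampedKernel D M L) {c c' : List Letter → ℂ} {B B' : ℝ}
    (hc : ∀ l, ‖c l‖ ≤ B) (hc' : ∀ l, ‖c' l‖ ≤ B') (l : List Letter) :
    wordDiff D γ l (fun l' => c l' - c' l') = wordDiff D γ l c - wordDiff D γ l c' := by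
  have h := wordDiff_add (γ := γ) hD hc (c' := fun l => -1 * c' l) (B' := B')
    (fun l => by simpa using hc' l) l
  rw [wordDiff_smul] at h
  simp only [sub_eq_add_neg]
  simpa using h

/-- A majorant uniform in the word permits Fubini in every slot. This is what moves the differential
past the infinite sums with `S` and with `D` in the first slot. -/
theorem wordDiff_tsum (hD : IsDampedKernel D M L) {e : ℤ → List Letter → ℂ} {u : ℤ → ℝ}
    (hu : Summable u) (he : ∀ k l, ‖e k l‖ ≤ u k) (l : List Letter) :
    wordDiff D γ l (fun l' => ∑' k, e k l') = ∑' k, wordDiff D γ l (e k) := by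
  have hu0 : ∀ k, 0 ≤ u k := fun k => (norm_nonneg _).trans (he k [])
  induction l generalizing e with
  | nil => simp [wordDiff]
  | cons x l ih =>
    simp only [wordDiff]
    rw [ih (e := fun k l' => e k (x :: l')) (fun k l' => he _ _)]
    have hsum2 : Summable fun k => wordDiff D γ l (fun l' => e k (x :: l')) :=
      Summable.of_norm_bounded
        (hu.mul_left _) fun k => norm_wordDiff_le hD (B := u k) (fun l' => he k (x :: l')) l
    split
    · rw [zero_add]
      simp only [zero_add]
      rw [tsum_mul_left]
    · have hprod : Summable (Function.uncurry fun m k => D m x.2.2 *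
          e k ((true, x.2.1, m) :: l)) := by
        have h0 : Summable fun p : ℤ × ℤ => ‖D p.1 x.2.2‖ * u p.2 :=
          (hD.summable_norm x.2.2).mul_of_nonneg hu (fun _ => norm_nonneg _) hu0
        refine Summable.of_norm_bounded h0 fun p => ?_
        simp only [Function.uncurry, norm_mul]
        exact mul_le_mul_of_nonneg_left (he _ _) (norm_nonneg _)
      have hsum1 : Summable fun k => ∑' m, D m x.2.2 * e k ((true, x.2.1, m) :: l) :=
        Summable.of_norm_bounded (hu.mul_left (L * expSum M)) fun k =>
          hD.norm_tsum_le _ fun m => he _ _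
      rw [(hsum1.mul_left _).tsum_add (hsum2.mul_left _), tsum_mul_left, tsum_mul_left]
      congr 2
      have hcomm := hprod.tsum_comm
      simp only [tsum_mul_left] at hcomm
      exact hcomm.symm

/-- Translation of a word. -/
def shiftWord (k : ℤ) (l : List Letter) : List Letter := l.map fun x => (x.1, x.2.1, x.2.2 + k)

theorem wordDiff_shift (hD : IsDampedKernel D M L) (k : ℤ) (l : List Letter)
    (c : List Letter → ℂ) :
    wordDiff D γ l (fun l' => c (shiftWord k l')) = wordDiff D γ (shiftWord k l) c := by
  induction l generalizing c with
  | nil => simp [wordDiff, shiftWord]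
  | cons x l ih =>
    simp only [wordDiff, shiftWord, List.map_cons]
    congr 1
    · congr 2
      rw [← (Equiv.addRight k).tsum_eq fun m => D m (x.2.2 + k) * _]
      simp only [Equiv.coe_addRight, hD.shift]
    · rw [← shiftWord, ← ih fun l' => c ((x.1, x.2.1, x.2.2 + k) :: l')]
      rfl

/-- Multiplying by a function of the pattern of the second components commutes with the
differential. -/
theorem wordDiff_mul_pattern (g : List Bool → ℂ) (l : List Letter) (c : List Letter → ℂ) :
    wordDiff D γ l (fun l' => g (l'.map fun x => x.2.1) * c l') =
      g (l.map fun x => x.2.1) * wordDiff D γ l c := by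
  induction l generalizing c g with
  | nil => simp [wordDiff]
  | cons x l ih =>
    simp only [wordDiff, List.map_cons]
    rw [ih (fun p => g (x.2.1 :: p)) (fun l' => c (x :: l'))]
    split
    · ring
    · have : (fun m => D m x.2.2 * (g (x.2.1 :: l.map fun x => x.2.1) *
          c ((true, x.2.1, m) :: l))) = fun m => g (x.2.1 :: l.map fun x => x.2.1) *
          (D m x.2.2 * c ((true, x.2.1, m) :: l)) := by funext m; ring
      rw [this, tsum_mul_left]; ring

/-- The number of letters `χ`, `F` in a word. -/
def upperCount (l : List Letter) : ℕ := l.countP fun x => x.1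

/-- The fermion number of a word. -/
def wordFermion : List Letter → ℤ
  | [] => 0
  | x :: l => ((if x.1 then 1 else 0) - (if x.2.1 then 1 else 0)) + wordFermion l

/-- The total distance of the sites of a word from the origin. -/
def wordWeight : List Letter → ℝ
  | [] => 0
  | x :: l => |(x.2.2 : ℝ)| + wordWeight l

theorem wordWeight_nonneg (l : List Letter) : 0 ≤ wordWeight l := by
  induction l with
  | nil => simp [wordWeight]
  | cons x l ih => simp only [wordWeight]; positivity

/-- Exponentially damped coefficient functions of words. -/
def Damped (M L : ℝ) (c : List Letter → ℂ) : Prop :=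
  ∀ l, ‖c l‖ ≤ L * Real.exp (-M * wordWeight l)

theorem Damped.nonneg {c : List Letter → ℂ} (hc : Damped M L c) : 0 ≤ L := by
  have := (norm_nonneg _).trans (hc [])
  simpa [wordWeight] using this

theorem Damped.norm_le {c : List Letter → ℂ} (hM : 0 ≤ M) (hc : Damped M L c) (l : List Letter) :
    ‖c l‖ ≤ L := by
  refine (hc l).trans (mul_le_of_le_one_right hc.nonneg ?_)
  rw [Real.exp_le_one_iff]
  have := wordWeight_nonneg l
  nlinarith

theorem Damped.cons_apply {c : List Letter → ℂ} (hc : Damped M L c) (κ t : Bool) (l : List Letter)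
    (m : ℤ) : ‖c ((κ, t, m) :: l)‖ ≤
      (L * Real.exp (-M * wordWeight l)) * Real.exp (-M * |(m : ℝ)|) := by
  refine (hc _).trans (le_of_eq ?_)
  rw [wordWeight, mul_add, Real.exp_add]; ring

theorem Damped.mono {c : List Letter → ℂ} {M' L' : ℝ} (hc : Damped M L c) (hM : M' ≤ M)
    (hL : L ≤ L') : Damped M' L' c := by
  intro l
  refine (hc l).trans (mul_le_mul hL (Real.exp_le_exp.2 ?_) (Real.exp_pos _).le
    (hc.nonneg.trans hL))
  have := wordWeight_nonneg l
  nlinarith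

end

/-! ### The contracting homotopy on damped words. -/

noncomputable section

variable {D : ℤ → ℤ → ℂ} {M L : ℝ} {γ : Bool → ℂ}

/-- Damped left inverses of the operator `b ↦ (fun m => ∑ k, D k m * b k)`. -/
structure IsLeftInverseKernel (D S : ℤ → ℤ → ℂ) (ε C : ℝ) : Prop where
  pos : 0 < ε
  bound : ∀ n m : ℤ, ‖S n m‖ ≤ C * Real.exp (-ε * |(n : ℝ)|) * Real.exp (ε * |(m : ℝ)|)
  hasSum : ∀ n k, HasSum (fun m => S n m * D k m) (if k = n then 1 else 0)

variable {S : ℤ → ℤ → ℂ} {ε C R : ℝ}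

theorem IsLeftInverseKernel.nonneg (hS : IsLeftInverseKernel D S ε C) : 0 ≤ C := by
  have := (norm_nonneg _).trans (hS.bound 0 0)
  simpa using this

/-- The growth of `S` in its input index is beaten by the decay of `b` as soon as `ε < R`. -/
theorem IsLeftInverseKernel.norm_mul_le (hS : IsLeftInverseKernel D S ε C) (n : ℤ) {b : ℤ → ℂ}
    {B : ℝ} (hb : ∀ m : ℤ, ‖b m‖ ≤ B * Real.exp (-R * |(m : ℝ)|)) (m : ℤ) :
    ‖S n m * b m‖ ≤ (C * B * Real.exp (-ε * |(n : ℝ)|)) * Real.exp (-(R - ε) * |(m : ℝ)|) := by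
  rw [norm_mul]
  refine (mul_le_mul (hS.bound n m) (hb m) (norm_nonneg _)
    (mul_nonneg (mul_nonneg hS.nonneg (Real.exp_pos _).le) (Real.exp_pos _).le)).trans
    (le_of_eq ?_)
  have : -(R - ε) * |(m : ℝ)| = ε * |(m : ℝ)| + -R * |(m : ℝ)| := by ring
  rw [this, Real.exp_add]; ring

theorem IsLeftInverseKernel.norm_tsum_le (hS : IsLeftInverseKernel D S ε C) (hεR : ε < R) (n : ℤ)
    {b : ℤ → ℂ} {B : ℝ} (hb : ∀ m : ℤ, ‖b m‖ ≤ B * Real.exp (-R * |(m : ℝ)|)) :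
    ‖∑' m, S n m * b m‖ ≤ C * expSum (R - ε) * B * Real.exp (-ε * |(n : ℝ)|) := by
  refine (tsum_of_norm_bounded ((summable_exp_neg_abs (sub_pos.2 hεR)).mul_left _).hasSum
    (hS.norm_mul_le n hb)).trans (le_of_eq ?_)
  rw [tsum_mul_left, expSum]; ring

theorem IsLeftInverseKernel.tsum_tsum (hD : IsDampedKernel D M L)
    (hS : IsLeftInverseKernel D S ε C) (hεM : ε < M) (hεR : ε < R) (n : ℤ)
    {b : ℤ → ℂ} {B : ℝ} (hb : ∀ m : ℤ, ‖b m‖ ≤ B * Real.exp (-R * |(m : ℝ)|)) :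
    ∑' m, S n m * ∑' k, D k m * b k = b n := by
  have hB : 0 ≤ B := by
    have := (norm_nonneg _).trans (hb 0)
    simpa using this
  have hprod : Summable (Function.uncurry fun m k => S n m * (D k m * b k)) := by
    have h0 : Summable fun p : ℤ × ℤ =>
        Real.exp (-(M - ε) * |(p.1 : ℝ)|) * Real.exp (-(R - ε) * |(p.2 : ℝ)|) :=
      (summable_exp_neg_abs (sub_pos.2 hεM)).mul_of_nonneg
        (summable_exp_neg_abs (sub_pos.2 hεR)) (fun _ => (Real.exp_pos _).le)
        (fun _ => (Real.exp_pos _).le)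
    -- In the variables `(k - m, k)` the majorant factorises into two summable exponentials; this
    -- justifies exchanging the sums over `m` and `k`.
    let φ : ℤ × ℤ ≃ ℤ × ℤ := ⟨fun p => (p.2 - p.1, p.2), fun p => (p.2 - p.1, p.2),
      fun p => by simp, fun p => by simp⟩
    have h1 := ((φ.summable_iff).2 h0).mul_left (C * L * B)
    refine Summable.of_norm_bounded h1 fun p => ?_
    obtain ⟨m, k⟩ := p
    simp only [Function.uncurry, norm_mul, φ, Function.comp_apply, Equiv.coe_fn_mk]
    have hC := hS.nonneg
    have hL := hD.nonneg
    calc ‖S n m‖ * (‖D k m‖ * ‖b k‖)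
        ≤ (C * 1 * Real.exp (ε * |(m : ℝ)|)) * ((L * Real.exp (-M * |((k - m : ℤ) : ℝ)|)) *
          (B * Real.exp (-R * |(k : ℝ)|))) := by
          have h1 : ‖S n m‖ ≤ C * 1 * Real.exp (ε * |(m : ℝ)|) := by
            refine (hS.bound n m).trans ?_
            gcongr
            rw [Real.exp_le_one_iff]
            have := abs_nonneg (n : ℝ)
            nlinarith [hS.pos]
          exact mul_le_mul h1 (mul_le_mul (hD.bound k m) (hb k) (norm_nonneg _) (by positivity))
            (by positivity) (by positivity)
      _ = C * L * B * Real.exp (ε * |(m : ℝ)| + -M * |((k - m : ℤ) : ℝ)| + -R * |(k : ℝ)|) := by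
          rw [Real.exp_add, Real.exp_add]; ring
      _ ≤ C * L * B * Real.exp (-(M - ε) * |((k - m : ℤ) : ℝ)| + -(R - ε) * |(k : ℝ)|) := by
          refine mul_le_mul_of_nonneg_left (Real.exp_le_exp.2 ?_) (by positivity)
          have h3 : |(m : ℝ)| ≤ |((k - m : ℤ) : ℝ)| + |(k : ℝ)| := by
            have := abs_sub_abs_le_abs_sub (m : ℝ) (k : ℝ)
            rw [abs_sub_comm] at this
            push_cast
            linarith
          nlinarith [hS.pos]
      _ = _ := by rw [Real.exp_add]
  have hcomm := hprod.tsum_comm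
  simp only [tsum_mul_left] at hcomm
  rw [← hcomm]
  have h2 : ∀ k, ∑' m, S n m * (D k m * b k) = if k = n then b n else 0 := by
    intro k
    have h3 := ((hS.hasSum n k).mul_right (b k)).tsum_eq
    simp only [mul_assoc] at h3
    rw [h3]
    by_cases h : k = n
    · subst h; simp
    · simp [h]
  simp only [h2]
  exact tsum_ite_eq n _

/-- The part of a coefficient function, at a fixed first letter `φ` or `χ̄`, that is left over
after division by the kernel in the first slot. -/
def slotRemainder (D S : ℤ → ℤ → ℂ) (t : Bool) (n : ℤ) (c : List Letter → ℂ) :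
    List Letter → ℂ :=
  fun l => c ((false, t, n) :: l) - ∑' m, D m n * ∑' k, S m k * c ((false, t, k) :: l)

/-- The contracting homotopy of `wordDiff` in positive degree. -/
def wordHomotopy (D S : ℤ → ℤ → ℂ) (γ : Bool → ℂ) : List Letter → (List Letter → ℂ) → ℂ
  | [], _ => 0
  | (true, t, n) :: l, c => (γ t)⁻¹ * ∑' m, S n m * c ((false, t, m) :: l)
  | (false, t, n) :: l, c => letterSign false t * wordHomotopy D S γ l (slotRemainder D S t n c)

/-- Only the split-off site decays at the smaller rate `ε`. The remaining letters keep the full rate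
`R`, so the recursion of the homotopy can go on with the same `S`. -/
theorem Damped.slotRemainder (hD : IsDampedKernel D M L) (hS : IsLeftInverseKernel D S ε C)
    (hεM : ε < M) (hεR : ε < R) {c : List Letter → ℂ} {B : ℝ} (hc : Damped R B c) (t : Bool)
    (n : ℤ) : Damped R ((1 + L * expSum (M - ε) * (C * expSum (R - ε))) * B *
      Real.exp (-ε * |(n : ℝ)|)) (slotRemainder D S t n c) := by
  intro l
  have hB := hc.nonneg
  have h1 := hc.cons_apply false t l
  have h2 := fun m => hS.norm_tsum_le hεR m (b := fun k => c ((false, t, k) :: l)) h1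
  have h3 := hD.norm_tsum_le_exp hS.pos.le hεM n h2
  refine (norm_sub_le _ _).trans ((add_le_add (h1 n) h3).trans ?_)
  have h4 : Real.exp (-R * |(n : ℝ)|) ≤ Real.exp (-ε * |(n : ℝ)|) := by
    apply Real.exp_le_exp.2
    nlinarith [abs_nonneg (n : ℝ)]
  have h5 := mul_le_mul_of_nonneg_left h4
    (mul_nonneg hB (Real.exp_pos (-R * wordWeight l)).le)
  linarith

/-- Each letter costs at most a factor `K`, either for the projection `1 - DS` or for `S` with
`γ⁻¹`; the rate drops from `R` to `ε` once for the entire word. -/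
theorem norm_wordHomotopy_le (hD : IsDampedKernel D M L) (hS : IsLeftInverseKernel D S ε C)
    (hεM : ε < M) (hεR : ε < R) {K : ℝ}
    (hK1 : 1 + L * expSum (M - ε) * (C * expSum (R - ε)) ≤ K)
    (hK2 : ∀ t, ‖(γ t)⁻¹‖ * (C * expSum (R - ε)) ≤ K) (hK : 1 ≤ K)
    (l : List Letter) {c : List Letter → ℂ} {B : ℝ} (hc : Damped R B c) :
    ‖wordHomotopy D S γ l c‖ ≤ K ^ l.length * B * Real.exp (-ε * wordWeight l) := by
  induction l generalizing c B with
  | nil =>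
    have hB := hc.nonneg
    simp [wordHomotopy, wordWeight, hB]
  | cons x l ih =>
    have hB := hc.nonneg
    obtain ⟨_ | _, t, n⟩ := x
    · rw [wordHomotopy, norm_mul, norm_letterSign, one_mul]
      refine (ih (hc.slotRemainder hD hS hεM hεR t n)).trans ?_
      have e : Real.exp (-ε * wordWeight ((false, t, n) :: l)) =
          Real.exp (-ε * |(n : ℝ)|) * Real.exp (-ε * wordWeight l) := by
        rw [← Real.exp_add, wordWeight]; ring_nf
      rw [e, List.length_cons, pow_succ]
      have h1 : (0 : ℝ) ≤ K ^ l.length := by positivity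
      have := mul_le_mul_of_nonneg_right hK1 (mul_nonneg (mul_nonneg h1 hB) (mul_nonneg
        (Real.exp_pos (-ε * |(n : ℝ)|)).le (Real.exp_pos (-ε * wordWeight l)).le))
      linarith
    · rw [wordHomotopy, norm_mul]
      have h1 := hS.norm_tsum_le hεR n (b := fun k => c ((false, t, k) :: l))
        (hc.cons_apply false t l)
      refine (mul_le_mul_of_nonneg_left h1 (norm_nonneg _)).trans ?_
      have e : Real.exp (-ε * wordWeight ((true, t, n) :: l)) =
          Real.exp (-ε * |(n : ℝ)|) * Real.exp (-ε * wordWeight l) := by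
        rw [← Real.exp_add, wordWeight]; ring_nf
      have h4 : Real.exp (-R * wordWeight l) ≤ Real.exp (-ε * wordWeight l) := by
        apply Real.exp_le_exp.2
        nlinarith [wordWeight_nonneg l]
      rw [e, List.length_cons, pow_succ]
      have h2 : (1 : ℝ) ≤ K ^ l.length := one_le_pow₀ hK
      have hK0 : 0 ≤ K := by linarith
      calc _ = (‖(γ t)⁻¹‖ * (C * expSum (R - ε))) * (B * Real.exp (-R * wordWeight l) *
            Real.exp (-ε * |(n : ℝ)|)) := by ring
        _ ≤ K * (B * Real.exp (-ε * wordWeight l) * Real.exp (-ε * |(n : ℝ)|)) := by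
            gcongr
            exact hK2 t
        _ = 1 * (K * (B * Real.exp (-ε * wordWeight l) * Real.exp (-ε * |(n : ℝ)|))) := by ring
        _ ≤ K ^ l.length * (K * (B * Real.exp (-ε * wordWeight l) *
            Real.exp (-ε * |(n : ℝ)|))) := by gcongr
        _ = _ := by ring

/-- The homotopy keeps the pattern of second components and raises the degree by one. -/
theorem exists_of_wordHomotopy_ne_zero (l : List Letter) {c : List Letter → ℂ}
    (hc : wordHomotopy D S γ l c ≠ 0) : ∃ l' : List Letter,
      (l'.map fun x => x.2.1) = (l.map fun x => x.2.1) ∧ upperCount l' + 1 = upperCount l ∧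
      c l' ≠ 0 := by
  contrapose! hc
  induction l generalizing c with
  | nil => rfl
  | cons x l ih =>
    obtain ⟨_ | _, t, n⟩ := x
    · rw [wordHomotopy, ih, mul_zero]
      intro l' h1 h2
      have h3 : ∀ k, c ((false, t, k) :: l') = 0 := by
        intro k
        apply hc
        · simp [h1]
        · simpa [upperCount] using h2
      simp [slotRemainder, h3]
    · have h3 : ∀ k, c ((false, t, k) :: l) = 0 := by
        intro k
        apply hc
        · simp
        · simp [upperCount]
      simp [wordHomotopy, h3]

/-- Damped cycles supported in positive degree are boundaries. -/
theorem wordDiff_wordHomotopy (hD : IsDampedKernel D M L) (hS : IsLeftInverseKernel D S ε C)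
    (hεM : ε < M) (hεR : ε < R) (hγ : ∀ t, γ t ≠ 0) (l : List Letter) {c : List Letter → ℂ}
    {B : ℝ} (hc : Damped R B c) (h0 : ∀ l, upperCount l = 0 → c l = 0)
    (hcl : ∀ l, wordDiff D γ l c = 0) :
    wordDiff D γ l (fun l' => wordHomotopy D S γ l' c) = c l := by
  have hR : 0 ≤ R := hS.pos.le.trans hεR.le
  induction l generalizing c B with
  | nil => rw [h0 [] rfl]; rfl
  | cons x l ih =>
    have hB := hc.nonneg
    -- closedness, solved for the differential at a lower first letter
    have hlow : ∀ (t : Bool) (m : ℤ) (l : List Letter),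
        wordDiff D γ l (fun l' => c ((false, t, m) :: l')) =
          -(letterSign false t * γ t) * ∑' k, D k m * c ((true, t, k) :: l) := by
      intro t m l
      have h1 := hcl ((false, t, m) :: l)
      simp only [wordDiff, Bool.false_eq_true, if_false] at h1
      have h2 := letterSign_sq false t
      linear_combination letterSign false t * h1 -
        wordDiff D γ l (fun l' => c ((false, t, m) :: l')) * h2
    -- the differential of the divided part
    have hdiv : ∀ (t : Bool) (n : ℤ) (l : List Letter),
        wordDiff D γ l (fun l' => ∑' m, S n m * c ((false, t, m) :: l')) =
          -(letterSign false t * γ t) * c ((true, t, n) :: l) := by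
      intro t n l
      rw [wordDiff_tsum hD (u := fun m => (C * B * Real.exp (-ε * |(n : ℝ)|)) *
        Real.exp (-(R - ε) * |(m : ℝ)|))
        ((summable_exp_neg_abs (sub_pos.2 hεR)).mul_left _) (fun m l' => ?_)]
      · simp only [wordDiff_smul, hlow]
        have e : (fun m => S n m * (-(letterSign false t * γ t) *
            ∑' k, D k m * c ((true, t, k) :: l))) = fun m => -(letterSign false t * γ t) *
            (S n m * ∑' k, D k m * c ((true, t, k) :: l)) := by funext m; ring
        rw [e, tsum_mul_left, hS.tsum_tsum hD hεM hεR n (hc.cons_apply true t l)]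
      · refine hS.norm_mul_le n (b := fun m => c ((false, t, m) :: l')) (fun k => ?_) m
        refine (hc.cons_apply false t l' k).trans ?_
        gcongr
        refine mul_le_of_le_one_right hB ?_
        rw [Real.exp_le_one_iff]
        nlinarith [wordWeight_nonneg l']
    obtain ⟨_ | _, t, n⟩ := x
    -- At a lower first letter, differentiating that slot returns `DS c`, and induction on the tail
    -- returns the complementary part `c - DS c`.
    · simp only [wordDiff, wordHomotopy, Bool.false_eq_true, if_false]
      have e : (fun m => D m n * ((γ t)⁻¹ * ∑' k, S m k * c ((false, t, k) :: l))) = fun m =>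
          (γ t)⁻¹ * (D m n * ∑' k, S m k * c ((false, t, k) :: l)) := by funext m; ring
      have hinner : ∀ l' m, ‖∑' k, S m k * c ((false, t, k) :: l')‖ ≤
          C * expSum (R - ε) * B := by
        intro l' m
        refine (hS.norm_tsum_le hεR m (hc.cons_apply false t l')).trans ?_
        have h1 : Real.exp (-R * wordWeight l') ≤ 1 := by
          rw [Real.exp_le_one_iff]; nlinarith [wordWeight_nonneg l']
        have h2 : Real.exp (-ε * |(m : ℝ)|) ≤ 1 := by
          rw [Real.exp_le_one_iff]; nlinarith [abs_nonneg (m : ℝ), hS.pos]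
        have hE := expSum_nonneg (R - ε)
        have hC := hS.nonneg
        calc _ ≤ C * expSum (R - ε) * (B * 1) * 1 := by gcongr
          _ = _ := by ring
      rw [e, tsum_mul_left, ← mul_assoc, mul_inv_cancel₀ (hγ t), one_mul, wordDiff_smul,
        ← mul_assoc, letterSign_sq, one_mul]
      rw [ih (hc.slotRemainder hD hS hεM hεR t n)]
      · simp [slotRemainder]
      · intro l' hl'
        have h3 : ∀ k, c ((false, t, k) :: l') = 0 := by
          intro k
          apply h0
          simpa [upperCount] using hl'
        simp [slotRemainder, h3]
      -- The remainder is again a cycle: the differential of `c` at a lower first letter lies in the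
      -- image of `D`, and `1 - DS` kills this image because `SD = 1`.
      · intro l'
        unfold slotRemainder
        rw [wordDiff_sub hD (B := B) (B' := L * expSum M * (C * expSum (R - ε) * B))
          (fun l'' => hc.norm_le hR _) (fun l'' => hD.norm_tsum_le n (hinner l'')),
          wordDiff_tsum hD (u := fun m => ‖D m n‖ * (C * expSum (R - ε) * B))
          ((hD.summable_norm n).mul_right _)]
        · simp only [wordDiff_smul, hdiv, hlow]
          rw [← tsum_mul_left, sub_eq_zero]
          congr 1
          funext m
          ring
        · intro m l''
          rw [norm_mul]
          exact mul_le_mul_of_nonneg_left (hinner l'' m) (norm_nonneg _)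
    -- At an upper first letter only the tail is differentiated; `hdiv` and the opposite parities of
    -- upper and lower letters return `c` with sign `+1`.
    · simp only [wordDiff, wordHomotopy, if_true]
      rw [wordDiff_smul, hdiv, zero_add]
      have h2 := letterSign_mul t
      have h3 := inv_mul_cancel₀ (hγ t)
      linear_combination -((γ t)⁻¹ * γ t * c ((true, t, n) :: l)) * h2 + c ((true, t, n) :: l) * h3

end

/-! ### Translation invariant words. -/

noncomputable section

variable {D : ℤ → ℤ → ℂ} {M L : ℝ} {γ : Bool → ℂ}

/-- The pattern of second components of the letters of a word. -/
abbrev wordPattern (l : List Letter) : List Bool := l.map fun x => x.2.1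

theorem wordPattern_shiftWord (k : ℤ) (l : List Letter) :
    wordPattern (shiftWord k l) = wordPattern l := by
  simp [wordPattern, shiftWord]

theorem upperCount_shiftWord (k : ℤ) (l : List Letter) :
    upperCount (shiftWord k l) = upperCount l := by
  simp only [upperCount, shiftWord, List.countP_map]
  rfl

theorem shiftWord_shiftWord (j k : ℤ) (l : List Letter) :
    shiftWord j (shiftWord k l) = shiftWord (k + j) l := by
  simp [shiftWord, add_assoc]

theorem shiftWord_zero (l : List Letter) : shiftWord 0 l = l := by
  simp [shiftWord]

theorem wordWeight_le_shiftWord (k : ℤ) (l : List Letter) :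
    wordWeight l ≤ wordWeight (shiftWord k l) + l.length * |(k : ℝ)| := by
  induction l with
  | nil => simp [wordWeight, shiftWord]
  | cons x l ih =>
    simp only [shiftWord, List.map_cons, wordWeight, List.length_cons] at ih ⊢
    have h : |(x.2.2 : ℝ)| ≤ |((x.2.2 + k : ℤ) : ℝ)| + |(k : ℝ)| := by
      have := abs_sub (((x.2.2 + k : ℤ) : ℝ)) (k : ℝ)
      push_cast at this ⊢
      simpa using this
    push_cast at h ⊢
    linarith

/-- Support on words of one length `n` turns the length-dependent bound into a single constant `K ^
n`. -/
theorem exists_damped_homotopy (hD : IsDampedKernel D M L) (hD0 : D ≠ 0) (hγ : ∀ t, γ t ≠ 0)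
    {R : ℝ} (hR : 0 < R) (n : ℕ) :
    ∃ ε, 0 < ε ∧ ∃ (S : ℤ → ℤ → ℂ) (K : ℝ), ∀ (c : List Letter → ℂ) (B : ℝ), Damped R B c →
      (∀ l, c l ≠ 0 → l.length = n) →
      Damped ε (K * B) (fun l => wordHomotopy D S γ l c) ∧
      ((∀ l, upperCount l = 0 → c l = 0) → (∀ l, wordDiff D γ l c = 0) →
        ∀ l, wordDiff D γ l (fun l' => wordHomotopy D S γ l' c) = c l) := by
  have hd : ∀ m n : ℤ, D m n = D (m - n) 0 := fun m n => by
    rw [← hD.shift (m - n) 0 n]; simp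
  have hd0 : (fun k => D k 0) ≠ 0 := by
    intro h
    apply hD0
    ext m n
    rw [hd]
    exact congrFun h (m - n)
  obtain ⟨ε, hε, hεR, hεM, S, C, hS, hSD⟩ := exists_left_inverse_kernel hd0 hD.pos
    (fun k => by simpa using hD.bound k 0) hR
  have hSL : IsLeftInverseKernel D S ε C := ⟨hε, hS, fun n k => by
    have := hSD n k
    simpa only [← hd] using this⟩
  let K : ℝ := 1 + L * expSum (M - ε) * (C * expSum (R - ε)) +
    ‖(γ true)⁻¹‖ * (C * expSum (R - ε)) + ‖(γ false)⁻¹‖ * (C * expSum (R - ε))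
  have hE := expSum_nonneg (R - ε)
  have hE' := expSum_nonneg (M - ε)
  have hL := hD.nonneg
  have hC := hSL.nonneg
  have p1 : 0 ≤ L * expSum (M - ε) * (C * expSum (R - ε)) := by positivity
  have p2 : 0 ≤ ‖(γ true)⁻¹‖ * (C * expSum (R - ε)) := by positivity
  have p3 : 0 ≤ ‖(γ false)⁻¹‖ * (C * expSum (R - ε)) := by positivity
  refine ⟨ε, hε, S, K ^ n, fun c B hc hlen => ⟨fun l => ?_, fun h0 hcl l =>
    wordDiff_wordHomotopy hD hSL hεM hεR hγ l hc h0 hcl⟩⟩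
  have hB := hc.nonneg
  have hK : 0 ≤ K := by simp only [K]; linarith
  by_cases hl : wordHomotopy D S γ l c = 0
  · beta_reduce
    rw [hl, norm_zero]; positivity
  · obtain ⟨l', h1, -, h3⟩ := exists_of_wordHomotopy_ne_zero l hl
    have hln : l.length = n := by
      rw [← hlen l' h3]
      simpa using (congrArg List.length h1).symm
    rw [← hln]
    refine norm_wordHomotopy_le hD hSL hεM hεR ?_ ?_ ?_ l hc
    · simp only [K]; linarith
    · rintro (_ | _) <;> simp only [K] <;> linarith
    · simp only [K]; linarith

/-- The kernel acting on the first slot of translation invariant coefficient functions, in terms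
of their restrictions to first letters at the origin. -/
def gaugeOp (D : ℤ → ℤ → ℂ) (b : List Letter → ℂ) : List Letter → ℂ :=
  fun l => ∑' m, D m 0 * b (shiftWord (-m) l)

theorem Damped.gaugeOp (hD : IsDampedKernel D M L) {R B : ℝ} (hR : 0 < R) (n : ℕ) :
    ∃ ε, 0 < ε ∧ ε ≤ R ∧ ∃ K, 0 ≤ K ∧ ∀ b : List Letter → ℂ, Damped R B b →
      (∀ l, b l ≠ 0 → l.length = n) → Damped ε (K * B) (gaugeOp D b) := by
  have hM := hD.pos
  have hL := hD.nonneg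
  -- Translating `n` letters by `m` may change the weight by `n * |m|`, so the kernel has to absorb
  -- `e^{εn|m|}`; this choice ensures `ε * n < M`.
  let ε := min R (M / (2 * (n + 1)))
  have hε : 0 < ε := lt_min hR (by positivity)
  have hεn : ε * n < M := by
    have h1 : ε ≤ M / (2 * (n + 1)) := min_le_right _ _
    rw [le_div_iff₀ (by positivity)] at h1
    nlinarith
  have hE := expSum_nonneg (M - ε * n)
  refine ⟨ε, hε, min_le_left _ _, L * expSum (M - ε * n), by positivity, fun b hb hlen l => ?_⟩
  have hB := hb.nonneg
  have hb' := hb.mono (min_le_left R (M / (2 * (n + 1)))) le_rfl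
  by_cases hl : l.length = n
  · have hs := (summable_exp_neg_abs (sub_pos.2 hεn)).mul_left
      (L * B * Real.exp (-ε * wordWeight l))
    refine (tsum_of_norm_bounded hs.hasSum fun m => ?_).trans ?_
    · rw [norm_mul]
      have h1 := hD.bound m 0
      rw [sub_zero] at h1
      refine (mul_le_mul h1 (hb' _) (norm_nonneg _)
        (mul_nonneg hL (Real.exp_pos _).le)).trans ?_
      have e1 : L * Real.exp (-M * |(m : ℝ)|) *
          (B * Real.exp (-ε * wordWeight (shiftWord (-m) l))) =
          L * B * Real.exp (-M * |(m : ℝ)| + -ε * wordWeight (shiftWord (-m) l)) := by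
        rw [Real.exp_add]; ring
      have e2 : L * B * Real.exp (-ε * wordWeight l) *
          Real.exp (-(M - ε * n) * |(m : ℝ)|) =
          L * B * Real.exp (-ε * wordWeight l + -(M - ε * n) * |(m : ℝ)|) := by
        rw [Real.exp_add]; ring
      rw [e2]
      refine e1.le.trans (mul_le_mul_of_nonneg_left (Real.exp_le_exp.2 ?_) (by positivity))
      have h2 := wordWeight_le_shiftWord (-m) l
      rw [hl] at h2
      push_cast at h2
      rw [abs_neg] at h2
      nlinarith
    · rw [tsum_mul_left]
      apply le_of_eq
      simp only [expSum]; ring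
  · have : LatticeSUSY.gaugeOp D b l = 0 := by
      have h3 : ∀ m, b (shiftWord (-m) l) = 0 := by
        intro m
        by_contra h
        apply hl
        rw [← hlen _ h]
        simp [shiftWord]
      simp [LatticeSUSY.gaugeOp, h3]
    rw [this, norm_zero]
    positivity

/-- Extension of coefficient functions for first letters at the origin to a translation invariant
coefficient function. -/
def ungauge (b : Bool → Bool → List Letter → ℂ) : List Letter → ℂ
  | [] => 0
  | x :: l => b x.1 x.2.1 (shiftWord (-x.2.2) l)

theorem ungauge_shiftWord (b : Bool → Bool → List Letter → ℂ) (k : ℤ) (l : List Letter) :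
    ungauge b (shiftWord k l) = ungauge b l := by
  cases l with
  | nil => rfl
  | cons x l =>
    change b x.1 x.2.1 (shiftWord (-(x.2.2 + k)) (shiftWord k l)) = b x.1 x.2.1 _
    rw [shiftWord_shiftWord]
    congr 2
    ring

/-- Translation invariant, damped cycles in degree at least two are boundaries. -/
theorem exists_word_primitive (hD : IsDampedKernel D M L) (hD0 : D ≠ 0) (hγ : ∀ t, γ t ≠ 0)
    {c : List Letter → ℂ} {n : ℕ} (hshift : ∀ k l, c (shiftWord k l) = c l)
    (hlen : ∀ l, c l ≠ 0 → l.length = n + 1) (hup : ∀ l, c l ≠ 0 → 2 ≤ upperCount l)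
    {R B : ℝ} (hR : 0 < R) (hdec : ∀ κ t, Damped R B fun l => c ((κ, t, 0) :: l))
    (hcl : ∀ l, wordDiff D γ l c = 0) :
    ∃ b : List Letter → ℂ, (∀ k l, b (shiftWord k l) = b l) ∧
      (∀ l, b l ≠ 0 → ∃ l', wordPattern l' = wordPattern l ∧ upperCount l' + 1 = upperCount l ∧
        c l' ≠ 0) ∧
      (∃ R' > 0, ∃ B', ∀ κ t, Damped R' B' fun l => b ((κ, t, 0) :: l)) ∧
      ∀ l, wordDiff D γ l b = c l := by
  -- The homotopy needs a kernel whose `ε` lies below the rate of its input. It is applied to the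
  -- upper slices at rate `R` and to the corrected lower slices at a smaller rate, hence two
  -- kernels.
  obtain ⟨ε₁, hε₁, S₁, K₁, H₁⟩ := exists_damped_homotopy hD hD0 hγ hR n
  obtain ⟨ε₂, hε₂, hε₁₂, K₂, hK₂, H₂⟩ := Damped.gaugeOp hD (B := K₁ * B) hε₁ n
  have hr : 0 < min R ε₂ := lt_min hR hε₂
  obtain ⟨ε₃, hε₃, S₃, K₃, H₃⟩ := exists_damped_homotopy hD hD0 hγ hr n
  have hfirst : ∀ κ t m l, c ((κ, t, m) :: l) = c ((κ, t, 0) :: shiftWord (-m) l) := by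
    intro κ t m l
    rw [← hshift (-m)]
    simp [shiftWord]
  have hlen' : ∀ κ t l, c ((κ, t, 0) :: l) ≠ 0 → l.length = n := by
    intro κ t l h
    simpa using hlen _ h
  -- For an upper first letter at the origin the cycle condition involves only the tail, so these
  -- slices can be inverted first.
  let bu : Bool → List Letter → ℂ := fun t l =>
    letterSign true t * wordHomotopy D S₁ γ l fun l' => c ((true, t, 0) :: l')
  have hbu : ∀ t l, wordDiff D γ l (bu t) = letterSign true t * c ((true, t, 0) :: l) := by
    intro t l
    simp only [bu]
    rw [wordDiff_smul]
    rw [(H₁ _ B (hdec true t) (hlen' true t)).2]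
    -- This is where degree two is needed: removing an upper first letter must leave at least one
    -- upper letter in the tail.
    · intro l hl
      by_contra h
      have := hup _ h
      simp only [upperCount] at hl this
      simp [hl] at this
    · intro l
      have h1 := hcl ((true, t, 0) :: l)
      simp only [wordDiff, if_true, zero_add] at h1
      have h2 := letterSign_sq true t
      linear_combination letterSign true t * h1 -
        wordDiff D γ l (fun l' => c ((true, t, 0) :: l')) * h2
  have hbuD : ∀ t, Damped ε₁ (K₁ * B) (bu t) := by
    intro t l
    simp only [bu]
    rw [norm_mul, norm_letterSign, one_mul]
    exact (H₁ _ B (hdec true t) (hlen' true t)).1 l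
  have hbus : ∀ t l, bu t l ≠ 0 → ∃ l', wordPattern l' = wordPattern l ∧
      upperCount l' + 1 = upperCount l ∧ c ((true, t, 0) :: l') ≠ 0 := by
    intro t l h
    exact exists_of_wordHomotopy_ne_zero l (right_ne_zero_of_mul h)
  have hbul : ∀ t l, bu t l ≠ 0 → l.length = n := by
    intro t l h
    obtain ⟨l', h1, -, h3⟩ := hbus t l h
    rw [← hlen' _ _ _ h3]
    simpa using (congrArg List.length h1).symm
  have hgD := fun t => H₂ (bu t) (hbuD t) (hbul t)
  -- The primitive's upper slices already contribute to the lower slices through the first slot.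
  -- Subtracting this contribution leaves a cycle of the tail complex that vanishes in degree zero.
  let e : Bool → List Letter → ℂ := fun t l => c ((false, t, 0) :: l) - γ t * gaugeOp D (bu t) l
  have hKB : 0 ≤ K₂ * (K₁ * B) := (hgD true).nonneg
  have heD : ∀ t, Damped (min R ε₂) (B + (‖γ true‖ + ‖γ false‖) * (K₂ * (K₁ * B))) (e t) := by
    intro t l
    refine (norm_sub_le _ _).trans ?_
    rw [norm_mul, add_mul]
    refine add_le_add ((hdec false t).mono (min_le_left _ _) le_rfl l) ?_
    rw [mul_assoc]
    refine mul_le_mul ?_ ((hgD t).mono (min_le_right _ _) le_rfl l) (norm_nonneg _) (by positivity)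
    cases t <;> simp
  have hes : ∀ t l, e t l ≠ 0 → c ((false, t, 0) :: l) ≠ 0 ∨ ∃ m, bu t (shiftWord (-m) l) ≠ 0 := by
    intro t l h
    by_contra! hcon
    apply h
    simp [e, gaugeOp, hcon.1, hcon.2]
  have hel : ∀ t l, e t l ≠ 0 → l.length = n := by
    intro t l h
    obtain h | ⟨m, h⟩ := hes t l h
    · exact hlen' _ _ _ h
    · simpa [shiftWord] using hbul _ _ h
  let bv : Bool → List Letter → ℂ := fun t l =>
    letterSign false t * wordHomotopy D S₃ γ l (e t)
  have hbv : ∀ t l, letterSign false t * wordDiff D γ l (bv t) = e t l := by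
    intro t l
    simp only [bv]
    rw [wordDiff_smul, ← mul_assoc, letterSign_sq, one_mul]
    rw [(H₃ _ _ (heD t) (hel t)).2]
    · intro l hl
      by_contra h
      obtain h | ⟨m, h⟩ := hes t l h
      · have := hup _ h
        simp only [upperCount] at hl this
        simp [hl] at this
      · obtain ⟨l', -, h2, h3⟩ := hbus _ _ h
        rw [upperCount_shiftWord] at h2
        omega
    · intro l
      have hb1 : ∀ l, ‖bu t l‖ ≤ K₁ * B := (hbuD t).norm_le hε₁.le
      have h1 := hcl ((false, t, 0) :: l)
      simp only [wordDiff, Bool.false_eq_true, if_false] at h1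
      simp only [e]
      rw [wordDiff_sub hD (B := B) (B' := ‖γ t‖ * (K₂ * (K₁ * B)))
        ((hdec false t).norm_le hR.le) (fun l => by
          rw [norm_mul]
          exact mul_le_mul_of_nonneg_left ((hgD t).norm_le hε₂.le l) (norm_nonneg _)),
        wordDiff_smul]
      unfold gaugeOp
      rw [wordDiff_tsum hD (u := fun m => ‖D m 0‖ * (K₁ * B)) ((hD.summable_norm 0).mul_right _)
        (fun m l => by
          rw [norm_mul]
          exact mul_le_mul_of_nonneg_left (hb1 _) (norm_nonneg _))]
      simp only [wordDiff_smul, wordDiff_shift hD, hbu]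
      have h2 : (fun m => D m 0 * (letterSign true t * c ((true, t, 0) :: shiftWord (-m) l))) =
          fun m => letterSign true t * (D m 0 * c ((true, t, m) :: l)) := by
        funext m
        rw [hfirst true t m]; ring
      rw [h2, tsum_mul_left]
      have h3 := letterSign_sq false t
      have h4 : letterSign true t = -letterSign false t := by cases t <;> simp [letterSign]
      linear_combination letterSign false t * h1 -
        wordDiff D γ l (fun l' => c ((false, t, 0) :: l')) * h3 - γ t *
        (∑' m, D m 0 * c ((true, t, m) :: l)) * h4
  let bb : Bool → Bool → List Letter → ℂ := fun κ t => if κ then bu t else bv t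
  refine ⟨ungauge bb, ungauge_shiftWord bb, ?_, ?_, ?_⟩
  · intro l h
    cases l with
    | nil => exact absurd rfl h
    | cons x l =>
      obtain ⟨_ | _, t, m⟩ := x
      · have h' : bv t (shiftWord (-m) l) ≠ 0 := h
        obtain ⟨l', h1, h2, h3⟩ := exists_of_wordHomotopy_ne_zero _ (right_ne_zero_of_mul h')
        rw [upperCount_shiftWord] at h2
        have h1' : wordPattern l' = wordPattern l := h1.trans (wordPattern_shiftWord _ _)
        obtain h3 | ⟨j, h3⟩ := hes t _ h3
        · refine ⟨_, ?_, ?_, h3⟩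
          · simpa [wordPattern] using h1'
          · simpa [upperCount] using h2
        · obtain ⟨l'', h4, h5, h6⟩ := hbus _ _ h3
          rw [upperCount_shiftWord] at h5
          have h4' : wordPattern l'' = wordPattern l :=
            (h4.trans (wordPattern_shiftWord _ _)).trans h1'
          refine ⟨_, ?_, ?_, h6⟩
          · simpa [wordPattern] using h4'
          · simp only [upperCount] at h2 h5 ⊢
            simp
            omega
      · have h' : bu t (shiftWord (-m) l) ≠ 0 := h
        obtain ⟨l', h1, h2, h3⟩ := hbus _ _ h'
        rw [upperCount_shiftWord] at h2
        have h1' : wordPattern l' = wordPattern l := h1.trans (wordPattern_shiftWord _ _)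
        refine ⟨_, ?_, ?_, h3⟩
        · simpa [wordPattern] using h1'
        · simpa [upperCount] using h2
  · have hbvD := fun t => (H₃ _ _ (heD t) (hel t)).1
    have q1 := (hbuD true).nonneg
    have q2 := (hbvD true).nonneg
    refine ⟨min ε₁ ε₃, lt_min hε₁ hε₃, K₁ * B +
      K₃ * (B + (‖γ true‖ + ‖γ false‖) * (K₂ * (K₁ * B))), ?_⟩
    rintro (_ | _) t l
    · have : ungauge bb ((false, t, 0) :: l) = bv t l := by
        simp [ungauge, bb, shiftWord_zero]
      dsimp only
      rw [this]
      simp only [bv]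
      rw [norm_mul, norm_letterSign, one_mul]
      exact (hbvD t).mono (min_le_right _ _) (by linarith) l
    · have : ungauge bb ((true, t, 0) :: l) = bu t l := by
        simp [ungauge, bb, shiftWord_zero]
      dsimp only
      rw [this]
      exact (hbuD t).mono (min_le_left _ _) (by linarith) l
  · intro l
    cases l with
    | nil =>
      by_contra h
      have := hlen [] (fun h' => h (by rw [h']; rfl))
      simp at this
    | cons x l =>
      obtain ⟨_ | _, t, m⟩ := x
      · simp only [wordDiff, Bool.false_eq_true, if_false]
        have h1 : (fun l' => ungauge bb ((false, t, m) :: l')) =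
            fun l' => bv t (shiftWord (-m) l') := rfl
        have h2 : ∀ k, ungauge bb ((true, t, k) :: l) = bu t (shiftWord (-k) l) := fun k => rfl
        rw [h1, wordDiff_shift hD, hbv]
        simp only [h2, e, gaugeOp]
        rw [hfirst false t m]
        have h3 : ∑' k, D k m * bu t (shiftWord (-k) l) =
            ∑' k, D k 0 * bu t (shiftWord (-k) (shiftWord (-m) l)) := by
          rw [← (Equiv.addRight m).tsum_eq fun k => D k m * bu t (shiftWord (-k) l)]
          congr 1
          funext k
          have := hD.shift k 0 m
          rw [zero_add] at this
          rw [Equiv.coe_addRight, this, shiftWord_shiftWord]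
          congr 3
          ring
        rw [h3]; ring
      · simp only [wordDiff, if_true, zero_add]
        have h1 : (fun l' => ungauge bb ((true, t, m) :: l')) =
            fun l' => bu t (shiftWord (-m) l') := rfl
        rw [h1, wordDiff_shift hD, hbu, ← mul_assoc, letterSign_sq, one_mul, ← hfirst]

end

/-! ### Intertwining words and functionals. -/

noncomputable section

variable {D : ℤ → ℤ → ℂ} {M L : ℝ} {γ : Bool → ℂ} {σ : Charge}

/-- The kind of field encoded by the two Boolean components of a letter. -/
def letterKind : Bool → Bool → BosonKind ⊕ FermionKind
  | false, false => .inl .phi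
  | true, false => .inr .chi
  | true, true => .inl .aux
  | false, true => .inr .chiBar

/-- The field variable with label `σ` encoded by a letter. -/
def toField (σ : Charge) (x : Letter) : Species × ℤ := ((letterKind x.1 x.2.1, σ), x.2.2)

theorem toField_injective (σ : Charge) : Function.Injective (toField σ) := by
  rintro ⟨_ | _, _ | _, n⟩ ⟨_ | _, _ | _, m⟩ <;> simp [toField, letterKind]

/-- Partners in the differential have opposite parity, so exactly one of the two exchanges with `x`
can produce a sign: the differential is odd. -/
theorem fsign_lower_mul_upper (t : Bool) (m k : ℤ) (x : Letter) :
    fsign (toField σ (false, t, m)) (toField σ x) * fsign (toField σ (true, t, k)) (toField σ x) =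
      letterSign x.1 x.2.1 := by
  obtain ⟨_ | _, _ | _, n⟩ := x <;> cases t <;>
    simp [fsign, toField, letterKind, letterSign]

theorem fsign_mul_lower_upper (t : Bool) (m k : ℤ) (x : Letter) :
    fsign (toField σ x) (toField σ (false, t, m)) * fsign (toField σ x) (toField σ (true, t, k)) =
      letterSign x.1 x.2.1 := by
  obtain ⟨_ | _, _ | _, n⟩ := x <;> cases t <;>
    simp [fsign, toField, letterKind, letterSign]

theorem fsign_site_left (κ t : Bool) (m k : ℤ) (v : Species × ℤ) :
    fsign (toField σ (κ, t, m)) v = fsign (toField σ (κ, t, k)) v := rfl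

theorem fsign_site_right (κ t : Bool) (m k : ℤ) (v : Species × ℤ) :
    fsign v (toField σ (κ, t, m)) = fsign v (toField σ (κ, t, k)) := rfl

/-- The sites occurring in a basis monomial. -/
def sites (a : Boson →₀ ℕ) (A : Finset Fermion) : Finset ℤ :=
  a.support.image (fun b => b.2.2) ∪ A.image (fun ψ => ψ.2.2)

theorem mem_sites_of_mult_ne_zero {v : Species × ℤ} {a : Boson →₀ ℕ} {A : Finset Fermion}
    (h : mult v a A ≠ 0) : v.2 ∈ sites a A := by
  obtain ⟨⟨b | ψ, τ⟩, n⟩ := v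
  · simp only [mult] at h
    simp only [sites, Finset.mem_union, Finset.mem_image]
    exact Or.inl ⟨(b, τ, n), by simpa using h, rfl⟩
  · simp only [mult] at h
    simp only [sites, Finset.mem_union, Finset.mem_image]
    exact Or.inr ⟨(ψ, τ, n), by simpa using h, rfl⟩

theorem mulField_eq_zero {v : Species × ℤ} {a : Boson →₀ ℕ} {A : Finset Fermion}
    (h : v.2 ∉ sites a A) (f : Functional) : mulField v f a A = 0 := by
  have h1 : mult v a A = 0 := by
    by_contra h2
    exact h (mem_sites_of_mult_ne_zero h2)
  rw [mulField_apply, (mulCoef_eq_zero_iff v a A).2 h1, zero_mul]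

theorem sites_rem_subset (v : Species × ℤ) (a : Boson →₀ ℕ) (A : Finset Fermion) :
    sites (remB v a) (remF v A) ⊆ sites a A := by
  obtain ⟨⟨b | ψ, τ⟩, n⟩ := v
  · apply Finset.union_subset_union _ (Finset.Subset.refl _)
    apply Finset.image_subset_image
    intro b' hb'
    simp only [remB, Finsupp.mem_support_iff, Finsupp.tsub_apply] at hb' ⊢
    omega
  · apply Finset.union_subset_union (Finset.Subset.refl _)
    exact Finset.image_subset_image (Finset.erase_subset _ _)

theorem sites_add_subset (v : Species × ℤ) (a : Boson →₀ ℕ) (A : Finset Fermion) :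
    sites (addB v a) (addF v A) ⊆ insert v.2 (sites a A) := by
  intro n hn
  obtain ⟨⟨b | ψ, τ⟩, m⟩ := v
  · simp only [addB, addF, sites, Finset.mem_union, Finset.mem_image, Finset.mem_insert,
      Finsupp.mem_support_iff, Finsupp.add_apply, Finsupp.single_apply] at hn ⊢
    obtain ⟨b', h1, rfl⟩ | h := hn
    · split at h1
      · next h2 => left; rw [← h2]
      · right; left; exact ⟨b', by simpa using h1, rfl⟩
    · exact Or.inr (Or.inr h)
  · simp only [addB, addF, sites, Finset.mem_union, Finset.mem_image, Finset.mem_insert] at hn ⊢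
    obtain h | ⟨ψ', rfl | h1, rfl⟩ := hn
    · exact Or.inr (Or.inl h)
    · exact Or.inl rfl
    · exact Or.inr (Or.inr ⟨ψ', h1, rfl⟩)

/-- The letters with sites in a given set. -/
def letters (T : Finset ℤ) : Finset Letter := Finset.univ ×ˢ Finset.univ ×ˢ T

theorem mem_letters {T : Finset ℤ} {x : Letter} : x ∈ letters T ↔ x.2.2 ∈ T := by
  simp [letters]

theorem sum_letters_subset {a : Boson →₀ ℕ} {A : Finset Fermion} {T : Finset ℤ}
    (hT : sites a A ⊆ T) (w : Letter → ℂ) (g : Letter → Functional) :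
    ∑ x ∈ letters (sites a A), w x * mulField (toField σ x) (g x) a A =
      ∑ x ∈ letters T, w x * mulField (toField σ x) (g x) a A := by
  apply Finset.sum_subset
  · intro x hx
    exact mem_letters.2 (hT (mem_letters.1 hx))
  · intro x _ hx
    rw [mulField_eq_zero (fun h => hx (mem_letters.2 h)), mul_zero]

/-- The functional `∑ c(x₁ … xₙ) X_{x₁} ⋯ X_{xₙ}`, summed over words of length `n`. -/
def wordSum (σ : Charge) : ℕ → (List Letter → ℂ) → Functional
  | 0, c => fun a A => c [] * one a A
  | n + 1, c => fun a A => ∑ x ∈ letters (sites a A),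
      mulField (toField σ x) (wordSum σ n fun l => c (x :: l)) a A

theorem wordSum_succ (n : ℕ) (c : List Letter → ℂ) {a : Boson →₀ ℕ} {A : Finset Fermion}
    {T : Finset ℤ} (hT : sites a A ⊆ T) :
    wordSum σ (n + 1) c a A = ∑ x ∈ letters T,
      mulField (toField σ x) (wordSum σ n fun l => c (x :: l)) a A := by
  have := sum_letters_subset (σ := σ) hT (fun _ => 1)
    fun x => wordSum σ n fun l => c (x :: l)
  simp only [one_mul] at this
  exact this

/-- Every coefficient of `wordSum` is a finite combination of values of the word function, so
pointwise convergence suffices. -/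
theorem hasSum_wordSum {ι : Type*} (n : ℕ) {e : ι → List Letter → ℂ} {s : List Letter → ℂ}
    (h : ∀ l, HasSum (fun k => e k l) (s l)) (a : Boson →₀ ℕ) (A : Finset Fermion) :
    HasSum (fun k => wordSum σ n (e k) a A) (wordSum σ n s a A) := by
  induction n generalizing e s a A with
  | zero => exact (h []).mul_right _
  | succ n ih =>
    refine hasSum_sum fun x _ => ?_
    simp only [mulField_apply]
    exact (ih (fun l => h (x :: l)) _ _).mul_left _

theorem wordSum_smul (n : ℕ) (w : ℂ) (c : List Letter → ℂ) (a : Boson →₀ ℕ) (A : Finset Fermion) :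
    wordSum σ n (fun l => w * c l) a A = w * wordSum σ n c a A := by
  induction n generalizing c a A with
  | zero => simp [wordSum, mul_assoc]
  | succ n ih =>
    simp only [wordSum, mulField_apply, Finset.mul_sum]
    refine Finset.sum_congr rfl fun x _ => ?_
    rw [ih fun l => c (x :: l)]; ring

theorem wordSum_add (n : ℕ) (c c' : List Letter → ℂ) (a : Boson →₀ ℕ) (A : Finset Fermion) :
    wordSum σ n (fun l => c l + c' l) a A = wordSum σ n c a A + wordSum σ n c' a A := by
  induction n generalizing c c' a A with
  | zero => simp [wordSum, add_mul]
  | succ n ih =>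
    simp only [wordSum, mulField_apply, ← Finset.sum_add_distrib]
    refine Finset.sum_congr rfl fun x _ => ?_
    rw [ih (fun l => c (x :: l)) fun l => c' (x :: l)]; ring

theorem wordSum_zero (n : ℕ) (a : Boson →₀ ℕ) (A : Finset Fermion) :
    wordSum σ n (fun _ => 0) a A = 0 := by
  have := wordSum_smul (σ := σ) n 0 (fun _ => 0) a A
  simpa using this

theorem norm_one_le (a : Boson →₀ ℕ) (A : Finset Fermion) : ‖one a A‖ ≤ 1 := by
  unfold one; split <;> simp

theorem norm_wordSum_le (n : ℕ) {c : List Letter → ℂ} {B : ℝ} (hc : ∀ l, ‖c l‖ ≤ B)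
    {a : Boson →₀ ℕ} {A : Finset Fermion} {N : ℕ} (hN : (sites a A).card ≤ N) :
    ‖wordSum σ n c a A‖ ≤ (4 * N) ^ n * B := by
  have hB : 0 ≤ B := (norm_nonneg _).trans (hc [])
  induction n generalizing c a A with
  | zero =>
    simp only [wordSum, norm_mul, pow_zero, one_mul]
    exact (mul_le_mul (hc []) (norm_one_le a A) (norm_nonneg _) hB).trans (by simp)
  | succ n ih =>
    simp only [wordSum]
    refine (norm_sum_le _ _).trans ?_
    have h1 : ∀ x ∈ letters (sites a A),
        ‖mulField (toField σ x) (wordSum σ n fun l => c (x :: l)) a A‖ ≤ (4 * N) ^ n * B := by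
      intro x _
      rw [mulField_apply, norm_mul]
      have h2 := ih (c := fun l => c (x :: l)) (fun l => hc _)
        ((Finset.card_le_card (sites_rem_subset (toField σ x) a A)).trans hN)
      refine (mul_le_mul (norm_mulCoef_le _ _ _) h2 (norm_nonneg _) zero_le_one).trans ?_
      rw [one_mul]
    refine (Finset.sum_le_card_nsmul _ _ _ h1).trans ?_
    have h3 : ((letters (sites a A)).card : ℝ) ≤ 4 * N := by
      have h4 : (letters (sites a A)).card = 2 * (2 * (sites a A).card) := by
        simp [letters, Finset.card_product]
      rw [h4]
      push_cast
      have : ((sites a A).card : ℝ) ≤ N := by exact_mod_cast hN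
      linarith
    rw [nsmul_eq_mul, pow_succ]
    have h5 : (0 : ℝ) ≤ (4 * N) ^ n * B := by positivity
    nlinarith [mul_le_mul_of_nonneg_right h3 h5]

/-- Functionals whose first derivatives are bounded, monomial by monomial. -/
def DerivBounded (f : Functional) : Prop :=
  ∀ a A, ∃ B : ℝ, ∀ v, ‖derivField v f a A‖ ≤ B

theorem mult_le (v : Species × ℤ) (a : Boson →₀ ℕ) (A : Finset Fermion) :
    mult v a A ≤ a.degree + 1 := by
  obtain ⟨⟨b | ψ, τ⟩, n⟩ := v <;> simp only [mult]
  · exact (Finsupp.le_degree _ _).trans (Nat.le_succ _)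
  · split <;> omega

theorem derivBounded_of_bounded {f : Functional} (h : ∀ a A, ∃ B : ℝ, ∀ v,
    ‖f (addB v a) (addF v A)‖ ≤ B) : DerivBounded f := by
  intro a A
  obtain ⟨B, hB⟩ := h a A
  refine ⟨((a.degree + 1 : ℕ) + 1) * B, fun v => ?_⟩
  rw [derivField_apply, norm_mul]
  refine mul_le_mul ((norm_derivCoef_le _ _ _).trans ?_) (hB v) (norm_nonneg _) (by positivity)
  have := mult_le v a A
  have : (mult v a A : ℝ) ≤ (a.degree + 1 : ℕ) := by exact_mod_cast this
  linarith

/-- Differentiating looks at a monomial with at most one more site, which bounds the number of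
contributing words uniformly in the variable. The infinite contractions with `D` then converge. -/
theorem derivBounded_wordSum (n : ℕ) {c : List Letter → ℂ} {B : ℝ} (hc : ∀ l, ‖c l‖ ≤ B) :
    DerivBounded (wordSum σ n c) := by
  refine derivBounded_of_bounded fun a A => ⟨_, fun v => norm_wordSum_le n hc
    (N := (sites a A).card + 1) ((Finset.card_le_card (sites_add_subset v a A)).trans
      (Finset.card_insert_le _ _))⟩

theorem derivField_wordSum (y : Letter) (n : ℕ) (c : List Letter → ℂ) {a : Boson →₀ ℕ}
    {A : Finset Fermion} {T : Finset ℤ} (hT : sites a A ⊆ T) :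
    derivField (toField σ y) (wordSum σ (n + 1) c) a A =
      wordSum σ n (fun l => c (y :: l)) a A + ∑ x ∈ letters T,
        fsign (toField σ y) (toField σ x) * mulField (toField σ x)
          (derivField (toField σ y) (wordSum σ n fun l => c (x :: l))) a A := by
  have h1 : sites (addB (toField σ y) a) (addF (toField σ y) A) ⊆ insert y.2.2 T :=
    (sites_add_subset _ _ _).trans (Finset.insert_subset_insert _ hT)
  rw [derivField_apply, wordSum_succ n c h1, Finset.mul_sum]
  have h2 : ∀ x, derivCoef (toField σ y) a A * mulField (toField σ x)
      (wordSum σ n fun l => c (x :: l)) (addB (toField σ y) a) (addF (toField σ y) A) =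
      (if y = x then wordSum σ n (fun l => c (x :: l)) a A else 0) +
        fsign (toField σ y) (toField σ x) * mulField (toField σ x)
          (derivField (toField σ y) (wordSum σ n fun l => c (x :: l))) a A := by
    intro x
    rw [← derivField_apply, derivField_mulField]
    simp only [(toField_injective σ).eq_iff]
  simp only [h2]
  rw [Finset.sum_add_distrib, Finset.sum_ite_eq,
    if_pos (mem_letters.2 (Finset.mem_insert_self _ _)),
    ← sum_letters_subset hT, ← sum_letters_subset (hT.trans (Finset.subset_insert _ _))]

/-- Contraction of a derivative with respect to the letters `χ` or `F` with the kernel. -/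
def slotOp (D : ℤ → ℤ → ℂ) (γ : Bool → ℂ) (σ : Charge) (t : Bool) (n : ℤ) (f : Functional) :
    Functional :=
  fun a A => γ t * ∑' m, D m n * derivField (toField σ (true, t, m)) f a A

/-- The part of a supersymmetry acting on the fields with label `σ`, in the form of a finite sum
for each coefficient. -/
def susyOp (D : ℤ → ℤ → ℂ) (γ : Bool → ℂ) (σ : Charge) (f : Functional) : Functional :=
  fun a A => ∑ p ∈ (Finset.univ ×ˢ sites a A : Finset (Bool × ℤ)),
    mulField (toField σ (false, p.1, p.2)) (slotOp D γ σ p.1 p.2 f) a A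

theorem susyOp_eq (f : Functional) {a : Boson →₀ ℕ} {A : Finset Fermion} {T : Finset ℤ}
    (hT : sites a A ⊆ T) : susyOp D γ σ f a A = ∑ p ∈ (Finset.univ ×ˢ T : Finset (Bool × ℤ)),
      mulField (toField σ (false, p.1, p.2)) (slotOp D γ σ p.1 p.2 f) a A := by
  apply Finset.sum_subset (Finset.product_subset_product_right hT)
  intro p hp hp'
  simp only [Finset.mem_product, Finset.mem_univ, true_and] at hp'
  exact mulField_eq_zero hp' _

theorem derivField_slotOp (y : Letter) (t : Bool) (n : ℤ) (f : Functional) (a : Boson →₀ ℕ)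
    (A : Finset Fermion) :
    derivField (toField σ y) (slotOp D γ σ t n f) a A =
      fsign (toField σ y) (toField σ (true, t, 0)) *
        slotOp D γ σ t n (derivField (toField σ y) f) a A := by
  rw [derivField_apply]
  unfold slotOp
  have : ∀ m, derivField (toField σ (true, t, m)) (derivField (toField σ y) f) a A =
      fsign (toField σ y) (toField σ (true, t, 0)) * (derivCoef (toField σ y) a A *
        derivField (toField σ (true, t, m)) f (addB (toField σ y) a) (addF (toField σ y) A)) := by
    intro m
    rw [← derivField_apply, derivField_comm (toField σ y), ← mul_assoc]
    have h1 : fsign (toField σ y) (toField σ (true, t, 0)) *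
        fsign (toField σ y) (toField σ (true, t, m)) = 1 := by
      rw [fsign_site_right true t m 0]
      unfold fsign; split <;> simp
    rw [h1, one_mul]
  simp only [this]
  have h2 : fsign (toField σ y) (toField σ (true, t, 0)) *
      fsign (toField σ y) (toField σ (true, t, 0)) = 1 := by
    unfold fsign; split <;> simp
  have h3 : (fun m => D m n * (fsign (toField σ y) (toField σ (true, t, 0)) *
      (derivCoef (toField σ y) a A * derivField (toField σ (true, t, m)) f
        (addB (toField σ y) a) (addF (toField σ y) A)))) = fun m =>
      (fsign (toField σ y) (toField σ (true, t, 0)) * derivCoef (toField σ y) a A) *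
      (D m n * derivField (toField σ (true, t, m)) f
        (addB (toField σ y) a) (addF (toField σ y) A)) := by
    funext m; ring
  rw [h3, tsum_mul_left]
  linear_combination -(derivCoef (toField σ y) a A * γ t * ∑' m, D m n *
    derivField (toField σ (true, t, m)) f (addB (toField σ y) a) (addF (toField σ y) A)) * h2

/-- The graded commutator of `∂_y` with the differential: the inhomogeneous term comes from
differentiating the explicit lower factor, so it is absent for upper `y`. -/
theorem derivField_susyOp (y : Letter) (f : Functional) (a : Boson →₀ ℕ) (A : Finset Fermion) :
    derivField (toField σ y) (susyOp D γ σ f) a A =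
      (if y.1 then 0 else slotOp D γ σ y.2.1 y.2.2 f a A) +
        letterSign y.1 y.2.1 * susyOp D γ σ (derivField (toField σ y) f) a A := by
  have h1 : sites (addB (toField σ y) a) (addF (toField σ y) A) ⊆ insert y.2.2 (sites a A) :=
    sites_add_subset _ _ _
  rw [derivField_apply, susyOp_eq f h1, susyOp_eq _ (Finset.subset_insert y.2.2 (sites a A)),
    Finset.mul_sum, Finset.mul_sum]
  have h2 : ∀ p : Bool × ℤ, derivCoef (toField σ y) a A *
      mulField (toField σ (false, p.1, p.2)) (slotOp D γ σ p.1 p.2 f)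
        (addB (toField σ y) a) (addF (toField σ y) A) =
      (if y = (false, p.1, p.2) then slotOp D γ σ p.1 p.2 f a A else 0) +
        letterSign y.1 y.2.1 * mulField (toField σ (false, p.1, p.2))
          (slotOp D γ σ p.1 p.2 (derivField (toField σ y) f)) a A := by
    intro p
    rw [← derivField_apply, derivField_mulField]
    simp only [(toField_injective σ).eq_iff]
    congr 1
    rw [mulField_apply, derivField_slotOp, mulField_apply,
      ← fsign_mul_lower_upper (σ := σ) p.1 p.2 0 y]
    ring
  simp only [h2]
  rw [Finset.sum_add_distrib]
  congr 1
  obtain ⟨_ | _, t, m⟩ := y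
  · rw [Finset.sum_eq_single (t, m)]
    · simp
    · rintro ⟨t', m'⟩ _ h
      rw [if_neg]
      intro h'
      apply h
      simpa [eq_comm] using h'
    · intro h
      simp at h
  · simp

/-- The polarised coefficient of a word: the iterated derivative at the origin. -/
def polar (σ : Charge) : List Letter → Functional → ℂ
  | [], f => f 0 ∅
  | x :: l, f => polar σ l (derivField (toField σ x) f)

/-- Iterated derivatives at the origin see a single basis monomial. Linearity of `polar` and the
transfer of pointwise bounds all follow from this form. -/
theorem exists_polar_eq (l : List Letter) : ∃ (a : Boson →₀ ℕ) (A : Finset Fermion) (K : ℂ),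
    ‖K‖ ≤ (l.length + 1).factorial ∧ (∀ f, polar σ l f = K * f a A) ∧ a.degree ≤ l.length ∧
      ∀ x ∈ l, K ≠ 0 → mult (toField σ x) a A ≠ 0 := by
  induction l with
  | nil => exact ⟨0, ∅, 1, by simp, fun f => by simp [polar], by simp, by simp⟩
  | cons x l ih =>
    obtain ⟨a, A, K, h1, h2, h3, h4⟩ := ih
    refine ⟨addB (toField σ x) a, addF (toField σ x) A, K * derivCoef (toField σ x) a A, ?_,
      fun f => ?_, ?_, ?_⟩
    · rw [norm_mul, List.length_cons, Nat.factorial_succ, mul_comm]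
      push_cast
      have h5 := mult_le (toField σ x) a A
      have h6 : (mult (toField σ x) a A : ℝ) ≤ l.length + 1 := by
        exact_mod_cast h5.trans (Nat.succ_le_succ h3)
      refine mul_le_mul ((norm_derivCoef_le _ _ _).trans (by linarith)) h1 (norm_nonneg _)
        (by positivity)
    · rw [polar, h2, derivField_apply, mul_assoc]
    · rw [List.length_cons]
      obtain ⟨κ, t, m⟩ := x
      cases κ <;> cases t <;> simp [toField, letterKind, addB] <;> omega
    · intro y hy hK
      have hK1 := left_ne_zero_of_mul hK
      have hK2 := right_ne_zero_of_mul hK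
      obtain rfl | hy := List.mem_cons.1 hy
      · obtain ⟨κ, t, m⟩ := y
        cases κ <;> cases t <;> simp [toField, letterKind, addB, addF, mult]
      · have h5 := h4 y hy hK1
        obtain ⟨κ, t, m⟩ := x
        obtain ⟨κ', t', m'⟩ := y
        cases κ <;> cases t <;> cases κ' <;> cases t' <;>
          simp_all [toField, letterKind, addB, addF, mult]

theorem polar_susyOp (l : List Letter) (f : Functional) :
    polar σ l (susyOp D γ σ f) = wordDiff D γ l fun l' => polar σ l' f := by
  induction l generalizing f with
  | nil => simp [polar, susyOp, wordDiff, sites]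
  | cons x l ih =>
    rw [polar, wordDiff]
    have h1 : derivField (toField σ x) (susyOp D γ σ f) = fun a A =>
      (if x.1 then 0 else slotOp D γ σ x.2.1 x.2.2 f a A) +
        letterSign x.1 x.2.1 * susyOp D γ σ (derivField (toField σ x) f) a A := by
      funext a A
      exact derivField_susyOp x f a A
    have h2 := ih (derivField (toField σ x) f)
    simp only [polar]
    rw [← h2, h1]
    obtain ⟨a, A, K, -, h3, -, -⟩ := exists_polar_eq (σ := σ) l
    simp only [h3]
    have h4 : (fun m => D m x.2.2 * (K * derivField (toField σ (true, x.2.1, m)) f a A)) =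
        fun m => K * (D m x.2.2 * derivField (toField σ (true, x.2.1, m)) f a A) := by
      funext m; ring
    rw [h4, tsum_mul_left]
    unfold slotOp
    split <;> ring

theorem slotOp_wordSum_succ (hD : IsDampedKernel D M L) (t : Bool) (m : ℤ) (n : ℕ)
    {c : List Letter → ℂ} {B : ℝ} (hc : ∀ l, ‖c l‖ ≤ B) {a : Boson →₀ ℕ}
    {A : Finset Fermion} {T : Finset ℤ} (hT : sites a A ⊆ T) :
    slotOp D γ σ t m (wordSum σ (n + 1) c) a A =
      wordSum σ n (fun l => γ t * ∑' k, D k m * c ((true, t, k) :: l)) a A +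
        ∑ x ∈ letters T, fsign (toField σ (true, t, 0)) (toField σ x) *
          mulField (toField σ x) (slotOp D γ σ t m (wordSum σ n fun l => c (x :: l))) a A := by
  have h1 : HasSum (fun k => D k m * wordSum σ n (fun l => c ((true, t, k) :: l)) a A)
      (wordSum σ n (fun l => ∑' k, D k m * c ((true, t, k) :: l)) a A) := by
    have := hasSum_wordSum (σ := σ) n (e := fun k l => D k m * c ((true, t, k) :: l))
      (fun l => (hD.summable_mul m fun k => hc _).hasSum) a A
    simpa only [wordSum_smul] using this
  have h2 : ∀ x, HasSum (fun k => D k m * (fsign (toField σ (true, t, k)) (toField σ x) *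
      mulField (toField σ x) (derivField (toField σ (true, t, k))
        (wordSum σ n fun l => c (x :: l))) a A))
      (fsign (toField σ (true, t, 0)) (toField σ x) * (mulCoef (toField σ x) a A *
        ∑' k, D k m * derivField (toField σ (true, t, k)) (wordSum σ n fun l => c (x :: l))
          (remB (toField σ x) a) (remF (toField σ x) A))) := by
    intro x
    obtain ⟨B', hB'⟩ := derivBounded_wordSum (σ := σ) n (c := fun l => c (x :: l))
      (fun l => hc _) (remB (toField σ x) a) (remF (toField σ x) A)
    have h3 := (hD.summable_mul m fun k => hB' (toField σ (true, t, k))).hasSum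
    have h4 := (h3.mul_left (mulCoef (toField σ x) a A)).mul_left
      (fsign (toField σ (true, t, 0)) (toField σ x))
    refine h4.congr_fun fun k => ?_
    rw [mulField_apply, fsign_site_left true t k 0]; ring
  have h5 := (h1.add (hasSum_sum fun x (_ : x ∈ letters T) => h2 x)).tsum_eq
  have h6 : ∀ k, D k m * derivField (toField σ (true, t, k)) (wordSum σ (n + 1) c) a A =
      D k m * wordSum σ n (fun l => c ((true, t, k) :: l)) a A + ∑ x ∈ letters T,
        D k m * (fsign (toField σ (true, t, k)) (toField σ x) * mulField (toField σ x)
          (derivField (toField σ (true, t, k)) (wordSum σ n fun l => c (x :: l))) a A) := by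
    intro k
    rw [derivField_wordSum _ n c hT, mul_add, Finset.mul_sum]
  rw [slotOp]
  simp only [h6]
  rw [h5, wordSum_smul, mul_add, Finset.mul_sum]
  congr 1
  refine Finset.sum_congr rfl fun x _ => ?_
  rw [mulField_apply]
  unfold slotOp
  ring

/-- No symmetry of `c` is required, so this applies to primitives from the homotopy although they
are not graded symmetric. -/
theorem susyOp_wordSum (hD : IsDampedKernel D M L) (n : ℕ) {c : List Letter → ℂ} {B : ℝ}
    (hc : ∀ l, ‖c l‖ ≤ B) (a : Boson →₀ ℕ) (A : Finset Fermion) :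
    susyOp D γ σ (wordSum σ n c) a A = wordSum σ n (fun l => wordDiff D γ l c) a A := by
  induction n generalizing c a A with
  | zero =>
    have h1 : ∀ x, derivField (toField σ x) (wordSum σ 0 c) = fun _ _ => 0 := by
      intro x
      funext a A
      rw [derivField_apply]
      obtain ⟨κ, t, m⟩ := x
      cases κ <;> cases t <;> simp [wordSum, one, toField, letterKind, addB, addF]
    have h2 : ∀ t m, slotOp D γ σ t m (wordSum σ 0 c) = fun _ _ => 0 := by
      intro t m
      funext a A
      simp only [slotOp, h1]
      simp
    simp only [susyOp, h2, mulField_apply]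
    simp [wordSum, wordDiff]
  | succ n ih =>
    let T := sites a A
    have hrem : ∀ v, sites (remB v a) (remF v A) ⊆ T := fun v => sites_rem_subset v a A
    -- Taking the derivative past `X_x` gives one sign and moving the lower factor past `X_x` gives
    -- another; together they form `letterSign`.
    have hleft : ∀ p : Bool × ℤ, mulField (toField σ (false, p.1, p.2))
        (slotOp D γ σ p.1 p.2 (wordSum σ (n + 1) c)) a A =
        mulField (toField σ (false, p.1, p.2)) (wordSum σ n fun l =>
          γ p.1 * ∑' k, D k p.2 * c ((true, p.1, k) :: l)) a A +
        ∑ x ∈ letters T, letterSign x.1 x.2.1 * mulField (toField σ x)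
          (mulField (toField σ (false, p.1, p.2))
            (slotOp D γ σ p.1 p.2 (wordSum σ n fun l => c (x :: l)))) a A := by
      intro p
      rw [mulField_apply, slotOp_wordSum_succ hD _ _ n hc (hrem _), mul_add, ← mulField_apply,
        Finset.mul_sum]
      congr 1
      refine Finset.sum_congr rfl fun x _ => ?_
      rw [mulField_comm (toField σ x), mulField_apply (toField σ (false, p.1, p.2)),
        ← fsign_lower_mul_upper (σ := σ) p.1 p.2 0 x]
      have h2 : fsign (toField σ x) (toField σ (false, p.1, p.2)) *
          fsign (toField σ (false, p.1, p.2)) (toField σ x) = 1 := by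
        unfold fsign
        by_cases h : (toField σ x).1.1.isRight <;>
          by_cases h' : (toField σ (false, p.1, p.2)).1.1.isRight <;> simp [h, h']
      linear_combination -(mulCoef (toField σ (false, p.1, p.2)) a A *
        fsign (toField σ (true, p.1, 0)) (toField σ x) * mulField (toField σ x)
        (slotOp D γ σ p.1 p.2 (wordSum σ n fun l => c (x :: l)))
        (remB (toField σ (false, p.1, p.2)) a) (remF (toField σ (false, p.1, p.2)) A)) * h2
    rw [susyOp_eq _ (Finset.Subset.refl T), wordSum_succ n _ (Finset.Subset.refl T)]
    simp only [hleft]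
    rw [Finset.sum_add_distrib, Finset.sum_comm]
    have hright : ∀ x, mulField (toField σ x)
        (wordSum σ n fun l => wordDiff D γ (x :: l) c) a A =
        mulField (toField σ x) (wordSum σ n fun l => if x.1 then 0 else
          γ x.2.1 * ∑' m, D m x.2.2 * c ((true, x.2.1, m) :: l)) a A +
        letterSign x.1 x.2.1 * mulField (toField σ x)
          (susyOp D γ σ (wordSum σ n fun l => c (x :: l))) a A := by
      intro x
      simp only [wordDiff]
      rw [mulField_apply, wordSum_add, wordSum_smul, mulField_apply, mulField_apply,
        ih (c := fun l => c (x :: l)) fun l => hc _]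
      ring
    simp only [hright]
    rw [Finset.sum_add_distrib]
    congr 1
    · have h3 : ∑ x ∈ letters T, mulField (toField σ x) (wordSum σ n fun l => if x.1 then 0 else
          γ x.2.1 * ∑' m, D m x.2.2 * c ((true, x.2.1, m) :: l)) a A =
          ∑ κ : Bool, ∑ p ∈ (Finset.univ ×ˢ T : Finset (Bool × ℤ)),
            mulField (toField σ (κ, p.1, p.2)) (wordSum σ n fun l => if κ then 0 else
              γ p.1 * ∑' m, D m p.2 * c ((true, p.1, m) :: l)) a A := by
        unfold letters
        rw [Finset.sum_product]
      rw [h3, Fintype.sum_bool]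
      have h4 : ∀ p : Bool × ℤ, mulField (toField σ (true, p.1, p.2)) (wordSum σ n fun l =>
          if true = true then 0 else
            γ p.1 * ∑' m, D m p.2 * c ((true, p.1, m) :: l)) a A = 0 := by
        intro p
        rw [mulField_apply]
        simp [wordSum_zero]
      rw [Finset.sum_eq_zero fun p _ => h4 p, zero_add]
      rfl
    · refine Finset.sum_congr rfl fun x _ => ?_
      rw [mulField_apply, susyOp_eq _ (hrem _), Finset.mul_sum, Finset.mul_sum]
      refine Finset.sum_congr rfl fun p _ => ?_
      rw [← mulField_apply]

end

/-! ### Counting fields, reconstruction from words, and the part in `φ` and `χ`. -/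

noncomputable section

variable {D : ℤ → ℤ → ℂ} {M L : ℝ} {γ : Bool → ℂ} {σ : Charge}

theorem addB_remB {v : Species × ℤ} {a : Boson →₀ ℕ} {A : Finset Fermion}
    (h : mult v a A ≠ 0) : addB v (remB v a) = a := by
  obtain ⟨⟨b | ψ, τ⟩, n⟩ := v
  · simp only [addB, remB]
    apply tsub_add_cancel_of_le
    rw [Finsupp.single_le_iff]
    exact Nat.one_le_iff_ne_zero.2 h
  · rfl

theorem addF_remF {v : Species × ℤ} {a : Boson →₀ ℕ} {A : Finset Fermion}
    (h : mult v a A ≠ 0) : addF v (remF v A) = A := by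
  obtain ⟨⟨b | ψ, τ⟩, n⟩ := v
  · rfl
  · simp only [addF, remF]
    apply Finset.insert_erase
    simpa [mult] using h

theorem derivCoef_rem_ne_zero (v : Species × ℤ) (a : Boson →₀ ℕ) (A : Finset Fermion) :
    derivCoef v (remB v a) (remF v A) ≠ 0 := by
  obtain ⟨⟨b | ψ, τ⟩, n⟩ := v
  · simp only [derivCoef]
    exact Nat.cast_add_one_ne_zero _
  · simp [derivCoef, remF, moveSign]

theorem fieldCount_add (τ : Charge) {v : Species × ℤ} {a : Boson →₀ ℕ} {A : Finset Fermion}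
    (h : derivCoef v a A ≠ 0) :
    fieldCount τ (addB v a) (addF v A) = fieldCount τ a A + if v.1.2 = τ then 1 else 0 := by
  obtain ⟨⟨b | ψ, ρ⟩, n⟩ := v
  · simp only [fieldCount, addB, addF]
    rw [Finsupp.sum_add_index', Finsupp.sum_single_index]
    · ring
    · simp
    · simp
    · intros; split <;> simp
  · have h1 : (ψ, ρ, n) ∉ A := by
      intro h1
      simp [derivCoef, h1] at h
    simp only [fieldCount, addB, addF]
    rw [Finset.filter_insert]
    split
    · rw [Finset.card_insert_of_notMem (by simp [h1])]; ring
    · rfl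

theorem fermionNumber_add {x : Letter} {a : Boson →₀ ℕ} {A : Finset Fermion}
    (h : derivCoef (toField σ x) a A ≠ 0) :
    fermionNumber (addF (toField σ x) A) = fermionNumber A +
      ((if x.1 then 1 else 0) - (if x.2.1 then 1 else 0)) := by
  obtain ⟨κ, t, n⟩ := x
  have key : ∀ ψ : FermionKind, derivCoef ((.inr ψ, σ), n) a A ≠ 0 → (ψ, σ, n) ∉ A := by
    intro ψ h1 h2
    simp [derivCoef, h2] at h1
  cases κ <;> cases t <;> simp only [toField, letterKind, addF, fermionNumber] at h ⊢
  · simp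
  · rw [Finset.filter_insert, Finset.filter_insert]
    simp [Finset.card_insert_of_notMem, key _ h]
    ring
  · rw [Finset.filter_insert, Finset.filter_insert]
    simp [Finset.card_insert_of_notMem, key _ h]
    ring
  · simp

theorem fieldCount_rem (τ : Charge) {v : Species × ℤ} {a : Boson →₀ ℕ} {A : Finset Fermion}
    (h : mult v a A ≠ 0) :
    fieldCount τ (remB v a) (remF v A) + (if v.1.2 = τ then 1 else 0) = fieldCount τ a A := by
  rw [← fieldCount_add τ (derivCoef_rem_ne_zero v a A), addB_remB h, addF_remF h]

theorem fermionNumber_rem {x : Letter} {a : Boson →₀ ℕ} {A : Finset Fermion}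
    (h : mult (toField σ x) a A ≠ 0) :
    fermionNumber (remF (toField σ x) A) +
      ((if x.1 then 1 else 0) - (if x.2.1 then 1 else 0)) = fermionNumber A := by
  rw [← fermionNumber_add (derivCoef_rem_ne_zero (toField σ x) a A), addF_remF h]

theorem sum_mult_eq_fieldCount (σ : Charge) (a : Boson →₀ ℕ) (A : Finset Fermion) :
    ∑ x ∈ letters (sites a A), mult (toField σ x) a A = fieldCount σ a A := by
  set T := sites a A with hT
  have hB : ∀ b ∈ a.support, b.2.2 ∈ T := fun b hb =>
    Finset.mem_union_left _ (Finset.mem_image_of_mem (fun b : Boson => b.2.2) hb)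
  have hF : ∀ ψ ∈ A, ψ.2.2 ∈ T := fun ψ hψ =>
    Finset.mem_union_right _ (Finset.mem_image_of_mem (fun ψ : Fermion => ψ.2.2) hψ)
  have h1 : ∑ x ∈ letters T, mult (toField σ x) a A =
      (∑ n ∈ T, a (.phi, σ, n) + ∑ n ∈ T, a (.aux, σ, n)) +
      (∑ n ∈ T, (if (FermionKind.chi, σ, n) ∈ A then 1 else 0) +
        ∑ n ∈ T, (if (FermionKind.chiBar, σ, n) ∈ A then 1 else 0)) := by
    unfold letters
    rw [Finset.sum_product]
    simp only [Finset.sum_product, Fintype.sum_bool, toField, letterKind, mult]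
    ring
  rw [h1, fieldCount]
  congr 1
  · have e1 : ∀ k : BosonKind, ∑ n ∈ T, a (k, σ, n) =
        ∑ b ∈ T.image (fun n => (k, σ, n)), a b := by
      intro k
      rw [Finset.sum_image]
      intro x _ y _ h
      simpa using h
    rw [e1, e1, ← Finset.sum_union, Finsupp.sum, ← Finset.sum_filter]
    · symm
      apply Finset.sum_subset
      · rintro ⟨k, τ, n⟩ hb
        rw [Finset.mem_filter] at hb
        obtain ⟨hb, h2⟩ := hb
        have h3 := hB _ hb
        dsimp only at h2 h3
        subst h2
        cases k <;> simp [h3]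
      · intro b hb hb'
        rw [Finset.mem_filter, Finsupp.mem_support_iff] at hb'
        by_contra h
        apply hb'
        refine ⟨h, ?_⟩
        simp only [Finset.mem_union, Finset.mem_image] at hb
        obtain ⟨n, _, rfl⟩ | ⟨n, _, rfl⟩ := hb <;> rfl
    · rw [Finset.disjoint_left]
      intro b h2 h3
      simp only [Finset.mem_image] at h2 h3
      obtain ⟨n, _, rfl⟩ := h2
      obtain ⟨m, _, h⟩ := h3
      simp at h
  · have e1 : ∀ k : FermionKind, ∑ n ∈ T, (if (k, σ, n) ∈ A then 1 else 0) =
        ((T.filter fun n => (k, σ, n) ∈ A).image (fun n => ((k, σ, n) : Fermion))).card := by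
      intro k
      rw [Finset.card_image_of_injective, Finset.card_filter]
      intro x y h
      simpa using h
    rw [e1, e1, ← Finset.card_union_of_disjoint]
    · congr 1
      ext ⟨k, τ, n⟩
      simp only [Finset.mem_union, Finset.mem_image, Finset.mem_filter]
      constructor
      · rintro (⟨m, ⟨_, h2⟩, h3⟩ | ⟨m, ⟨_, h2⟩, h3⟩) <;>
        · simp only [Prod.mk.injEq] at h3
          obtain ⟨rfl, rfl, rfl⟩ := h3
          exact ⟨h2, rfl⟩
      · rintro ⟨h2, rfl⟩
        have h3 := hF _ h2
        cases k
        · exact Or.inl ⟨n, ⟨h3, h2⟩, rfl⟩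
        · exact Or.inr ⟨n, ⟨h3, h2⟩, rfl⟩
    · rw [Finset.disjoint_left]
      intro b h2 h3
      simp only [Finset.mem_image] at h2 h3
      obtain ⟨n, _, rfl⟩ := h2
      obtain ⟨m, _, h⟩ := h3
      simp at h

theorem fieldCount_eq_zero {a : Boson →₀ ℕ} {A : Finset Fermion}
    (h1 : fieldCount .plus a A = 0) (h2 : fieldCount .minus a A = 0) : a = 0 ∧ A = ∅ := by
  have h3 : ∀ τ, fieldCount τ a A = 0 := by rintro (_ | _) <;> assumption
  simp only [fieldCount, Nat.add_eq_zero_iff, Finset.card_eq_zero, Finsupp.sum,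
    Finset.sum_eq_zero_iff] at h3
  constructor
  · ext b
    by_contra h
    have := (h3 b.2.1).1 b (by simpa using h)
    simp at this
    exact h this
  · rw [Finset.eq_empty_iff_forall_notMem]
    intro ψ hψ
    have := (h3 ψ.2.1).2
    rw [Finset.filter_eq_empty_iff] at this
    exact this hψ rfl

/-- The other label. -/
def Charge.other : Charge → Charge
  | .plus => .minus
  | .minus => .plus

theorem Charge.other_ne (σ : Charge) : σ ≠ σ.other := by cases σ <;> simp [Charge.other]

/-- Summing the polarised coefficients against the words recovers a multiple of the homogeneous
part of a functional. -/
theorem wordSum_polar (n : ℕ) (f : Functional) {a : Boson →₀ ℕ} {A : Finset Fermion}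
    (h : fieldCount σ.other a A = 0) :
    wordSum σ n (fun l => polar σ l f) a A =
      if fieldCount σ a A = n then (n.factorial : ℂ) * f a A else 0 := by
  induction n generalizing f a A with
  | zero =>
    simp only [wordSum, polar, one]
    by_cases h0 : fieldCount σ a A = 0
    · have h1 : a = 0 ∧ A = ∅ := by
        cases σ
        · exact fieldCount_eq_zero h0 h
        · exact fieldCount_eq_zero h h0
      obtain ⟨rfl, rfl⟩ := h1
      simp [h0]
    · rw [if_neg h0, if_neg, mul_zero]
      rintro ⟨rfl, rfl⟩
      simp [fieldCount] at h0
  | succ n ih =>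
    simp only [wordSum, polar]
    -- Removing `x` lowers the order by one, so induction supplies `n!` times the number operator of
    -- `x`; summing over `x` supplies the factor `n + 1`.
    have h1 : ∀ x : Letter, mulField (toField σ x)
        (wordSum σ n fun l => polar σ l (derivField (toField σ x) f)) a A =
        if fieldCount σ a A = n + 1 then
          (n.factorial : ℂ) * ((mult (toField σ x) a A : ℂ) * f a A) else 0 := by
      intro x
      by_cases hx : mult (toField σ x) a A = 0
      · rw [mulField_apply, (mulCoef_eq_zero_iff _ _ _).2 hx, hx]
        simp
      · have h2 := fieldCount_rem σ.other hx
        have h3 := fieldCount_rem σ hx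
        have h4 : (toField σ x).1.2 = σ := rfl
        rw [h4, if_neg (Charge.other_ne σ), add_zero] at h2
        rw [h4, if_pos rfl] at h3
        rw [mulField_apply, ih _ (h2.trans h), ← mulField_derivField, mulField_apply]
        by_cases h5 : fieldCount σ a A = n + 1
        · rw [if_pos h5, if_pos (by omega)]; ring
        · rw [if_neg h5, if_neg (by omega), mul_zero]
    simp only [h1]
    split
    · next h5 =>
      rw [← Finset.mul_sum, ← Finset.sum_mul, ← Nat.cast_sum, sum_mult_eq_fieldCount, h5,
        Nat.factorial_succ]
      push_cast; ring
    · simp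

theorem exists_word_of_wordSum_ne_zero (n : ℕ) {c : List Letter → ℂ} {a : Boson →₀ ℕ}
    {A : Finset Fermion} (h : wordSum σ n c a A ≠ 0) :
    fieldCount σ a A = n ∧ fieldCount σ.other a A = 0 ∧
      ∃ l : List Letter, l.length = n ∧ wordFermion l = fermionNumber A ∧ c l ≠ 0 := by
  induction n generalizing c a A with
  | zero =>
    simp only [wordSum, one] at h
    have h1 := left_ne_zero_of_mul h
    have h2 := right_ne_zero_of_mul h
    have h3 : a = 0 ∧ A = ∅ := by
      by_contra h3
      rw [if_neg h3] at h2
      exact h2 rfl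
    obtain ⟨rfl, rfl⟩ := h3
    exact ⟨by simp [fieldCount], by simp [fieldCount], [], rfl,
      by simp [wordFermion, fermionNumber], h1⟩
  | succ n ih =>
    simp only [wordSum] at h
    obtain ⟨x, -, hx⟩ := Finset.exists_ne_zero_of_sum_ne_zero h
    rw [mulField_apply] at hx
    have h1 := left_ne_zero_of_mul hx
    obtain ⟨h2, h3, l, h4, h5, h6⟩ := ih (right_ne_zero_of_mul hx)
    have hm : mult (toField σ x) a A ≠ 0 := fun h7 => h1 ((mulCoef_eq_zero_iff _ _ _).2 h7)
    have h7 := fieldCount_rem σ.other hm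
    have h8 := fieldCount_rem σ hm
    have h9 := fermionNumber_rem hm
    have h10 : (toField σ x).1.2 = σ := rfl
    rw [h10, if_neg (Charge.other_ne σ), add_zero] at h7
    rw [h10, if_pos rfl] at h8
    refine ⟨by omega, by omega, x :: l, by simp [h4], ?_, h6⟩
    rw [wordFermion, h5, ← h9]; ring

theorem wordSum_congr (n : ℕ) {c c' : List Letter → ℂ} (h : ∀ l, l.length = n → c l = c' l)
    (a : Boson →₀ ℕ) (A : Finset Fermion) : wordSum σ n c a A = wordSum σ n c' a A := by
  induction n generalizing c c' a A with
  | zero => simp [wordSum, h [] rfl]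
  | succ n ih =>
    simp only [wordSum, mulField_apply]
    refine Finset.sum_congr rfl fun x _ => ?_
    rw [ih fun l hl => h (x :: l) (by simp [hl])]

theorem HasFermionNumber.polar {q : ℤ} {f : Functional} (hf : HasFermionNumber q f)
    {l : List Letter} (h : polar σ l f ≠ 0) : wordFermion l = q := by
  induction l generalizing f q with
  | nil =>
    have := hf 0 ∅ h
    simpa [wordFermion, fermionNumber] using this
  | cons x l ih =>
    have h1 : HasFermionNumber (q - ((if x.1 then 1 else 0) - (if x.2.1 then 1 else 0)))
        (derivField (toField σ x) f) := by
      intro a A h2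
      rw [derivField_apply] at h2
      have h3 := hf _ _ (right_ne_zero_of_mul h2)
      rw [fermionNumber_add (left_ne_zero_of_mul h2)] at h3
      rw [← h3]; ring
    rw [wordFermion, ih h1 h]; ring

/-- Basis monomials that contain only the fields `φ` and `χ`. -/
def IsPlain (a : Boson →₀ ℕ) (A : Finset Fermion) : Prop :=
  (∀ b, a b ≠ 0 → b.1 = .phi) ∧ ∀ ψ ∈ A, ψ.1 = .chi

open Classical in
/-- The part of a functional that contains only the fields `φ` and `χ`. -/
def plainPart (f : Functional) : Functional := fun a A => if IsPlain a A then f a A else 0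

theorem isPlain_add_iff {x : Letter} {a : Boson →₀ ℕ} {A : Finset Fermion} :
    IsPlain (addB (toField σ x) a) (addF (toField σ x) A) ↔ x.2.1 = false ∧ IsPlain a A := by
  obtain ⟨κ, t, n⟩ := x
  have aux : ∀ k : BosonKind, (∀ b, (a + Finsupp.single (k, σ, n) 1 : Boson →₀ ℕ) b ≠ 0 →
      b.1 = .phi) ↔ k = .phi ∧ ∀ b, a b ≠ 0 → b.1 = .phi := by
    intro k
    constructor
    · intro h
      exact ⟨h (k, σ, n) (by simp), fun b hb => h b (by simp [hb])⟩
    · rintro ⟨h1, h2⟩ b hb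
      by_cases hb' : (k, σ, n) = b
      · rw [← hb', h1]
      · apply h2
        simpa [Finsupp.single_apply, hb'] using hb
  cases κ <;> cases t <;> simp only [toField, letterKind, addB, addF, IsPlain, aux,
    Finset.forall_mem_insert] <;> simp

theorem derivField_plainPart (x : Letter) (f : Functional) :
    derivField (toField σ x) (plainPart f) =
      if x.2.1 then 0 else plainPart (derivField (toField σ x) f) := by
  funext a A
  rw [derivField_apply, plainPart, isPlain_add_iff]
  by_cases hx : x.2.1 = true
  · simp [hx]
  · rw [Bool.not_eq_true] at hx
    by_cases h : IsPlain a A <;> simp [hx, h, plainPart, derivField_apply]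

theorem polar_zero (l : List Letter) : polar σ l 0 = 0 := by
  obtain ⟨a, A, K, -, h, -, -⟩ := exists_polar_eq (σ := σ) l
  simp [h]

/-- Being plain depends only on the pattern of second components, which the differential preserves;
hence the projection commutes with it. -/
theorem polar_plainPart (l : List Letter) (f : Functional) :
    polar σ l (plainPart f) = if true ∈ wordPattern l then 0 else polar σ l f := by
  induction l generalizing f with
  | nil => simp [polar, plainPart, IsPlain]
  | cons x l ih =>
    rw [polar, derivField_plainPart]
    by_cases hx : x.2.1 = true
    · simp [hx, polar_zero]
    · rw [Bool.not_eq_true] at hx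
      have h1 : true ∈ wordPattern (x :: l) ↔ true ∈ wordPattern l := by simp [hx]
      rw [if_neg (by simp [hx]), ih]
      by_cases h : true ∈ wordPattern l
      · rw [if_pos h, if_pos (h1.2 h)]
      · rw [if_neg h, if_neg fun h' => h (h1.1 h'), polar]

/-- With `κ` marking upper letters and `t` marking `F`, `χ̄`, every letter contributes `κ - t`. This
identity separates the terms obeying the cyclic Leibniz rule from the exact ones. -/
theorem wordFermion_eq (l : List Letter) :
    wordFermion l = upperCount l - (wordPattern l).count true := by
  induction l with
  | nil => simp [wordFermion, upperCount]
  | cons x l ih =>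
    rw [wordFermion, ih]
    obtain ⟨_ | _, _ | _, n⟩ := x <;> simp [upperCount] <;> ring

end

/-! ### Translation invariance and damping of local functionals. -/

noncomputable section

variable {σ : Charge}

/-- Translation of a fermionic variable. -/
def fermionShift (k : ℤ) : Fermion ≃ Fermion :=
  (Equiv.refl _).prodCongr ((Equiv.refl _).prodCongr (Equiv.addRight k))

/-- Translation of a bosonic variable. -/
def bosonShift (k : ℤ) : Boson ≃ Boson :=
  (Equiv.refl _).prodCongr ((Equiv.refl _).prodCongr (Equiv.addRight k))

theorem fermionShift_apply (k : ℤ) (ψ : FermionKind) (τ : Charge) (n : ℤ) :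
    fermionShift k (ψ, τ, n) = (ψ, τ, n + k) := rfl

theorem bosonShift_apply (k : ℤ) (b : BosonKind) (τ : Charge) (n : ℤ) :
    bosonShift k (b, τ, n) = (b, τ, n + k) := rfl

/-- Translation of bosonic exponents. -/
def shiftB (k : ℤ) (a : Boson →₀ ℕ) : Boson →₀ ℕ := a.equivMapDomain (bosonShift k)

/-- Translation of fermionic factors. -/
def shiftF (k : ℤ) (A : Finset Fermion) : Finset Fermion := A.map (fermionShift k).toEmbedding

/-- Translation of a field variable. -/
def shiftField (k : ℤ) (v : Species × ℤ) : Species × ℤ := (v.1, v.2 + k)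

/-- Translation preserves the chosen order of the fermions, so it produces no reordering signs. -/
theorem rank_fermionShift (k : ℤ) (ψ : Fermion) : rank (fermionShift k ψ) = rank ψ + 4 * k := by
  obtain ⟨_ | _, _ | _, n⟩ := ψ <;> simp only [fermionShift_apply, rank] <;> ring

theorem shiftB_apply (k : ℤ) (a : Boson →₀ ℕ) (b : BosonKind) (τ : Charge) (n : ℤ) :
    shiftB k a (b, τ, n + k) = a (b, τ, n) := by
  rw [← bosonShift_apply, shiftB, Finsupp.equivMapDomain_apply, Equiv.symm_apply_apply]

theorem mem_shiftF (k : ℤ) (A : Finset Fermion) (ψ : FermionKind) (τ : Charge) (n : ℤ) :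
    (ψ, τ, n + k) ∈ shiftF k A ↔ (ψ, τ, n) ∈ A := by
  rw [← fermionShift_apply, shiftF]
  exact Finset.mem_map' _

theorem moveSign_shift (k : ℤ) (ψ : Fermion) (A : Finset Fermion) :
    moveSign (fermionShift k ψ) (shiftF k A) = moveSign ψ A := by
  unfold moveSign shiftF
  rw [Finset.filter_map, Finset.card_map]
  congr 3
  ext ξ
  simp [rank_fermionShift]

theorem shiftF_erase (k : ℤ) (ψ : Fermion) (A : Finset Fermion) :
    shiftF k (A.erase ψ) = (shiftF k A).erase (fermionShift k ψ) := by
  unfold shiftF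
  rw [Finset.map_erase]
  rfl

theorem shiftF_insert (k : ℤ) (ψ : Fermion) (A : Finset Fermion) :
    shiftF k (insert ψ A) = insert (fermionShift k ψ) (shiftF k A) := by
  unfold shiftF
  rw [Finset.map_insert]
  rfl

theorem shiftB_single (k : ℤ) (b : Boson) :
    shiftB k (Finsupp.single b 1) = Finsupp.single (bosonShift k b) 1 :=
  Finsupp.equivMapDomain_single _ _ _

theorem shiftB_add (k : ℤ) (a a' : Boson →₀ ℕ) :
    shiftB k (a + a') = shiftB k a + shiftB k a' := by
  ext b; simp [shiftB]

theorem shiftB_tsub (k : ℤ) (a a' : Boson →₀ ℕ) :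
    shiftB k (a - a') = shiftB k a - shiftB k a' := by
  ext b; simp [shiftB]

theorem remB_shift (k : ℤ) (v : Species × ℤ) (a : Boson →₀ ℕ) :
    remB (shiftField k v) (shiftB k a) = shiftB k (remB v a) := by
  obtain ⟨⟨b | ψ, τ⟩, n⟩ := v
  · simp only [remB, shiftField]
    rw [shiftB_tsub, shiftB_single, bosonShift_apply]
  · rfl

theorem remF_shift (k : ℤ) (v : Species × ℤ) (A : Finset Fermion) :
    remF (shiftField k v) (shiftF k A) = shiftF k (remF v A) := by
  obtain ⟨⟨b | ψ, τ⟩, n⟩ := v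
  · rfl
  · simp only [remF, shiftField]
    rw [shiftF_erase, fermionShift_apply]

theorem addB_shift (k : ℤ) (v : Species × ℤ) (a : Boson →₀ ℕ) :
    addB (shiftField k v) (shiftB k a) = shiftB k (addB v a) := by
  obtain ⟨⟨b | ψ, τ⟩, n⟩ := v
  · simp only [addB, shiftField]
    rw [shiftB_add, shiftB_single, bosonShift_apply]
  · rfl

theorem addF_shift (k : ℤ) (v : Species × ℤ) (A : Finset Fermion) :
    addF (shiftField k v) (shiftF k A) = shiftF k (addF v A) := by
  obtain ⟨⟨b | ψ, τ⟩, n⟩ := v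
  · rfl
  · simp only [addF, shiftField]
    rw [shiftF_insert, fermionShift_apply]

theorem mulCoef_shift (k : ℤ) (v : Species × ℤ) (a : Boson →₀ ℕ) (A : Finset Fermion) :
    mulCoef (shiftField k v) (shiftB k a) (shiftF k A) = mulCoef v a A := by
  obtain ⟨⟨b | ψ, τ⟩, n⟩ := v
  · simp only [mulCoef, shiftField, shiftB_apply]
  · simp only [mulCoef, shiftField, mem_shiftF]
    rw [← fermionShift_apply, ← shiftF_erase, moveSign_shift]

theorem derivCoef_shift (k : ℤ) (v : Species × ℤ) (a : Boson →₀ ℕ) (A : Finset Fermion) :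
    derivCoef (shiftField k v) (shiftB k a) (shiftF k A) = derivCoef v a A := by
  obtain ⟨⟨b | ψ, τ⟩, n⟩ := v
  · simp only [derivCoef, shiftField, shiftB_apply]
  · simp only [derivCoef, shiftField, mem_shiftF]
    rw [← fermionShift_apply, moveSign_shift]

theorem one_shift (k : ℤ) (a : Boson →₀ ℕ) (A : Finset Fermion) :
    one (shiftB k a) (shiftF k A) = one a A := by
  unfold one
  have h1 : shiftB k a = 0 ↔ a = 0 := by
    constructor
    · intro h
      ext ⟨b, τ, n⟩
      rw [← shiftB_apply k, h]; rfl
    · rintro rfl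
      ext b; simp [shiftB]
  have h2 : shiftF k A = ∅ ↔ A = ∅ := Finset.map_eq_empty
  simp only [h1, h2]

theorem fieldProduct_shift (k : ℤ) (l : List (Species × ℤ)) (a : Boson →₀ ℕ)
    (A : Finset Fermion) :
    fieldProduct (l.map (shiftField k)) (shiftB k a) (shiftF k A) = fieldProduct l a A := by
  induction l generalizing a A with
  | nil => exact one_shift k a A
  | cons v l ih =>
    rw [List.map_cons, fieldProduct, fieldProduct, mulField_apply, mulField_apply, mulCoef_shift,
      remB_shift, remF_shift, ih]

/-- Translation invariant functionals. -/
def TranslationInvariant (f : Functional) : Prop :=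
  ∀ k a A, f (shiftB k a) (shiftF k A) = f a A

theorem TranslationInvariant.derivField {f g : Functional} {k : ℤ}
    (hf : ∀ a A, f (shiftB k a) (shiftF k A) = g a A) (v : Species × ℤ) (a : Boson →₀ ℕ)
    (A : Finset Fermion) :
    LatticeSUSY.derivField (shiftField k v) f (shiftB k a) (shiftF k A) =
      LatticeSUSY.derivField v g a A := by
  rw [derivField_apply, derivField_apply, derivCoef_shift, addB_shift, addF_shift, hf]

theorem TranslationInvariant.polar_shiftWord {f : Functional} (hf : TranslationInvariant f)
    (k : ℤ) (l : List Letter) : polar σ (shiftWord k l) f = polar σ l f := by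
  have key : ∀ (l : List Letter) (f g : Functional),
      (∀ a A, f (shiftB k a) (shiftF k A) = g a A) →
      polar σ (shiftWord k l) f = polar σ l g := by
    intro l
    induction l with
    | nil =>
      intro f g h
      have := h 0 ∅
      simpa [polar, shiftWord, shiftB, shiftF] using this
    | cons x l ih =>
      intro f g h
      exact ih _ _ (TranslationInvariant.derivField h (toField σ x))
  exact key l f f (hf k)

theorem IsTILC.shift {I : ℕ} {C : (Fin (I + 1) → ℤ) → ℂ} (hC : IsTILC C) (k : ℤ)
    (m : Fin (I + 1) → ℤ) : C (fun i => m i + k) = C m := by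
  induction k using Int.induction_on generalizing m with
  | zero => simp
  | succ k ih =>
    refine Eq.trans ?_ ((hC.translation fun i => m i + k).trans (ih m))
    congr 1; funext i; ring
  | pred k ih =>
    refine ((hC.translation fun i => m i + (-k - 1)).symm.trans ?_).trans (ih m)
    congr 1; funext i; ring

theorem translationInvariant_siteSum {I : ℕ} (s : Fin (I + 1) → Species)
    {C : (Fin (I + 1) → ℤ) → ℂ} (hC : IsTILC C) : TranslationInvariant (siteSum s C) := by
  intro k a A
  unfold siteSum
  rw [← finsum_comp_equiv (Equiv.piCongrRight fun _ : Fin (I + 1) => Equiv.addRight k)]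
  refine finsum_congr fun m => ?_
  have h1 : C (Equiv.piCongrRight (fun _ : Fin (I + 1) => Equiv.addRight k) m) = C m :=
    hC.shift k m
  rw [h1, ← fieldProduct_shift k (List.ofFn fun i => (s i, m i)), List.map_ofFn]
  rfl

theorem IsLocal.translationInvariant {f : Functional} (hf : IsLocal f) :
    TranslationInvariant f := by
  unfold IsLocal at hf
  induction hf using Submodule.span_induction with
  | mem g hg =>
    obtain ⟨I, s, C, hC, rfl⟩ := hg
    exact translationInvariant_siteSum s hC
  | zero => intro k a A; rfl
  | add f g _ _ h1 h2 =>
    intro k a A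
    rw [Pi.add_apply, Pi.add_apply, Pi.add_apply, Pi.add_apply, h1, h2]
  | smul w f _ h =>
    intro k a A
    rw [Pi.smul_apply, Pi.smul_apply, Pi.smul_apply, Pi.smul_apply, h]

theorem mult_rem_le (v w : Species × ℤ) (a : Boson →₀ ℕ) (A : Finset Fermion) :
    mult w (remB v a) (remF v A) ≤ mult w a A := by
  obtain ⟨⟨b | ψ, τ⟩, n⟩ := v <;> obtain ⟨⟨b' | ψ', τ'⟩, n'⟩ := w
  · exact tsub_le_self
  · exact le_rfl
  · exact le_rfl
  · simp only [mult, remF, Finset.mem_erase]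
    split_ifs <;> simp_all

theorem mult_rem_of_ne {v w : Species × ℤ} (h : w ≠ v) (a : Boson →₀ ℕ) (A : Finset Fermion) :
    mult w (remB v a) (remF v A) = mult w a A := by
  obtain ⟨⟨b | ψ, τ⟩, n⟩ := v <;> obtain ⟨⟨b' | ψ', τ'⟩, n'⟩ := w
  · have : ¬ ((b, τ, n) : Boson) = (b', τ', n') := by
      intro h'; apply h; simp only [Prod.mk.injEq] at h'; obtain ⟨rfl, rfl, rfl⟩ := h'; rfl
    simp only [mult, remB, Finsupp.tsub_apply]
    rw [Finsupp.single_apply, if_neg this, tsub_zero]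
  · rfl
  · rfl
  · have : ¬ ((ψ', τ', n') : Fermion) = (ψ, τ, n) := by
      intro h'; apply h; simp only [Prod.mk.injEq] at h'; obtain ⟨rfl, rfl, rfl⟩ := h'; rfl
    have h2 : (ψ', τ', n') ∈ A.erase (ψ, τ, n) ↔ (ψ', τ', n') ∈ A := by
      rw [Finset.mem_erase]; exact and_iff_right this
    simp only [mult, remF, h2]

theorem mem_iff_of_fieldProduct_ne_zero {l : List (Species × ℤ)} {a : Boson →₀ ℕ}
    {A : Finset Fermion} (h : fieldProduct l a A ≠ 0) (w : Species × ℤ) :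
    w ∈ l ↔ mult w a A ≠ 0 := by
  induction l generalizing a A with
  | nil =>
    have h1 : a = 0 ∧ A = ∅ := by
      by_contra h3
      simp [fieldProduct, one, h3] at h
    obtain ⟨rfl, rfl⟩ := h1
    obtain ⟨⟨b | ψ, τ⟩, n⟩ := w <;> simp [mult]
  | cons v l ih =>
    rw [fieldProduct, mulField_apply] at h
    have h1 := ih (right_ne_zero_of_mul h)
    have h2 : mult v a A ≠ 0 := fun h3 => left_ne_zero_of_mul h ((mulCoef_eq_zero_iff _ _ _).2 h3)
    rw [List.mem_cons, h1]
    constructor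
    · rintro (rfl | h3)
      · exact h2
      · have := mult_rem_le v w a A
        omega
    · intro h3
      by_cases hw : w = v
      · exact Or.inl hw
      · right
        rwa [mult_rem_of_ne hw]

theorem norm_fieldProduct_le (l : List (Species × ℤ)) (a : Boson →₀ ℕ) (A : Finset Fermion) :
    ‖fieldProduct l a A‖ ≤ 1 := by
  induction l generalizing a A with
  | nil => exact norm_one_le a A
  | cons v l ih =>
    rw [fieldProduct, mulField_apply, norm_mul]
    exact mul_le_one₀ (norm_mulCoef_le _ _ _) (norm_nonneg _) (ih _ _)

theorem exists_mult_of_mem_sites {a : Boson →₀ ℕ} {A : Finset Fermion} {n : ℤ}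
    (h : n ∈ sites a A) : ∃ v : Species × ℤ, mult v a A ≠ 0 ∧ v.2 = n := by
  simp only [sites, Finset.mem_union, Finset.mem_image] at h
  obtain ⟨⟨b, τ, m⟩, h1, rfl⟩ | ⟨⟨ψ, τ, m⟩, h1, rfl⟩ := h
  · exact ⟨((.inl b, τ), m), by simpa [mult] using h1, rfl⟩
  · exact ⟨((.inr ψ, τ), m), by simpa [mult] using h1, rfl⟩

theorem card_sites_le_of_fieldProduct_ne_zero {l : List (Species × ℤ)} {a : Boson →₀ ℕ}
    {A : Finset Fermion} (h : fieldProduct l a A ≠ 0) : (sites a A).card ≤ l.length := by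
  have h1 : sites a A ⊆ (l.map Prod.snd).toFinset := by
    intro n hn
    obtain ⟨v, hv, rfl⟩ := exists_mult_of_mem_sites hn
    rw [List.mem_toFinset]
    exact List.mem_map_of_mem ((mem_iff_of_fieldProduct_ne_zero h v).2 hv)
  refine (Finset.card_le_card h1).trans ((List.toFinset_card_le _).trans ?_)
  simp

theorem siteSum_eq_sum {n : ℕ} (s : Fin n → Species) (C : (Fin n → ℤ) → ℂ) {a : Boson →₀ ℕ}
    {A : Finset Fermion} {T : Finset ℤ} (hT : sites a A ⊆ T) :
    siteSum s C a A = ∑ m ∈ Fintype.piFinset fun _ : Fin n => T,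
      C m * fieldProduct (List.ofFn fun i => (s i, m i)) a A := by
  unfold siteSum
  apply finsum_eq_sum_of_support_subset
  intro m hm
  have h1 := right_ne_zero_of_mul (Function.mem_support.1 hm)
  rw [Finset.mem_coe, Fintype.mem_piFinset]
  intro i
  apply hT
  have h2 := mem_iff_of_fieldProduct_ne_zero h1 (s i, m i)
  exact mem_sites_of_mult_ne_zero (h2.1 (by rw [List.mem_ofFn]; exact ⟨i, rfl⟩))

theorem siteSum_cons {n : ℕ} (s₀ : Species) (s : Fin n → Species) (C : (Fin (n + 1) → ℤ) → ℂ)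
    {a : Boson →₀ ℕ} {A : Finset Fermion} {T : Finset ℤ} (hT : sites a A ⊆ T) :
    siteSum (Fin.cons s₀ s : Fin (n + 1) → Species) C a A =
      ∑ k ∈ T, mulField (s₀, k) (siteSum s fun m => C (Fin.cons k m)) a A := by
  rw [siteSum_eq_sum _ C hT]
  simp only [mulField_apply]
  have h1 : ∀ k, siteSum s (fun m => C (Fin.cons k m)) (remB (s₀, k) a) (remF (s₀, k) A) =
      _ := fun k => siteSum_eq_sum s _ ((sites_rem_subset (s₀, k) a A).trans hT)
  simp only [h1, Finset.mul_sum]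
  rw [← Finset.sum_product']
  symm
  refine Finset.sum_bij' (fun (p : ℤ × (Fin n → ℤ)) _ => (Fin.cons p.1 p.2 : Fin (n + 1) → ℤ))
    (fun m _ => (m 0, Fin.tail m)) ?_ ?_ ?_ ?_ ?_
  · rintro ⟨k, m⟩ h
    simp only [Finset.mem_product, Fintype.mem_piFinset] at h ⊢
    intro i
    refine Fin.cases ?_ (fun j => ?_) i
    · exact h.1
    · exact h.2 j
  · intro m h
    simp only [Finset.mem_product, Fintype.mem_piFinset] at h ⊢
    exact ⟨h 0, fun i => h i.succ⟩
  · rintro ⟨k, m⟩ _; simp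
  · intro m _; simp
  · rintro ⟨k, m⟩ _
    rw [List.ofFn_succ, fieldProduct, mulField_apply]
    simp only [Fin.cons_zero, Fin.cons_succ]
    ring

theorem siteSum_fin_zero (s : Fin 0 → Species) (C : (Fin 0 → ℤ) → ℂ) (a : Boson →₀ ℕ)
    (A : Finset Fermion) : siteSum s C a A = C Fin.elim0 * one a A := by
  unfold siteSum
  rw [finsum_unique]
  simp only [List.ofFn_zero, fieldProduct]
  congr 2

/-- Functionals whose coefficients are exponentially damped in the distance of any two fields. -/
def SiteDamped (M L : ℝ) (f : Functional) : Prop :=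
  ∀ a A v w, mult v a A ≠ 0 → mult w a A ≠ 0 →
    ‖f a A‖ ≤ L * Real.exp (-M * |((v.2 - w.2 : ℤ) : ℝ)|)

theorem SiteDamped.mono {M L M' L' : ℝ} {f : Functional} (hf : SiteDamped M L f) (hL : 0 ≤ L)
    (hM : M' ≤ M) (hL' : L ≤ L') : SiteDamped M' L' f := by
  intro a A v w hv hw
  refine (hf a A v w hv hw).trans (mul_le_mul hL' (Real.exp_le_exp.2 ?_) (Real.exp_pos _).le
    (hL.trans hL'))
  nlinarith [abs_nonneg ((v.2 - w.2 : ℤ) : ℝ)]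

/-- Where no damping estimate applies, all site differences are bounded; translating `m 0` to the
origin leaves the finite box `K`. -/
theorem IsTILC.exists_bound {I : ℕ} {C : (Fin (I + 1) → ℤ) → ℂ} (hC : IsTILC C) :
    ∃ B : ℝ, 0 ≤ B ∧ ∀ m, ‖C m‖ ≤ B := by
  choose M hM L hL r hr using hC.locality
  let K : Finset (Fin (I + 1) → ℤ) := Fintype.piFinset fun i : Fin (I + 1) =>
    Fin.cases {0} (fun l => Finset.Icc (-|r l|) (|r l|)) i
  refine ⟨∑ l, L l + ∑ m ∈ K, ‖C m‖, add_nonneg (Finset.sum_nonneg fun l _ => (hL l).le)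
    (Finset.sum_nonneg fun m _ => norm_nonneg _), fun m => ?_⟩
  by_cases h : ∃ l, r l ≤ |m 0 - m l.succ|
  · obtain ⟨l, hl⟩ := h
    have h1 : ‖C m‖ ≤ L l := by
      refine (hr l m hl).le.trans (mul_le_of_le_one_right (hL l).le ?_)
      rw [Real.exp_le_one_iff]
      nlinarith [hM l, abs_nonneg ((m 0 - m l.succ : ℤ) : ℝ)]
    have h2 := Finset.single_le_sum (f := L) (fun l _ => (hL l).le) (Finset.mem_univ l)
    have h3 : 0 ≤ ∑ m ∈ K, ‖C m‖ := Finset.sum_nonneg fun m _ => norm_nonneg _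
    linarith
  · push Not at h
    have h1 := hC.shift (-m 0) m
    rw [← h1]
    have h2 : (fun i => m i + -m 0) ∈ K := by
      simp only [K, Fintype.mem_piFinset]
      intro i
      refine Fin.cases ?_ (fun l => ?_) i
      · simp
      · have h3 := h l
        have h4 := le_abs_self (r l)
        simp only [Fin.cases_succ, Finset.mem_Icc]
        rw [abs_lt] at h3
        constructor <;> linarith
    have h3 := Finset.single_le_sum (f := fun m => ‖C m‖) (fun m _ => norm_nonneg _) h2
    have h4 : 0 ≤ ∑ l, L l := Finset.sum_nonneg fun l _ => (hL l).le
    linarith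

/-- Of two sites at distance `r`, at least one has distance `r / 2` or more from `m 0`; therefore
half of the smallest rate works for every pair. -/
theorem IsTILC.exists_pair_bound {I : ℕ} {C : (Fin (I + 1) → ℤ) → ℂ} (hC : IsTILC C) :
    ∃ M > (0 : ℝ), ∃ L ≥ (0 : ℝ), ∀ (m : Fin (I + 1) → ℤ) (i j : Fin (I + 1)),
      ‖C m‖ ≤ L * Real.exp (-M * |((m i - m j : ℤ) : ℝ)|) := by
  obtain ⟨B, hB, hb⟩ := hC.exists_bound
  have h1 : ∀ l : Fin (I + 1), ∃ M > (0 : ℝ), ∃ L ≥ (0 : ℝ), ∀ m,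
      ‖C m‖ ≤ L * Real.exp (-M * |((m 0 - m l : ℤ) : ℝ)|) := by
    intro l
    refine Fin.cases ?_ (fun l => ?_) l
    · exact ⟨1, one_pos, B, hB, fun m => by simpa using hb m⟩
    · obtain ⟨M, hM, L, hL, r, hr⟩ := hC.locality l
      refine ⟨M, hM, L + B * Real.exp (M * |(r : ℝ)|), by positivity, fun m => ?_⟩
      have hp := Real.exp_pos (-M * |((m 0 - m l.succ : ℤ) : ℝ)|)
      by_cases h : r ≤ |m 0 - m l.succ|
      · refine (hr m h).le.trans (mul_le_mul_of_nonneg_right ?_ hp.le)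
        have : 0 ≤ B * Real.exp (M * |(r : ℝ)|) := by positivity
        linarith
      · refine (hb m).trans ?_
        rw [add_mul, mul_assoc B, ← Real.exp_add]
        have h2 : |((m 0 - m l.succ : ℤ) : ℝ)| ≤ |(r : ℝ)| := by
          rw [not_le] at h
          have h3 : ((|m 0 - m l.succ| : ℤ) : ℝ) < r := by exact_mod_cast h
          rw [Int.cast_abs] at h3
          exact h3.le.trans (le_abs_self _)
        have h4 : 1 ≤ Real.exp (M * |(r : ℝ)| + -M * |((m 0 - m l.succ : ℤ) : ℝ)|) := by
          rw [Real.one_le_exp_iff]; nlinarith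
        have h5 := mul_le_mul_of_nonneg_left h4 hB
        have h6 := mul_pos hL hp
        linarith
  choose M hM L hL h using h1
  obtain ⟨i₀, -, hi₀⟩ := Finset.exists_min_image Finset.univ M ⟨0, Finset.mem_univ _⟩
  have hS : 0 ≤ ∑ l, L l := Finset.sum_nonneg fun l _ => hL l
  have h' : ∀ l m, ‖C m‖ ≤ (∑ l, L l) * Real.exp (-(M i₀) * |((m 0 - m l : ℤ) : ℝ)|) := by
    intro l m
    refine (h l m).trans (mul_le_mul ?_ (Real.exp_le_exp.2 ?_) (Real.exp_pos _).le hS)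
    · exact Finset.single_le_sum (f := L) (fun l _ => hL l) (Finset.mem_univ l)
    · have := hi₀ l (Finset.mem_univ l)
      nlinarith [abs_nonneg ((m 0 - m l : ℤ) : ℝ)]
  refine ⟨M i₀ / 2, by have := hM i₀; positivity, ∑ l, L l, hS, fun m i j => ?_⟩
  have h2 : |((m i - m j : ℤ) : ℝ)| ≤ |((m 0 - m i : ℤ) : ℝ)| + |((m 0 - m j : ℤ) : ℝ)| := by
    have := abs_sub ((m 0 - m j : ℤ) : ℝ) ((m 0 - m i : ℤ) : ℝ)
    push_cast at this ⊢
    have e : (m i : ℝ) - m j = (m 0 - m j) - (m 0 - m i) := by ring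
    rw [e]
    linarith
  have hMi := hM i₀
  obtain h3 | h3 := le_total |((m 0 - m i : ℤ) : ℝ)| |((m 0 - m j : ℤ) : ℝ)|
  · refine (h' j m).trans (mul_le_mul_of_nonneg_left (Real.exp_le_exp.2 ?_) hS)
    nlinarith
  · refine (h' i m).trans (mul_le_mul_of_nonneg_left (Real.exp_le_exp.2 ?_) hS)
    nlinarith

theorem IsTILC.exists_siteDamped {I : ℕ} (s : Fin (I + 1) → Species)
    {C : (Fin (I + 1) → ℤ) → ℂ} (hC : IsTILC C) :
    ∃ M > (0 : ℝ), ∃ L ≥ (0 : ℝ), SiteDamped M L (siteSum s C) := by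
  obtain ⟨M, hM, L, hL, h⟩ := hC.exists_pair_bound
  -- A monomial reached by the sum has at most `I + 1` sites, so at most `(I + 1) ^ (I + 1)` index
  -- tuples contribute to it.
  refine ⟨M, hM, ((I + 1 : ℕ) ^ (I + 1) : ℕ) * L, by positivity, fun a A v w hv hw => ?_⟩
  have h1 : ∀ m : Fin (I + 1) → ℤ, ‖C m * fieldProduct (List.ofFn fun i => (s i, m i)) a A‖ ≤
      L * Real.exp (-M * |((v.2 - w.2 : ℤ) : ℝ)|) := by
    intro m
    by_cases h0 : fieldProduct (List.ofFn fun i => (s i, m i)) a A = 0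
    · rw [h0, mul_zero, norm_zero]; positivity
    · rw [norm_mul]
      have h2 := (mem_iff_of_fieldProduct_ne_zero h0 v).2 hv
      have h3 := (mem_iff_of_fieldProduct_ne_zero h0 w).2 hw
      rw [List.mem_ofFn] at h2 h3
      obtain ⟨i, rfl⟩ := h2
      obtain ⟨j, rfl⟩ := h3
      refine (mul_le_of_le_one_right (norm_nonneg _) (norm_fieldProduct_le _ _ _)).trans (h m i j)
  by_cases hcard : (sites a A).card ≤ I + 1
  · rw [siteSum_eq_sum s C (Finset.Subset.refl _)]
    refine (norm_sum_le _ _).trans ((Finset.sum_le_card_nsmul _ _ _ fun m _ => h1 m).trans ?_)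
    rw [nsmul_eq_mul, Fintype.card_piFinset_const, mul_assoc]
    refine mul_le_mul_of_nonneg_right ?_ (by positivity)
    exact Nat.cast_le.2 (Nat.pow_le_pow_left hcard (I + 1))
  · have h0 : siteSum s C a A = 0 := by
      rw [siteSum_eq_sum s C (Finset.Subset.refl _)]
      refine Finset.sum_eq_zero fun m _ => ?_
      by_contra h2
      apply hcard
      have := card_sites_le_of_fieldProduct_ne_zero (right_ne_zero_of_mul h2)
      simpa using this
    rw [h0, norm_zero]
    positivity

theorem IsLocal.exists_siteDamped {f : Functional} (hf : IsLocal f) :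
    ∃ M > (0 : ℝ), ∃ L ≥ (0 : ℝ), SiteDamped M L f := by
  unfold IsLocal at hf
  induction hf using Submodule.span_induction with
  | mem g hg =>
    obtain ⟨I, s, C, hC, rfl⟩ := hg
    exact hC.exists_siteDamped s
  | zero => exact ⟨1, one_pos, 0, le_rfl, fun a A v w _ _ => by simp⟩
  | add f g _ _ h1 h2 =>
    obtain ⟨M₁, hM₁, L₁, hL₁, h1⟩ := h1
    obtain ⟨M₂, hM₂, L₂, hL₂, h2⟩ := h2
    refine ⟨min M₁ M₂, lt_min hM₁ hM₂, L₁ + L₂, add_nonneg hL₁ hL₂, fun a A v w hv hw => ?_⟩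
    rw [Pi.add_apply, Pi.add_apply, add_mul]
    exact (norm_add_le _ _).trans (add_le_add
      (h1.mono hL₁ (min_le_left _ _) le_rfl a A v w hv hw)
      (h2.mono hL₂ (min_le_right _ _) le_rfl a A v w hv hw))
  | smul z f _ h =>
    obtain ⟨M, hM, L, hL, h⟩ := h
    refine ⟨M, hM, ‖z‖ * L, by positivity, fun a A v w hv hw => ?_⟩
    rw [Pi.smul_apply, Pi.smul_apply, norm_smul, mul_assoc]
    exact mul_le_mul_of_nonneg_left (h a A v w hv hw) (norm_nonneg _)

theorem SiteDamped.norm_polar_le {M L : ℝ} {f : Functional} (hf : SiteDamped M L f) (hL : 0 ≤ L)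
    {l : List Letter} {x y : Letter} (hx : x ∈ l) (hy : y ∈ l) :
    ‖polar σ l f‖ ≤ (l.length + 1).factorial * L *
      Real.exp (-M * |((x.2.2 - y.2.2 : ℤ) : ℝ)|) := by
  obtain ⟨a, A, K, hK, h, -, h2⟩ := exists_polar_eq (σ := σ) l
  rw [h]
  have hN : (0 : ℝ) ≤ ((l.length + 1).factorial : ℝ) := Nat.cast_nonneg _
  generalize ((l.length + 1).factorial : ℝ) = N at hK hN ⊢
  by_cases h0 : K = 0
  · rw [h0, zero_mul, norm_zero]; positivity
  · have h3 : ‖f a A‖ ≤ L * Real.exp (-M * |((x.2.2 - y.2.2 : ℤ) : ℝ)|) :=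
      hf a A (toField σ x) (toField σ y) (h2 x hx h0) (h2 y hy h0)
    rw [norm_mul, mul_assoc]
    exact mul_le_mul hK h3 (norm_nonneg _) hN

end

/-! ### Locality of word sums, and extraction of the cyclic Leibniz coefficients. -/

noncomputable section

variable {D : ℤ → ℤ → ℂ} {M L : ℝ} {γ : Bool → ℂ} {σ : Charge}

/-- Grouping words by species leaves finitely many sums over sites, the form demanded by locality.
-/
theorem wordSum_eq_sum_siteSum (n : ℕ) (c : List Letter → ℂ) (a : Boson →₀ ℕ)
    (A : Finset Fermion) :
    wordSum σ n c a A = ∑ p : Fin n → Bool × Bool,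
      siteSum (fun i => (letterKind (p i).1 (p i).2, σ))
        (fun m => c (List.ofFn fun i => ((p i).1, (p i).2, m i))) a A := by
  induction n generalizing c a A with
  | zero => simp [siteSum_fin_zero, wordSum]
  | succ n ih =>
    rw [wordSum_succ n c (Finset.Subset.refl _),
      ← (Fin.consEquiv fun _ : Fin (n + 1) => Bool × Bool).sum_comp, Fintype.sum_prod_type]
    have h1 : ∀ (q : Bool × Bool) (p : Fin n → Bool × Bool),
        siteSum (fun i => (letterKind (Fin.consEquiv (fun _ : Fin (n + 1) => Bool × Bool) (q, p) i).1
            (Fin.consEquiv (fun _ : Fin (n + 1) => Bool × Bool) (q, p) i).2, σ))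
          (fun m => c (List.ofFn fun i =>
            ((Fin.consEquiv (fun _ : Fin (n + 1) => Bool × Bool) (q, p) i).1,
              (Fin.consEquiv (fun _ : Fin (n + 1) => Bool × Bool) (q, p) i).2, m i))) a A =
        ∑ k ∈ sites a A, mulField ((letterKind q.1 q.2, σ), k)
          (siteSum (fun i => (letterKind (p i).1 (p i).2, σ)) fun m =>
            c ((q.1, q.2, k) :: List.ofFn fun i => ((p i).1, (p i).2, m i))) a A := by
      intro q p
      have e : (fun i => (letterKind (Fin.consEquiv (fun _ : Fin (n + 1) => Bool × Bool) (q, p) i).1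
            (Fin.consEquiv (fun _ : Fin (n + 1) => Bool × Bool) (q, p) i).2, σ)) =
          (Fin.cons (letterKind q.1 q.2, σ) (fun i => (letterKind (p i).1 (p i).2, σ)) :
            Fin (n + 1) → Species) := by
        funext i
        refine Fin.cases ?_ (fun j => ?_) i <;> simp [Fin.consEquiv]
      rw [e, siteSum_cons _ _ _ (Finset.Subset.refl _)]
      simp [Fin.consEquiv, List.ofFn_succ]
    simp only [h1]
    have h2 : ∀ x : Letter, mulField (toField σ x) (wordSum σ n fun l => c (x :: l)) a A =
        ∑ p : Fin n → Bool × Bool, mulField (toField σ x)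
          (siteSum (fun i => (letterKind (p i).1 (p i).2, σ)) fun m =>
            c (x :: List.ofFn fun i => ((p i).1, (p i).2, m i))) a A := by
      intro x
      simp only [mulField_apply]
      rw [ih fun l => c (x :: l), Finset.mul_sum]
    simp only [h2]
    rw [Finset.sum_comm, Finset.sum_comm (s := (Finset.univ : Finset (Bool × Bool)))]
    refine Finset.sum_congr rfl fun p _ => ?_
    unfold letters
    rw [Finset.sum_product, Fintype.sum_prod_type]
    refine Finset.sum_congr rfl fun κ _ => ?_
    rw [Finset.sum_product]
    rfl

/-- Coefficients obtained from a translation invariant, damped coefficient function of words by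
fixing the species are TILCs. -/
theorem isTILC_of_word {I : ℕ} (p : Fin (I + 1) → Bool × Bool) {c : List Letter → ℂ}
    (hshift : ∀ k l, c (shiftWord k l) = c l) (hM : 0 < M) (hL : 0 ≤ L)
    (hb : ∀ x l, l.length = I → ∀ y ∈ l, ‖c (x :: l)‖ ≤
      L * Real.exp (-M * |((x.2.2 - y.2.2 : ℤ) : ℝ)|)) :
    IsTILC fun m => c (List.ofFn fun i => ((p i).1, (p i).2, m i)) where
  translation m := by
    rw [← hshift 1 (List.ofFn fun i => ((p i).1, (p i).2, m i)), shiftWord, List.map_ofFn]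
    rfl
  locality l := by
    -- The definition asks for a strict inequality and a positive constant, hence `L + 1`; the bound
    -- holds at all distances, hence `0`.
    refine ⟨M, hM, L + 1, by positivity, 0, fun m _ => ?_⟩
    rw [List.ofFn_succ]
    refine (hb _ _ (List.length_ofFn) ((p l.succ).1, (p l.succ).2, m l.succ) ?_).trans_lt ?_
    · rw [List.mem_ofFn]
      exact ⟨l, rfl⟩
    · exact mul_lt_mul_of_pos_right (by linarith) (Real.exp_pos _)

theorem isLocal_wordSum (n : ℕ) {c : List Letter → ℂ}
    (hshift : ∀ k l, c (shiftWord k l) = c l) (hM : 0 < M) (hL : 0 ≤ L)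
    (hb : ∀ x l, l.length = n → ∀ y ∈ l, ‖c (x :: l)‖ ≤
      L * Real.exp (-M * |((x.2.2 - y.2.2 : ℤ) : ℝ)|)) : IsLocal (wordSum σ (n + 1) c) := by
  have h : wordSum σ (n + 1) c = ∑ p : Fin (n + 1) → Bool × Bool,
      siteSum (fun i => (letterKind (p i).1 (p i).2, σ))
        (fun m => c (List.ofFn fun i => ((p i).1, (p i).2, m i))) := by
    funext a A
    rw [wordSum_eq_sum_siteSum, Finset.sum_apply, Finset.sum_apply]
  rw [h]
  exact Submodule.sum_mem _ fun p _ => Submodule.subset_span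
    ⟨n, _, _, isTILC_of_word p hshift hM hL hb, rfl⟩

theorem abs_le_wordWeight {l : List Letter} {y : Letter} (hy : y ∈ l) :
    |(y.2.2 : ℝ)| ≤ wordWeight l := by
  induction l with
  | nil => simp at hy
  | cons x l ih =>
    have h1 := wordWeight_nonneg l
    have h2 := abs_nonneg (x.2.2 : ℝ)
    rw [wordWeight]
    obtain rfl | h := List.mem_cons.1 hy
    · linarith
    · linarith [ih h]

theorem wordWeight_le_of_forall {l : List Letter} {r : ℝ}
    (h : ∀ y ∈ l, |(y.2.2 : ℝ)| ≤ r) : wordWeight l ≤ l.length * r := by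
  induction l with
  | nil => simp [wordWeight]
  | cons x l ih =>
    rw [wordWeight, List.length_cons]
    have h1 := h x List.mem_cons_self
    have h2 := ih fun y hy => h y (List.mem_cons_of_mem _ hy)
    push_cast
    linarith

theorem exists_wordWeight_le (l : List Letter) :
    wordWeight l = 0 ∨ ∃ y ∈ l, wordWeight l ≤ l.length * |(y.2.2 : ℝ)| := by
  by_cases hl : l = []
  · left; simp [hl, wordWeight]
  · right
    obtain ⟨y, hy, h⟩ := l.toFinset.exists_max_image (fun y => |(y.2.2 : ℝ)|)
      (by simpa using hl)
    exact ⟨y, by simpa using hy, wordWeight_le_of_forall fun z hz => h z (by simpa using hz)⟩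

theorem cons_eq_cons_zero {c : List Letter → ℂ} (hshift : ∀ k l, c (shiftWord k l) = c l)
    (x : Letter) (l : List Letter) :
    c (x :: l) = c ((x.1, x.2.1, 0) :: shiftWord (-x.2.2) l) := by
  rw [← hshift (-x.2.2)]
  simp [shiftWord]

/-- Damping relative to a first letter at the origin bounds translation invariant coefficient
functions by the distances to the first letter. -/
theorem norm_cons_le_of_damped {c : List Letter → ℂ} (hshift : ∀ k l, c (shiftWord k l) = c l)
    (hM : 0 < M) (hdec : ∀ κ t, Damped M L fun l => c ((κ, t, 0) :: l)) (x : Letter)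
    (l : List Letter) (y : Letter) (hy : y ∈ l) :
    ‖c (x :: l)‖ ≤ L * Real.exp (-M * |((x.2.2 - y.2.2 : ℤ) : ℝ)|) := by
  rw [cons_eq_cons_zero hshift]
  refine (hdec x.1 x.2.1 _).trans (mul_le_mul_of_nonneg_left (Real.exp_le_exp.2 ?_)
    (hdec true true).nonneg)
  have h1 : (y.1, y.2.1, y.2.2 + -x.2.2) ∈ shiftWord (-x.2.2) l :=
    List.mem_map_of_mem (f := fun z : Letter => (z.1, z.2.1, z.2.2 + -x.2.2)) hy
  have h2 := abs_le_wordWeight h1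
  have h3 : |((x.2.2 - y.2.2 : ℤ) : ℝ)| = |((y.2.2 + -x.2.2 : ℤ) : ℝ)| := by
    rw [← abs_neg]; push_cast; ring_nf
  rw [h3]
  dsimp only at h2
  nlinarith

/-- The sign condition is imposed on distinct letters only, so a word with a single fermion meets
it: exchanging that fermion with itself does nothing. -/
theorem polar_perm {l l' : List Letter} (h : l.Perm l')
    (hs : ∀ x ∈ l, ∀ y ∈ l, x ≠ y → fsign (toField σ x) (toField σ y) = 1) (f : Functional) :
    polar σ l f = polar σ l' f := by
  induction h generalizing f with
  | nil => rfl
  | cons x _ ih =>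
    exact ih (fun y hy z hz => hs y (List.mem_cons_of_mem _ hy) z (List.mem_cons_of_mem _ hz)) _
  | swap x y l =>
    simp only [polar]
    congr 1
    funext a A
    by_cases hxy : x = y
    · rw [hxy]
    · rw [derivField_comm, hs x (by simp) y (by simp) hxy, one_mul]
  | trans h₁ h₂ ih₁ ih₂ =>
    rw [ih₁ hs, ih₂ fun x hx y hy => hs x (h₁.mem_iff.2 hx) y (h₁.mem_iff.2 hy)]

theorem fsign_phi_left (n : ℤ) (v : Species × ℤ) :
    fsign (toField σ (false, false, n)) v = 1 := by
  simp [fsign, toField, letterKind]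

theorem fsign_phi_right (n : ℤ) (v : Species × ℤ) :
    fsign v (toField σ (false, false, n)) = 1 := by
  simp [fsign, toField, letterKind]

/-- The word `χ_m φ_{n₁} ⋯ φ_{n_k}`. -/
abbrev chiPhiWord {k : ℕ} (m : ℤ) (n : Fin k → ℤ) : List Letter :=
  (true, false, m) :: List.ofFn fun j => (false, false, n j)

theorem fsign_of_mem_chiPhiWord {k : ℕ} {m : ℤ} {n : Fin k → ℤ} (x : Letter)
    (hx : x ∈ chiPhiWord m n) (y : Letter) (hy : y ∈ chiPhiWord m n) (hxy : x ≠ y) :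
    fsign (toField σ x) (toField σ y) = 1 := by
  rw [List.mem_cons, List.mem_ofFn] at hx hy
  obtain rfl | ⟨i, rfl⟩ := hx
  · obtain rfl | ⟨j, rfl⟩ := hy
    · exact absurd rfl hxy
    · exact fsign_phi_right _ _
  · exact fsign_phi_left _ _

theorem wordDiff_phi (k : ℕ) (n : Fin k → ℤ) (c : List Letter → ℂ) :
    wordDiff D γ (List.ofFn fun i => (false, false, n i)) c =
      ∑ i, γ false * ∑' m, D m (n i) *
        c (List.ofFn (Function.update (fun j => ((false, false, n j) : Letter)) i
          (true, false, m))) := by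
  induction k generalizing c with
  | zero => simp [wordDiff]
  | succ k ih =>
    rw [List.ofFn_succ, wordDiff, Fin.sum_univ_succ, ih (fun i => n i.succ)]
    simp only [Bool.false_eq_true, if_false, letterSign, if_true, one_mul]
    congr 1
    · simp [List.ofFn_succ]
    · refine Finset.sum_congr rfl fun i _ => ?_
      congr 2
      funext m
      rw [List.ofFn_succ (f := Function.update _ i.succ _)]
      congr 3
      congr 1
      funext j
      simp only [Function.update_apply, Fin.succ_inj]

/-- Rotating the indices by `p` brings the slot holding `χ` to the front; this matches one term of
the differential with one cyclic permutation. -/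
theorem perm_update_chiPhiWord {k : ℕ} (n : Fin (k + 1) → ℤ) (p : Fin (k + 1)) (m : ℤ) :
    (chiPhiWord m fun j : Fin k => n (p + j.succ)).Perm
      (List.ofFn (Function.update (fun j => ((false, false, n j) : Letter)) p
        (true, false, m))) := by
  have h1 : chiPhiWord m (fun j : Fin k => n (p + j.succ)) = List.ofFn
      ((Function.update (fun j => ((false, false, n j) : Letter)) p (true, false, m)) ∘
        Equiv.addLeft p) := by
    rw [List.ofFn_succ]
    simp
  rw [h1]
  exact Equiv.Perm.ofFn_comp_perm _ _

theorem wordDiff_polar_plainPart {f : Functional} (hcl : susyOp D γ σ f = 0) (l : List Letter) :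
    wordDiff D γ l (fun l' => polar σ l' (plainPart f)) = 0 := by
  have h := wordDiff_mul_pattern (D := D) (γ := γ) (fun p => if true ∈ p then 0 else 1) l
    fun l' => polar σ l' f
  rw [← polar_susyOp, hcl, polar_zero, mul_zero] at h
  rw [← h]
  congr 1
  funext l'
  rw [polar_plainPart]
  split <;> simp

theorem siteSum_phi (k : ℕ) {c : List Letter → ℂ}
    (hc : ∀ l, (∃ x ∈ l, x.1 = true ∨ x.2.1 = true) → c l = 0) (a : Boson →₀ ℕ)
    (A : Finset Fermion) :
    siteSum (fun _ : Fin k => ((.inl .phi, σ) : Species))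
      (fun n => c (List.ofFn fun j => (false, false, n j))) a A = wordSum σ k c a A := by
  rw [wordSum_eq_sum_siteSum, Finset.sum_eq_single fun _ => (false, false)]
  · rfl
  · intro p _ hp
    have h1 : ∃ i, (p i).1 = true ∨ (p i).2 = true := by
      by_contra! hcon
      apply hp
      funext i
      have := hcon i
      exact Prod.ext (by simpa using this.1) (by simpa using this.2)
    obtain ⟨i, hi⟩ := h1
    have h2 : (fun m : Fin k → ℤ => c (List.ofFn fun i => ((p i).1, (p i).2, m i))) =
        fun _ => 0 := by
      funext m
      apply hc
      exact ⟨_, (List.mem_ofFn).2 ⟨i, rfl⟩, hi⟩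
    rw [h2]
    simp [siteSum]
  · simp

theorem HasFermionNumber.plainPart {q : ℤ} {f : Functional} (hf : HasFermionNumber q f) :
    HasFermionNumber q (plainPart f) := by
  intro a A h
  apply hf a A
  unfold LatticeSUSY.plainPart at h
  split at h
  · exact h
  · exact absurd rfl h

theorem sum_mult_chi {a : Boson →₀ ℕ} {A : Finset Fermion} (hA : IsPlain a A)
    (ho : fieldCount σ.other a A = 0) (hN : fermionNumber A = 1) :
    ∑ m ∈ sites a A, mult (toField σ (true, false, m)) a A = 1 := by
  have h1 : A.card = 1 := by
    have e1 : A.filter (fun ψ => ψ.1 = FermionKind.chi) = A :=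
      Finset.filter_true_of_mem hA.2
    have e2 : A.filter (fun ψ => ψ.1 = FermionKind.chiBar) = ∅ :=
      Finset.filter_false_of_mem fun ψ hψ h => by
        rw [hA.2 ψ hψ] at h
        simp at h
    rw [fermionNumber, e1, e2] at hN
    simpa using hN
  obtain ⟨⟨κ, τ, n⟩, rfl⟩ := Finset.card_eq_one.1 h1
  have hκ : κ = .chi := hA.2 _ (Finset.mem_singleton_self _)
  have hτ : τ = σ := by
    by_contra h
    have : τ = σ.other := by cases τ <;> cases σ <;> simp_all [Charge.other]
    simp [fieldCount, this, Finset.filter_singleton] at ho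
  subst hκ hτ
  have hn : n ∈ sites a {((FermionKind.chi, τ, n) : Fermion)} := by simp [sites]
  simp only [toField, letterKind, mult, Finset.mem_singleton, Prod.mk.injEq, true_and]
  rw [Finset.sum_ite_eq' , if_pos hn]

/-- The coefficient of the CLR term contained in a functional. -/
def clrCoef (σ : Charge) (k : ℕ) (f : Functional) (m : Fin (k + 1) → ℤ) : ℂ :=
  (k.factorial : ℂ)⁻¹ * polar σ (chiPhiWord (m 0) fun j => m j.succ) (plainPart f)

/-- The normalisation is `1 / k!` rather than `1 / (k + 1)!`: the fixed first slot counts the unique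
`χ` once, by `sum_mult_chi`, and only the `k` factors `φ` are overcounted. -/
theorem siteSum_clrCoef {f : Functional} (hf : HasFermionNumber 1 f)
    (ho : ∀ a A, f a A ≠ 0 → fieldCount σ.other a A = 0) (k : ℕ) (a : Boson →₀ ℕ)
    (A : Finset Fermion) :
    siteSum (Fin.cons (.inr .chi, σ) fun _ : Fin k => (.inl .phi, σ)) (clrCoef σ k f) a A =
      if fieldCount σ a A = k + 1 then plainPart f a A else 0 := by
  rw [siteSum_cons _ _ _ (Finset.Subset.refl _)]
  have h1 : ∀ m : ℤ, (siteSum (fun _ : Fin k => ((.inl .phi, σ) : Species))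
      fun n => clrCoef σ k f (Fin.cons m n)) = fun a A => (k.factorial : ℂ)⁻¹ *
      wordSum σ k (fun l => polar σ l (derivField (toField σ (true, false, m)) (plainPart f)))
        a A := by
    intro m
    funext a A
    rw [← wordSum_smul, ← siteSum_phi]
    · rfl
    -- The leading `χ` uses up the single upper letter allowed at fermion number one without `F`,
    -- `χ̄`; all other letters must be `φ`.
    · rintro l ⟨x, hx, h⟩
      rw [mul_eq_zero]
      right
      change polar σ ((true, false, m) :: l) (plainPart f) = 0
      by_contra hne
      rw [polar_plainPart] at hne
      have hnt : true ∉ wordPattern ((true, false, m) :: l) := fun ht => hne (if_pos ht)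
      rw [if_neg hnt] at hne
      have h2 := hf.polar hne
      rw [wordFermion_eq, List.count_eq_zero.2 hnt] at h2
      have h3 : x.2.1 ≠ true := by
        intro h3
        apply hnt
        exact List.mem_map.2 ⟨x, List.mem_cons_of_mem _ hx, h3⟩
      have h4 : x.1 = true := h.resolve_right h3
      have h5 : 0 < l.countP fun x => x.1 := List.countP_pos_iff.2 ⟨x, hx, h4⟩
      rw [upperCount, List.countP_cons] at h2
      simp only [if_true] at h2
      omega
  simp only [h1]
  have hk : (k.factorial : ℂ) ≠ 0 := Nat.cast_ne_zero.2 (Nat.factorial_ne_zero k)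
  by_cases hother : fieldCount σ.other a A = 0
  · have h2 : ∀ m : ℤ, mulField ((.inr .chi, σ), m) (fun a A => (k.factorial : ℂ)⁻¹ *
        wordSum σ k (fun l => polar σ l (derivField (toField σ (true, false, m)) (plainPart f)))
          a A) a A = if fieldCount σ a A = k + 1 then
          (mult (toField σ (true, false, m)) a A : ℂ) * plainPart f a A else 0 := by
      intro m
      change mulField (toField σ (true, false, m)) _ a A = _
      by_cases hx : mult (toField σ (true, false, m)) a A = 0
      · rw [mulField_apply, (mulCoef_eq_zero_iff _ _ _).2 hx, hx]
        simp
      · have h3 := fieldCount_rem σ.other hx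
        have h4 := fieldCount_rem σ hx
        have h5 : (toField σ (true, false, m)).1.2 = σ := rfl
        rw [h5, if_neg (Charge.other_ne σ), add_zero] at h3
        rw [h5, if_pos rfl] at h4
        rw [mulField_apply, wordSum_polar _ _ (h3.trans hother), ← mulField_derivField,
          mulField_apply]
        by_cases h6 : fieldCount σ a A = k + 1
        · rw [if_pos h6, if_pos (by omega)]; field_simp
        · rw [if_neg h6, if_neg (by omega), mul_zero, mul_zero]
    simp only [h2]
    split
    · rw [← Finset.sum_mul, ← Nat.cast_sum]
      by_cases h0 : plainPart f a A = 0
      · rw [h0, mul_zero]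
      · have h3 : IsPlain a A := by
          by_contra h3
          exact h0 (if_neg h3)
        rw [sum_mult_chi h3 hother (hf.plainPart a A h0)]
        simp
    · simp
  · have h2 : plainPart f a A = 0 := by
      have : f a A = 0 := by
        by_contra h
        exact hother (ho a A h)
      simp [plainPart, this]
    rw [h2, ite_self]
    refine Finset.sum_eq_zero fun m _ => ?_
    change mulField (toField σ (true, false, m)) _ a A = _
    by_contra h
    rw [mulField_apply] at h
    have hx : mult (toField σ (true, false, m)) a A ≠ 0 := fun h3 =>
      left_ne_zero_of_mul h ((mulCoef_eq_zero_iff _ _ _).2 h3)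
    obtain ⟨-, h3, -⟩ :=
      exists_word_of_wordSum_ne_zero k (right_ne_zero_of_mul (right_ne_zero_of_mul h))
    have h4 := fieldCount_rem σ.other hx
    have h5 : (toField σ (true, false, m)).1.2 = σ := rfl
    rw [h5, if_neg (Charge.other_ne σ), add_zero] at h4
    exact hother (h4.symm.trans h3)

theorem polar_plainPart_shiftWord {f : Functional} (hf : TranslationInvariant f) (k : ℤ)
    (l : List Letter) : polar σ (shiftWord k l) (plainPart f) = polar σ l (plainPart f) := by
  rw [polar_plainPart, polar_plainPart, hf.polar_shiftWord, wordPattern_shiftWord]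

theorem isTILC_clrCoef {f : Functional} (hf : TranslationInvariant f) (hM : 0 < M) (hL : 0 ≤ L)
    (hd : SiteDamped M L f) (k : ℕ) : IsTILC (clrCoef σ k f) := by
  have h := isTILC_of_word (I := k) (Fin.cons (true, false) fun _ => (false, false))
    (c := fun l => (k.factorial : ℂ)⁻¹ * polar σ l (plainPart f))
    (L := ‖(k.factorial : ℂ)⁻¹‖ * ((k + 1 + 1).factorial * L))
    (fun k l => by rw [polar_plainPart_shiftWord hf]) hM (by positivity) (fun x l hl y hy => by
      rw [norm_mul, mul_assoc]
      refine mul_le_mul_of_nonneg_left ?_ (norm_nonneg _)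
      have h1 := hd.norm_polar_le (σ := σ) hL (l := x :: l) List.mem_cons_self
        (List.mem_cons_of_mem _ hy)
      rw [List.length_cons, hl] at h1
      rw [polar_plainPart]
      split
      · rw [norm_zero]; positivity
      · exact h1)
  have e : clrCoef σ k f = fun m => (k.factorial : ℂ)⁻¹ * polar σ (List.ofFn fun i =>
      (((Fin.cons (true, false) fun _ => (false, false) : Fin (k + 1) → Bool × Bool) i).1,
        ((Fin.cons (true, false) fun _ => (false, false) : Fin (k + 1) → Bool × Bool) i).2, m i))
      (plainPart f) := by
    funext m
    rw [clrCoef, List.ofFn_succ]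
    simp
  rw [e]
  exact h

/-- Closedness of the plain part, evaluated on a word of `k + 1` letters `φ`, is the cyclic Leibniz
rule; no signs arise because each term has only one fermion. -/
theorem isCLR_clrCoef {f : Functional} (hγ : γ false ≠ 0) (hcl : susyOp D γ σ f = 0) (k : ℕ) :
    IsCLR D (clrCoef σ k f) where
  symmetric m n π := by
    simp only [clrCoef, Fin.cons_zero, Fin.cons_succ]
    congr 1
    refine polar_perm (List.Perm.cons _ ?_) fsign_of_mem_chiPhiWord _
    exact Equiv.Perm.ofFn_comp_perm π (fun j => ((false, false, n j) : Letter))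
  cyclic n := by
    have h := wordDiff_polar_plainPart hcl (List.ofFn fun i => (false, false, n i))
    rw [wordDiff_phi, ← Finset.mul_sum] at h
    have h1 := (mul_eq_zero.1 h).resolve_left hγ
    have h2 : ∀ p m, D m (n p) * clrCoef σ k f (Fin.cons m fun j : Fin k => n (p + j.succ)) =
        (k.factorial : ℂ)⁻¹ * (D m (n p) * polar σ (List.ofFn (Function.update
          (fun j => ((false, false, n j) : Letter)) p (true, false, m))) (plainPart f)) := by
      intro p m
      rw [← polar_perm (perm_update_chiPhiWord n p m) fsign_of_mem_chiPhiWord, clrCoef]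
      simp only [Fin.cons_zero, Fin.cons_succ]
      ring
    simp only [h2, tsum_mul_left]
    rw [← Finset.mul_sum, h1, mul_zero]

end

/-! ### The supersymmetries on functionals of one label. -/

noncomputable section

variable {D : ℤ → ℤ → ℂ} {M L : ℝ} {γ : Bool → ℂ} {σ : Charge}

/-- For a fixed monomial, multiplication at site `n` vanishes unless `n` occurs in it. The double
sum is thus a finite family of sums over `m`, each convergent because the derivatives are bounded.
-/
theorem tsum_kernel_mulField (hD : IsDampedKernel D M L) {f : Functional} (hf : DerivBounded f)
    (t : Bool) (a : Boson →₀ ℕ) (A : Finset Fermion) :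
    ∑' p : ℤ × ℤ, D p.1 p.2 * mulField (toField σ (false, t, p.2))
        (derivField (toField σ (true, t, p.1)) f) a A =
      ∑ n ∈ sites a A, mulField (toField σ (false, t, n))
        (fun a A => ∑' m, D m n * derivField (toField σ (true, t, m)) f a A) a A := by
  apply HasSum.tsum_eq
  have h1 : ∀ n, HasSum (fun p : ℤ × ℤ => if p.2 = n then D p.1 p.2 *
      mulField (toField σ (false, t, p.2)) (derivField (toField σ (true, t, p.1)) f) a A else 0)
      (mulField (toField σ (false, t, n))
        (fun a A => ∑' m, D m n * derivField (toField σ (true, t, m)) f a A) a A) := by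
    intro n
    have hinj : Function.Injective fun m : ℤ => (m, n) := fun m m' h => (Prod.ext_iff.1 h).1
    rw [← hinj.hasSum_iff]
    · simp only [Function.comp_def, if_true, mulField_apply]
      obtain ⟨B, hB⟩ := hf (remB (toField σ (false, t, n)) a) (remF (toField σ (false, t, n)) A)
      have := ((hD.summable_mul n fun m => hB (toField σ (true, t, m))).hasSum).mul_left
        (mulCoef (toField σ (false, t, n)) a A)
      refine this.congr_fun ?_
      intro m
      ring
    · rintro ⟨m, n'⟩ h
      rw [if_neg]
      rintro rfl
      exact h ⟨m, rfl⟩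
  refine (hasSum_sum fun n (_ : n ∈ sites a A) => h1 n).congr_fun ?_
  rintro ⟨m, n⟩
  rw [Finset.sum_ite_eq]
  split
  · rfl
  · next h => rw [mulField_eq_zero h, mul_zero]

theorem derivField_eq_zero_of_ne {f : Functional}
    (ho : ∀ a A, f a A ≠ 0 → fieldCount σ.other a A = 0) {v : Species × ℤ} (hv : v.1.2 = σ.other) :
    derivField v f = fun _ _ => 0 := by
  funext a A
  rw [derivField_apply]
  by_contra h
  have h1 := ho _ _ (right_ne_zero_of_mul h)
  rw [fieldCount_add _ (left_ne_zero_of_mul h), if_pos hv] at h1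
  omega

theorem mulField_zero (v : Species × ℤ) (a : Boson →₀ ℕ) (A : Finset Fermion) :
    mulField v (fun _ _ => 0) a A = 0 := by
  rw [mulField_apply, mul_zero]

theorem susyOp_eq_tsum (hD : IsDampedKernel D M L) {f : Functional} (hf : DerivBounded f)
    (a : Boson →₀ ℕ) (A : Finset Fermion) :
    susyOp D γ σ f a A = ∑ t, γ t * ∑' p : ℤ × ℤ, D p.1 p.2 *
      mulField (toField σ (false, t, p.2)) (derivField (toField σ (true, t, p.1)) f) a A := by
  unfold susyOp
  rw [Finset.sum_product]
  refine Finset.sum_congr rfl fun t _ => ?_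
  rw [tsum_kernel_mulField hD hf, Finset.mul_sum]
  refine Finset.sum_congr rfl fun n _ => ?_
  rw [mulField_apply, mulField_apply, slotOp]
  ring

/-- Derivatives with respect to fields of label `-` vanish on `f`; the two surviving terms have
factor `i` for `χ` and `-i` for `F`. -/
theorem Qminus_eq_susyOp (hD : IsDampedKernel D M L) {f : Functional} (hf : DerivBounded f)
    (ho : ∀ a A, f a A ≠ 0 → fieldCount .minus a A = 0) :
    Qminus D f = susyOp D (fun t => if t then -Complex.I else Complex.I) .plus f := by
  funext a A
  rw [susyOp_eq_tsum hD hf, Fintype.sum_bool]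
  have h1 : ∀ n, mulFermion (.chiBar, .minus, n) (derivBoson (.phi, .minus, n) f) a A = 0 := by
    intro n
    have := derivField_eq_zero_of_ne (σ := .plus) ho (v := ((.inl .phi, .minus), n)) rfl
    change derivBoson _ f = _ at this
    rw [this]
    exact mulField_zero ((.inr .chiBar, .minus), n) a A
  have h2 : ∀ n, mulBoson (.aux, .minus, n) (derivFermion (.chi, .minus, n) f) a A = 0 := by
    intro n
    have := derivField_eq_zero_of_ne (σ := .plus) ho (v := ((.inr .chi, .minus), n)) rfl
    change derivFermion _ f = _ at this
    rw [this]
    exact mulField_zero ((.inl .aux, .minus), n) a A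
  unfold Qminus
  simp only [h1, h2, tsum_zero, toField, letterKind, mulField, derivField]
  simp only [Bool.false_eq_true, if_true, if_false]
  ring

theorem Qplus_eq_susyOp (hD : IsDampedKernel D M L) {f : Functional} (hf : DerivBounded f)
    (ho : ∀ a A, f a A ≠ 0 → fieldCount .plus a A = 0) :
    Qplus D f = susyOp D (fun _ => -Complex.I) .minus f := by
  funext a A
  rw [susyOp_eq_tsum hD hf, Fintype.sum_bool]
  have h1 : ∀ n, mulFermion (.chiBar, .plus, n) (derivBoson (.phi, .plus, n) f) a A = 0 := by
    intro n
    have := derivField_eq_zero_of_ne (σ := .minus) ho (v := ((.inl .phi, .plus), n)) rfl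
    change derivBoson _ f = _ at this
    rw [this]
    exact mulField_zero ((.inr .chiBar, .plus), n) a A
  have h2 : ∀ n, mulBoson (.aux, .plus, n) (derivFermion (.chi, .plus, n) f) a A = 0 := by
    intro n
    have := derivField_eq_zero_of_ne (σ := .minus) ho (v := ((.inr .chi, .plus), n)) rfl
    change derivFermion _ f = _ at this
    rw [this]
    exact mulField_zero ((.inl .aux, .plus), n) a A
  unfold Qplus
  simp only [h1, h2, tsum_zero, toField, letterKind, mulField, derivField]
  ring

theorem mult_add_ne_zero {v : Species × ℤ} (a : Boson →₀ ℕ) (A : Finset Fermion) :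
    mult v (addB v a) (addF v A) ≠ 0 := by
  obtain ⟨⟨b | ψ, τ⟩, n⟩ := v
  · simp [mult, addB]
  · simp [mult, addF]

theorem SiteDamped.derivBounded {f : Functional} (hf : SiteDamped M L f) : DerivBounded f := by
  refine derivBounded_of_bounded fun a A => ⟨L, fun v => ?_⟩
  have := hf _ _ v v (mult_add_ne_zero a A) (mult_add_ne_zero a A)
  simpa using this

theorem DerivBounded.add {f g : Functional} (hf : DerivBounded f) (hg : DerivBounded g) :
    DerivBounded (f + g) := by
  intro a A
  obtain ⟨B, hB⟩ := hf a A
  obtain ⟨B', hB'⟩ := hg a A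
  refine ⟨B + B', fun v => ?_⟩
  have h : derivField v (f + g) a A = derivField v f a A + derivField v g a A := by
    simp only [derivField_apply, Pi.add_apply, mul_add]
  rw [h]
  exact (norm_add_le _ _).trans (add_le_add (hB v) (hB' v))

theorem DerivBounded.zero : DerivBounded 0 := fun a A => ⟨0, fun v => by
  rw [derivField_apply]; simp⟩

theorem susyOp_add (hD : IsDampedKernel D M L) {f g : Functional} (hf : DerivBounded f)
    (hg : DerivBounded g) : susyOp D γ σ (f + g) = susyOp D γ σ f + susyOp D γ σ g := by
  funext a A
  simp only [susyOp, Pi.add_apply]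
  rw [← Finset.sum_add_distrib]
  refine Finset.sum_congr rfl fun p _ => ?_
  simp only [mulField_apply]
  rw [← mul_add]
  congr 1
  unfold slotOp
  obtain ⟨B, hB⟩ := hf (remB (toField σ (false, p.1, p.2)) a) (remF (toField σ (false, p.1, p.2)) A)
  obtain ⟨B', hB'⟩ := hg (remB (toField σ (false, p.1, p.2)) a)
    (remF (toField σ (false, p.1, p.2)) A)
  rw [← mul_add, ← (hD.summable_mul p.2 fun m => hB _).tsum_add
    (hD.summable_mul p.2 fun m => hB' _)]
  congr 2
  funext m
  simp only [derivField_apply, Pi.add_apply]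
  ring

theorem susyOp_sum (hD : IsDampedKernel D M L) (S : Finset ℕ) {f : ℕ → Functional}
    (hf : ∀ k, DerivBounded (f k)) : DerivBounded (∑ k ∈ S, f k) ∧
      susyOp D γ σ (∑ k ∈ S, f k) = ∑ k ∈ S, susyOp D γ σ (f k) := by
  induction S using Finset.induction_on with
  | empty =>
    refine ⟨DerivBounded.zero, ?_⟩
    funext a A
    simp [susyOp, slotOp, mulField_apply, derivField_apply]
  | insert k S hk ih =>
    rw [Finset.sum_insert hk, Finset.sum_insert hk, susyOp_add hD (hf k) ih.1, ih.2]
    exact ⟨(hf k).add ih.1, rfl⟩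

theorem IsDifferenceOperator.exists_isDampedKernel (hD : IsDifferenceOperator D) :
    ∃ M L, IsDampedKernel D M L := by
  obtain ⟨M, hM, L, hL, h⟩ := hD.tilc.exists_pair_bound
  refine ⟨M, L, hM, fun m n k => ?_, fun m n => ?_⟩
  · have := hD.tilc.shift k ![m, n]
    simpa using this
  · have := h ![m, n] 0 1
    simpa using this

end

/-! ### Primitives order by order and the decomposition. -/

noncomputable section

variable {D : ℤ → ℤ → ℂ} {M L : ℝ} {γ : Bool → ℂ} {σ : Charge}

/-- The farthest letter carries at least the average of the weight, which divides the rate by the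
length. The added letter at the origin covers words of weight zero, including the empty one. -/
theorem exp_le_exp_wordWeight (hM : 0 < M) (l : List Letter) :
    ∃ y ∈ ((true, true, 0) :: l : List Letter), Real.exp (-M * |(y.2.2 : ℝ)|) ≤
      Real.exp (-(M / (l.length + 1)) * wordWeight l) := by
  have hk : (0 : ℝ) < (l.length : ℝ) + 1 := by positivity
  obtain h | ⟨y, hy, h⟩ := exists_wordWeight_le l
  · exact ⟨(true, true, 0), List.mem_cons_self, by rw [h]; simp⟩
  · refine ⟨y, List.mem_cons_of_mem _ hy, Real.exp_le_exp.2 ?_⟩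
    have h1 : wordWeight l ≤ (l.length + 1) * |(y.2.2 : ℝ)| := by
      have := abs_nonneg (y.2.2 : ℝ)
      linarith
    have h2 : M / (l.length + 1) * wordWeight l ≤
        M / (l.length + 1) * ((l.length + 1) * |(y.2.2 : ℝ)|) :=
      mul_le_mul_of_nonneg_left h1 (by positivity)
    have h3 : M / (l.length + 1) * ((l.length + 1) * |(y.2.2 : ℝ)|) = M * |(y.2.2 : ℝ)| := by
      field_simp
    linarith

theorem SiteDamped.norm_polar_cons_le {f : Functional} (hf : SiteDamped M L f) (hM : 0 < M)
    (hL : 0 ≤ L) (κ t : Bool) (l : List Letter) :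
    ‖polar σ ((κ, t, 0) :: l) f‖ ≤ (l.length + 2).factorial * L *
      Real.exp (-(M / (l.length + 1)) * wordWeight l) := by
  obtain ⟨y, hy, h⟩ := exp_le_exp_wordWeight hM l
  have h0 : ∃ z ∈ ((κ, t, 0) :: l : List Letter), z.2.2 = y.2.2 := by
    obtain rfl | hy := List.mem_cons.1 hy
    · exact ⟨_, List.mem_cons_self, rfl⟩
    · exact ⟨y, List.mem_cons_of_mem _ hy, rfl⟩
  obtain ⟨z, hz, hzy⟩ := h0
  refine (hf.norm_polar_le hL List.mem_cons_self hz).trans ?_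
  rw [List.length_cons]
  refine mul_le_mul_of_nonneg_left ?_ (by positivity)
  simpa [hzy] using h

theorem polar_sub_plainPart (l : List Letter) (f : Functional) :
    polar σ l (f - plainPart f) = if true ∈ wordPattern l then polar σ l f else 0 := by
  obtain ⟨a, A, K, -, h, -, -⟩ := exists_polar_eq (σ := σ) l
  have h1 := polar_plainPart (σ := σ) l f
  have h2 : polar σ l (f - plainPart f) = polar σ l f - polar σ l (plainPart f) := by
    simp only [h, Pi.sub_apply, mul_sub]
  rw [h2, h1]
  split <;> simp

/-- The homogeneous parts of a closed functional of fermion number one are exact up to their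
part in the fields `φ` and `χ`. -/
theorem exists_susyOp_primitive (hD : IsDampedKernel D M L) (hD0 : D ≠ 0) (hγ : ∀ t, γ t ≠ 0)
    {f : Functional} (hti : TranslationInvariant f) {M' L' : ℝ} (hM : 0 < M') (hL : 0 ≤ L')
    (hd : SiteDamped M' L' f) (hN : HasFermionNumber 1 f)
    (ho : ∀ a A, f a A ≠ 0 → fieldCount σ.other a A = 0) (hcl : susyOp D γ σ f = 0) (k : ℕ) :
    ∃ Q : Functional, IsLocal Q ∧ DerivBounded Q ∧ HasFermionNumber 2 Q ∧
      (∀ a A, Q a A ≠ 0 → fieldCount σ a A = k + 1 ∧ fieldCount σ.other a A = 0) ∧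
      ∀ a A, susyOp D γ σ Q a A =
        if fieldCount σ a A = k + 1 then f a A - plainPart f a A else 0 := by
  -- The cutoff selects order `k + 1` and words containing `F` or `χ̄`; as a function of the pattern
  -- it preserves closedness.
  let g : List Bool → ℂ := fun p => if p.length = k + 1 ∧ true ∈ p then 1 else 0
  let c : List Letter → ℂ := fun l => g (l.map fun x => x.2.1) * polar σ l f
  have hc : ∀ l, c l ≠ 0 → l.length = k + 1 ∧ true ∈ wordPattern l ∧ wordFermion l = 1 := by
    intro l h
    have h1 : (wordPattern l).length = k + 1 ∧ true ∈ wordPattern l := by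
      by_contra h2
      exact left_ne_zero_of_mul h (if_neg h2)
    rw [List.length_map] at h1
    exact ⟨h1.1, h1.2, hN.polar (right_ne_zero_of_mul h)⟩
  have hg : ∀ p, ‖g p‖ ≤ 1 := by
    intro p
    simp only [g]
    split <;> simp
  have hshift : ∀ j l, c (shiftWord j l) = c l := by
    intro j l
    simp only [c]
    rw [hti.polar_shiftWord]
    congr 2
    exact wordPattern_shiftWord j l
  have hup : ∀ l, c l ≠ 0 → 2 ≤ upperCount l := by
    intro l h
    obtain ⟨-, h1, h2⟩ := hc l h
    rw [wordFermion_eq] at h2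
    have := List.count_pos_iff.2 h1
    omega
  have hdec : ∀ κ t, Damped (M' / (k + 1)) ((k + 2).factorial * L') fun l =>
      c ((κ, t, 0) :: l) := by
    intro κ t l
    change ‖c ((κ, t, 0) :: l)‖ ≤ _
    by_cases h : c ((κ, t, 0) :: l) = 0
    · rw [h, norm_zero]; positivity
    · have h1 : l.length = k := by simpa using (hc _ h).1
      have h2 := hd.norm_polar_cons_le (σ := σ) hM hL κ t l
      rw [h1] at h2
      simp only [c]
      rw [norm_mul]
      exact (mul_le_of_le_one_left (norm_nonneg _) (hg _)).trans h2
  have hclc : ∀ l, wordDiff D γ l c = 0 := by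
    intro l
    rw [wordDiff_mul_pattern g l fun l' => polar σ l' f, ← polar_susyOp, hcl, polar_zero, mul_zero]
  obtain ⟨b, hbshift, hb, ⟨R, hR, B, hbB⟩, hbc⟩ := exists_word_primitive hD hD0 hγ hshift
    (fun l h => (hc l h).1) hup (by positivity : 0 < M' / ((k : ℝ) + 1)) hdec hclc
  have hB : 0 ≤ B := (hbB true true).nonneg
  have hbb : ∀ l, ‖b l‖ ≤ B := by
    intro l
    cases l with
    | nil =>
      have : b [] = 0 := by
        by_contra h
        obtain ⟨l', -, h, -⟩ := hb [] h
        simp [upperCount] at h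
      rw [this, norm_zero]
      exact hB
    | cons x l =>
      rw [cons_eq_cons_zero hbshift]
      exact (hbB _ _).norm_le hR.le _
  have hk : ((k + 1).factorial : ℂ) ≠ 0 := Nat.cast_ne_zero.2 (Nat.factorial_ne_zero _)
  -- This compensates the factorial with which `wordSum` of the polarised coefficients reproduces a
  -- functional.
  let w : ℂ := ((k + 1).factorial : ℂ)⁻¹
  refine ⟨wordSum σ (k + 1) fun l => w * b l, ?_, ?_, ?_, ?_, ?_⟩
  · refine isLocal_wordSum k (fun j l => by rw [hbshift]) hR (L := ‖w‖ * B) (by positivity) ?_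
    intro x l _ y hy
    rw [norm_mul, mul_assoc]
    exact mul_le_mul_of_nonneg_left (norm_cons_le_of_damped hbshift hR hbB x l y hy)
      (norm_nonneg _)
  · refine derivBounded_wordSum (k + 1) (B := ‖w‖ * B) fun l => ?_
    rw [norm_mul]
    exact mul_le_mul_of_nonneg_left (hbb l) (norm_nonneg _)
  · intro a A h
    obtain ⟨-, -, l, -, h2, h3⟩ := exists_word_of_wordSum_ne_zero _ h
    obtain ⟨l', h4, h5, h6⟩ := hb l (right_ne_zero_of_mul h3)
    have h7 := (hc l' h6).2.2
    rw [wordFermion_eq, h4] at h7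
    rw [← h2, wordFermion_eq]
    omega
  · intro a A h
    obtain ⟨h1, h2, -⟩ := exists_word_of_wordSum_ne_zero _ h
    exact ⟨h1, h2⟩
  · intro a A
    rw [susyOp_wordSum hD (B := ‖w‖ * B) _ (fun l => by
      rw [norm_mul]
      exact mul_le_mul_of_nonneg_left (hbb l) (norm_nonneg _))]
    have h1 : wordSum σ (k + 1) (fun l => wordDiff D γ l fun l' => w * b l') a A =
        w * wordSum σ (k + 1) (fun l => polar σ l (f - plainPart f)) a A := by
      rw [← wordSum_smul]
      refine wordSum_congr _ (fun l hl => ?_) a A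
      rw [wordDiff_smul, hbc, polar_sub_plainPart]
      simp only [c, g, List.length_map, hl, true_and]
      split <;> simp
    rw [h1]
    by_cases hother : fieldCount σ.other a A = 0
    · rw [wordSum_polar _ _ hother]
      split
      · simp only [w, Pi.sub_apply]
        field_simp
      · simp
    · have h2 : wordSum σ (k + 1) (fun l => polar σ l (f - plainPart f)) a A = 0 := by
        by_contra h
        exact hother (exists_word_of_wordSum_ne_zero _ h).2.1
      have h3 : f a A = 0 := by
        by_contra h
        exact hother (ho a A h)
      rw [h2, mul_zero, plainPart, h3]
      simp

/-- The homogeneous parts of `f` need not be shown local first: for each `k` the coefficient and the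
primitive are extracted from the whole `f`, and the orders are added at the end. -/
theorem exists_clr_decomposition (hD : IsDampedKernel D M L) (hD0 : D ≠ 0) (hγ : ∀ t, γ t ≠ 0)
    (S : Finset ℕ) {f : Functional} (hf : IsLocal f) (hN : HasFermionNumber 1 f)
    (hS : ∀ a A, f a A ≠ 0 → (∃ k ∈ S, fieldCount σ a A = k + 1) ∧ fieldCount σ.other a A = 0)
    (hcl : susyOp D γ σ f = 0) :
    ∃ (c : ℕ → Functional) (Q : Functional), (∀ k ∈ S, IsCLRTerm D σ k (c k)) ∧
      IsLocal Q ∧ DerivBounded Q ∧ HasFermionNumber 2 Q ∧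
      (∀ a A, Q a A ≠ 0 → (∃ k ∈ S, fieldCount σ a A = k + 1) ∧ fieldCount σ.other a A = 0) ∧
      f = (∑ k ∈ S, c k) + susyOp D γ σ Q := by
  have ho : ∀ a A, f a A ≠ 0 → fieldCount σ.other a A = 0 := fun a A h => (hS a A h).2
  obtain ⟨M', hM, L', hL, hd⟩ := hf.exists_siteDamped
  have hti := hf.translationInvariant
  choose q hq1 hq2 hq3 hq4 hq5 using
    exists_susyOp_primitive hD hD0 hγ hti hM hL hd hN ho hcl
  have hsum : ∀ a A, (∑ k ∈ S, q k) a A ≠ 0 → ∃ k ∈ S, q k a A ≠ 0 := by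
    intro a A h
    rw [Finset.sum_apply, Finset.sum_apply] at h
    exact Finset.exists_ne_zero_of_sum_ne_zero h
  refine ⟨fun k => siteSum (Fin.cons (.inr .chi, σ) fun _ : Fin k => (.inl .phi, σ))
    (clrCoef σ k f), ∑ k ∈ S, q k, fun k _ => ⟨_, isTILC_clrCoef hti hM hL hd k,
      isCLR_clrCoef (hγ false) hcl k, rfl⟩, Submodule.sum_mem _ fun k _ => hq1 k,
    (susyOp_sum (γ := γ) (σ := σ) hD S hq2).1, ?_, ?_, ?_⟩
  · intro a A h
    obtain ⟨k, -, h⟩ := hsum a A h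
    exact hq3 k a A h
  · intro a A h
    obtain ⟨k, hk, h⟩ := hsum a A h
    exact ⟨⟨k, hk, (hq4 k a A h).1⟩, (hq4 k a A h).2⟩
  · rw [(susyOp_sum hD S hq2).2, ← Finset.sum_add_distrib]
    funext a A
    rw [Finset.sum_apply, Finset.sum_apply]
    have h1 : ∀ k, (siteSum (Fin.cons (.inr .chi, σ) fun _ : Fin k => (.inl .phi, σ))
        (clrCoef σ k f) + susyOp D γ σ (q k)) a A =
        if fieldCount σ a A = k + 1 then f a A else 0 := by
      intro k
      rw [Pi.add_apply, Pi.add_apply, siteSum_clrCoef hN ho, hq5]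
      split <;> simp
    simp only [h1]
    by_cases h : f a A = 0
    · simp [h]
    · obtain ⟨⟨k, hk, h2⟩, -⟩ := hS a A h
      rw [Finset.sum_eq_single_of_mem k hk, if_pos h2]
      intro j _ hj
      rw [if_neg]
      omega

end
end LatticeSUSY

/-! ### The theorem for both labels. -/

open LatticeSUSY
theorem theorem1 (D : ℤ → ℤ → ℂ) (hD : IsDifferenceOperator D) (S : Finset ℕ) :
    (∀ P : Functional, IsLocal P → InSector {t | (∃ k ∈ S, t.1 = k + 1) ∧ t.2 = 0} P →
      HasFermionNumber 1 P → Qminus D P = 0 →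
      ∃ (c : ℕ → Functional) (Q : Functional),
        (∀ k ∈ S, IsCLRTerm D .plus k (c k)) ∧
        IsLocal Q ∧ InSector {t | (∃ k ∈ S, t.1 = k + 1) ∧ t.2 = 0} Q ∧
        HasFermionNumber 2 Q ∧
        P = (∑ k ∈ S, c k) + Qminus D Q) ∧
    (∀ P : Functional, IsLocal P → InSector {t | t.1 = 0 ∧ ∃ k ∈ S, t.2 = k + 1} P →
      HasFermionNumber 1 P → Qplus D P = 0 →
      ∃ (c : ℕ → Functional) (Q : Functional),
        (∀ k ∈ S, IsCLRTerm D .minus k (c k)) ∧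
        IsLocal Q ∧ InSector {t | t.1 = 0 ∧ ∃ k ∈ S, t.2 = k + 1} Q ∧
        HasFermionNumber 2 Q ∧
        P = (∑ k ∈ S, c k) + Qplus D Q) := by
  obtain ⟨M, L, hK⟩ := hD.exists_isDampedKernel
  constructor
  · intro P hP hS hN hcl
    obtain ⟨M', -, L', -, hd⟩ := hP.exists_siteDamped
    rw [Qminus_eq_susyOp hK hd.derivBounded fun a A h => (hS a A h).2] at hcl
    obtain ⟨c, Q, hc, hQ, hb, hN', hS', h⟩ := exists_clr_decomposition hK hD.ne_zero
      (fun t => by cases t <;> simp) S hP hN hS hcl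
    refine ⟨c, Q, hc, hQ, hS', hN', ?_⟩
    rw [Qminus_eq_susyOp hK hb fun a A h => (hS' a A h).2]
    exact h
  · intro P hP hS hN hcl
    obtain ⟨M', -, L', -, hd⟩ := hP.exists_siteDamped
    rw [Qplus_eq_susyOp hK hd.derivBounded fun a A h => (hS a A h).1] at hcl
    obtain ⟨c, Q, hc, hQ, hb, hN', hS', h⟩ := exists_clr_decomposition hK hD.ne_zero
      (fun t => by simp) S hP hN (fun a A h => (hS a A h).symm) hcl
    refine ⟨c, Q, hc, hQ, fun a A h => (hS' a A h).symm, hN', ?_⟩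
    rw [Qplus_eq_susyOp hK hb fun a A h => (hS' a A h).2]
    exact h
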